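/- Let $\Bbbk$ be a field and let $(V,c)$ be a finite-dimensional rigid braided vector space: $c\in\operatorname{Aut}(V\otimes V)$ satisfies the braid equation $(c\otimes\mathrm{id})(\mathrm{id}\otimes c)(c\otimes\mathrm{id})=(\mathrm{id}\otimes c)(c\otimes\mathrm{id})(\mathrm{id}\otimes c)$, and, for a basis $x_1,\dots,x_n$ of $V$ with dual basis $x_1^*,\dots,x_n^*$, the map $c^\flat:V^*\otimes V\to V\otimes V^*$, $c^\flat(f\otimes x)=\sum_i (f\otimes\mathrm{id})(c(x\otimes x_i))\otimes x_i^*$, is invertible. Write $c(x_i\otimes x_j)=\sum_{k,\ell}c_{ij}^{k\ell}\,x_k\otimes x_\ell$, and let $A(c)$ be the FRT bialgebra: the algebra generated by $t_i^j$ $(1\le i,j\le n)$ with relations $\sum_{k,\ell}c_{ij}^{k\ell}t_k^rt_\ell^s=\sum_{k,\ell}t_i^kt_j^\ell c_{k\ell}^{rs}$ for all $i,j,r,s$, with $\Delta(t_i^j)=\sum_k t_i^k\otimes t_k^j$ and $\varepsilon(t_i^j)=\delta_{ij}$. It coacts on $V$ by $\lambda(x_i)=\sum_j t_i^j\otimes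 x_j$. Let $\mathcal B=\bigoplus_{m\ge0}\mathcal B^m$ be a weakly graded-Frobenius algebra for $A(c)$: a finite-dimensional graded left $A(c)$-comodule algebra (each $\mathcal B^m$ is a subcomodule) with $\mathcal B^0=\Bbbk$, $\mathcal B^1=V$ as comodules, $\dim\mathcal B^{top}=1$ for $top=\max\{m:\mathcal B^m\ne0\}$, and such that the multiplications $\mathcal B^1\times\mathcal B^{top-1}\to\mathcal B^{top}$ and $\mathcal B^{top-1}\times\mathcal B^1\to\mathcal B^{top}$ are non-degenerate. Choose $0\ne\mathfrak b\in\mathcal B^{top}$, and let the quantum determinant $D\in A(c)$ be the group-like element with $\lambda(\mathfrak b)=D\otimes\mathfrak b$. Let $\omega^1,\dots,\omega^n\in\mathcal B^{top-1}$ be the basis with $x_i\omega^j=\delta_i^j\mathfrak b$, and define $T_i^j\in A(c)$ by $\lambda(\omega^i)=\sum_j T_j^i\otimes\omega^j$. Let $H(c)=A(c)[D^{-1}]$ be the localization of $A(c)$ at $D$ (the universal algebra under $A(c)$ in which $D$ is invertible), with the bialgebra structure that extends the one of $A(c)$ and in which $D^{-1}$ is group-like, and let $\iota:A(c)\to H(c)$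 be the canonical map. **Theorem.** If $\iota$ is injective, then the category of finite-dimensional left $H(c)$-comodules is rigid (every object has a left and a right dual) and is tensorially generated by $V$ and $\Bbbk D^{-1}$, that is, every object is a subquotient of a finite direct sum of tensor products of copies of $V$ and $\Bbbk D^{-1}$ (the empty product being the unit object $\Bbbk$). Moreover, $H(c)$ is a coquasitriangular Hopf algebra: it has an antipode $\mathcal S$ and a convolution-invertible bilinear form $r:H(c)\times H(c)\to\Bbbk$ with $r(ab,d)=r(a,d_{(1)})r(b,d_{(2)})$, $r(a,bd)=r(a_{(2)},b)r(a_{(1)},d)$ and $r(a_{(1)},b_{(1)})a_{(2)}b_{(2)}=b_{(1)}a_{(1)}r(a_{(2)},b_{(2)})$ for all $a,b,d$, and with $r(\iota(t_i^k),\iota(t_j^\ell))=c_{ji}^{k\ell}$. The antipode is given on generators by $\mathcal S(D^{-1})=\iota(D)$ and $\mathcal S(\iota(t_i^j))=\iota(T_i^j)D^{-1}$ for all $1\le i,j\le n$. -/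

import Mathlib

open scoped TensorProduct

universe u v w z

noncomputable section

namespace QDet

/-! ### Braided vector spaces -/

section Braided

variable {k : Type u} [Field k] {V : Type v} [AddCommGroup V] [Module k V]

/-- `c ⊗ id` on `(V ⊗ V) ⊗ V`. -/
def braidLeft (c : V ⊗[k] V ≃ₗ[k] V ⊗[k] V) : (V ⊗[k] V) ⊗[k] V →ₗ[k] (V ⊗[k] V) ⊗[k] V :=
  LinearMap.rTensor V c.toLinearMap

/-- `id ⊗ c` on `(V ⊗ V) ⊗ V` (up to the associator). -/
def braidRight (c : V ⊗[k] V ≃ₗ[k] V ⊗[k] V) : (V ⊗[k] V) ⊗[k] V →ₗ[k] (V ⊗[k] V) ⊗[k] V :=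
  (TensorProduct.assoc k V V V).symm.toLinearMap ∘ₗ LinearMap.lTensor V c.toLinearMap ∘ₗ
    (TensorProduct.assoc k V V V).toLinearMap

/-- The braid equation `(c ⊗ id)(id ⊗ c)(c ⊗ id) = (id ⊗ c)(c ⊗ id)(id ⊗ c)`. -/
def IsBraiding (c : V ⊗[k] V ≃ₗ[k] V ⊗[k] V) : Prop :=
  braidLeft c ∘ₗ braidRight c ∘ₗ braidLeft c = braidRight c ∘ₗ braidLeft c ∘ₗ braidRight c

variable {ι : Type w} [Fintype ι]

/-- The map `c♭ : V* ⊗ V → V ⊗ V*`,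
`c♭ (f ⊗ y) = ∑ i, (f ⊗ id) (c (y ⊗ x i)) ⊗ (x i)*`. -/
def flat (x : Module.Basis ι k V) (c : V ⊗[k] V ≃ₗ[k] V ⊗[k] V) :
    Module.Dual k V ⊗[k] V →ₗ[k] V ⊗[k] Module.Dual k V :=
  TensorProduct.lift (LinearMap.mk₂ k
    (fun f y => ∑ i, (TensorProduct.lid k V (LinearMap.rTensor V f (c (y ⊗ₜ[k] x i)))) ⊗ₜ[k]
      x.coord i)
    (fun f g y => by
      simp [LinearMap.rTensor_add, TensorProduct.add_tmul, Finset.sum_add_distrib])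
    (fun a f y => by
      simp [LinearMap.rTensor_smul, TensorProduct.smul_tmul', Finset.smul_sum])
    (fun f y y' => by
      simp [TensorProduct.add_tmul, Finset.sum_add_distrib])
    (fun a f y => by
      simp [← TensorProduct.smul_tmul', Finset.smul_sum]))

/-- The braiding is rigid: `c♭` is invertible. -/
def IsRigidBraiding (x : Module.Basis ι k V) (c : V ⊗[k] V ≃ₗ[k] V ⊗[k] V) : Prop :=
  Function.Bijective (flat x c)

/-- The structure constants: `c (x i ⊗ x j) = ∑ p q, coeffs x c i j p q • (x p ⊗ x q)`. -/
def coeffs (x : Module.Basis ι k V) (c : V ⊗[k] V ≃ₗ[k] V ⊗[k] V) (i j p q : ι) : k :=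
  (x.tensorProduct x).repr (c (x i ⊗ₜ[k] x j)) (p, q)

end Braided

/-! ### The FRT bialgebra -/

section FRT

variable {k : Type u} [Field k] {ι : Type w} [Fintype ι]

/-- The FRT relations on the free algebra on generators `t i j` (written `t_i^j` in the literature):
`∑ p q, C i j p q • t p r * t q s = ∑ p q, C p q r s • t i p * t j q`. -/
inductive FRTRel (C : ι → ι → ι → ι → k) : FreeAlgebra k (ι × ι) → FreeAlgebra k (ι × ι) → Prop
  | mk (i j r s : ι) : FRTRel C
      (∑ p, ∑ q, C i j p q • (FreeAlgebra.ι k (p, r) * FreeAlgebra.ι k (q, s)))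
      (∑ p, ∑ q, C p q r s • (FreeAlgebra.ι k (i, p) * FreeAlgebra.ι k (j, q)))

/-- The FRT algebra with structure constants `C`. -/
def FRTAlg (C : ι → ι → ι → ι → k) : Type (max u w) := RingQuot (FRTRel C)

namespace FRTAlg

variable (C : ι → ι → ι → ι → k)

instance : Ring (FRTAlg C) := inferInstanceAs (Ring (RingQuot (FRTRel C)))

instance : Algebra k (FRTAlg C) := inferInstanceAs (Algebra k (RingQuot (FRTRel C)))

/-- The quotient map from the free algebra. -/
def mk : FreeAlgebra k (ι × ι) →ₐ[k] FRTAlg C := RingQuot.mkAlgHom k (FRTRel C)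

/-- The generators `t i j = t_i^j`. -/
def t (i j : ι) : FRTAlg C := mk C (FreeAlgebra.ι k (i, j))

theorem t_rel (i j r s : ι) :
    ∑ p, ∑ q, C i j p q • (t C p r * t C q s) = ∑ p, ∑ q, C p q r s • (t C i p * t C j q) := by
  have h : mk C _ = mk C _ := RingQuot.mkAlgHom_rel k (FRTRel.mk (C := C) i j r s)
  simpa [map_sum, map_smul, map_mul, t] using h

variable {C}
variable {R : Type z} [Ring R] [Algebra k R]

/-- The universal property of the FRT algebra. -/
def lift (f : ι → ι → R)
    (hf : ∀ i j r s, ∑ p, ∑ q, C i j p q • (f p r * f q s) =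
      ∑ p, ∑ q, C p q r s • (f i p * f j q)) : FRTAlg C →ₐ[k] R :=
  RingQuot.liftAlgHom k ⟨FreeAlgebra.lift k (fun ij : ι × ι => f ij.1 ij.2), by
    rintro _ _ ⟨i, j, r, s⟩
    simpa [map_sum, map_smul, map_mul] using hf i j r s⟩

@[simp] theorem lift_t (f : ι → ι → R) (hf) (i j : ι) : lift (C := C) f hf (t C i j) = f i j := by
  refine (RingQuot.liftAlgHom_mkAlgHom_apply k _ _ _).trans ?_
  simp

theorem algHom_ext {f g : FRTAlg C →ₐ[k] R} (h : ∀ i j, f (t C i j) = g (t C i j)) : f = g := by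
  refine RingQuot.ringQuot_ext' k f g ?_
  ext ⟨i, j⟩
  exact h i j

variable (C) [DecidableEq ι]

/-- The comultiplication `Δ (t i j) = ∑ p, t i p ⊗ t p j`. -/
def comulHom : FRTAlg C →ₐ[k] FRTAlg C ⊗[k] FRTAlg C :=
  lift (fun i j => ∑ p, t C i p ⊗ₜ[k] t C p j) (by
    intro i j r s
    have h1 : ∀ p q r s : ι, (∑ a, t C p a ⊗ₜ[k] t C a r) * (∑ b, t C q b ⊗ₜ[k] t C b s) =
        ∑ a, ∑ b, (t C p a * t C q b) ⊗ₜ[k] (t C a r * t C b s) := by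
      intro p q r s
      rw [Finset.sum_mul_sum]
      simp
    have h2 : ∀ F : ι → ι → ι → ι → FRTAlg C ⊗[k] FRTAlg C,
        ∑ p, ∑ q, ∑ a, ∑ b, F p q a b = ∑ a, ∑ b, ∑ p, ∑ q, F p q a b := by
      intro F
      calc _ = ∑ x : ι × ι, ∑ y : ι × ι, F x.1 x.2 y.1 y.2 := by
            simp only [Fintype.sum_prod_type]
        _ = ∑ y : ι × ι, ∑ x : ι × ι, F x.1 x.2 y.1 y.2 := Finset.sum_comm
        _ = _ := by simp only [Fintype.sum_prod_type]
    simp only [h1, Finset.smul_sum]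
    rw [h2]
    have h3 : ∀ a b, ∑ p, ∑ q, C i j p q • (t C p a * t C q b) ⊗ₜ[k] (t C a r * t C b s) =
        ∑ p, ∑ q, (t C i p * t C j q) ⊗ₜ[k] (C p q a b • (t C a r * t C b s)) := by
      intro a b
      simp only [TensorProduct.tmul_smul, TensorProduct.smul_tmul', ← TensorProduct.sum_tmul, t_rel]
    simp only [h3]
    rw [h2]
    conv_rhs => simp only [TensorProduct.smul_tmul', TensorProduct.smul_tmul]
    conv_rhs => rw [h2]
    refine Finset.sum_congr rfl fun p _ => Finset.sum_congr rfl fun q _ => ?_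
    simp only [← TensorProduct.tmul_sum, t_rel])

/-- The counit `ε (t i j) = δ_ij`. -/
def counitHom : FRTAlg C →ₐ[k] k :=
  lift (fun i j => if i = j then 1 else 0) (by
    intro i j r s
    simp)

instance : Bialgebra k (FRTAlg C) :=
  Bialgebra.ofAlgHom (comulHom C) (counitHom C)
    (algHom_ext fun i j => by
      simp [comulHom, map_sum, TensorProduct.sum_tmul, TensorProduct.tmul_sum]
      exact Finset.sum_comm)
    (algHom_ext fun i j => by
      simp [comulHom, counitHom, map_sum, TensorProduct.ite_tmul])
    (algHom_ext fun i j => by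
      simp [comulHom, counitHom, map_sum, TensorProduct.tmul_ite])

theorem comul_t (i j : ι) : Coalgebra.comul (R := k) (t C i j) = ∑ p, t C i p ⊗ₜ[k] t C p j :=
  lift_t _ _ i j

theorem counit_t (i j : ι) : Coalgebra.counit (R := k) (t C i j) = if i = j then (1 : k) else 0 :=
  lift_t _ _ i j

end FRTAlg

end FRT

/-! ### Localization of an algebra at an element -/

section Localization

variable {k : Type u} [Field k] {A : Type w} [Ring A] [Algebra k A]

/-- The relations defining `A[D⁻¹]` as a quotient of the free algebra on symbols `some a` (`a ∈ A`)
and `none` (the inverse of `D`): the map `a ↦ some a` becomes an algebra map, and `none` becomes a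
two-sided inverse of `some D`. -/
inductive LocRel (D : A) : FreeAlgebra k (Option A) → FreeAlgebra k (Option A) → Prop
  | scalar (r : k) : LocRel D (FreeAlgebra.ι k (some (algebraMap k A r))) (algebraMap k _ r)
  | add (a b : A) : LocRel D (FreeAlgebra.ι k (some (a + b)))
      (FreeAlgebra.ι k (some a) + FreeAlgebra.ι k (some b))
  | mul (a b : A) : LocRel D (FreeAlgebra.ι k (some (a * b)))
      (FreeAlgebra.ι k (some a) * FreeAlgebra.ι k (some b))
  | inv_mul : LocRel D (FreeAlgebra.ι k none * FreeAlgebra.ι k (some D)) 1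
  | mul_inv : LocRel D (FreeAlgebra.ι k (some D) * FreeAlgebra.ι k none) 1

variable (k) in
/-- The localization `A[D⁻¹]`. -/
def Loc (D : A) : Type (max u w) := RingQuot (LocRel (k := k) D)

namespace Loc

variable (k) (D : A)

instance : Ring (Loc k D) := inferInstanceAs (Ring (RingQuot (LocRel (k := k) D)))

instance : Algebra k (Loc k D) := inferInstanceAs (Algebra k (RingQuot (LocRel (k := k) D)))

/-- The quotient map from the free algebra. -/
def mk : FreeAlgebra k (Option A) →ₐ[k] Loc k D := RingQuot.mkAlgHom k (LocRel D)

/-- The element `D⁻¹` of `A[D⁻¹]`. -/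
def invD : Loc k D := mk k D (FreeAlgebra.ι k none)

/-- The canonical map `A → A[D⁻¹]`. -/
def of : A →ₐ[k] Loc k D :=
  AlgHom.ofLinearMap
    { toFun := fun a => mk k D (FreeAlgebra.ι k (some a))
      map_add' := fun a b =>
        (RingQuot.mkAlgHom_rel k (LocRel.add (D := D) a b)).trans (map_add (mk k D) _ _)
      map_smul' := fun r a => by
        have h1 : mk k D _ = mk k D _ :=
          RingQuot.mkAlgHom_rel k (LocRel.mul (k := k) (D := D) (algebraMap k A r) a)
        have h2 : mk k D _ = mk k D _ := RingQuot.mkAlgHom_rel k (LocRel.scalar (D := D) r)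
        rw [map_mul, h2, AlgHom.commutes] at h1
        simpa [Algebra.smul_def] using h1 }
    (by
      have h2 : mk k D _ = mk k D _ := RingQuot.mkAlgHom_rel k (LocRel.scalar (D := D) (1 : k))
      rw [map_one, map_one, map_one] at h2
      exact h2)
    (fun a b => by
      have h2 : mk k D _ = mk k D _ := RingQuot.mkAlgHom_rel k (LocRel.mul (k := k) (D := D) a b)
      exact h2.trans (map_mul _ _ _))

theorem invD_mul : invD k D * of k D D = 1 := by
  have h : mk k D _ = mk k D _ := RingQuot.mkAlgHom_rel k (LocRel.inv_mul (k := k) (D := D))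
  exact (map_mul (mk k D) _ _).symm.trans (h.trans (map_one _))

theorem mul_invD : of k D D * invD k D = 1 := by
  have h : mk k D _ = mk k D _ := RingQuot.mkAlgHom_rel k (LocRel.mul_inv (k := k) (D := D))
  exact (map_mul (mk k D) _ _).symm.trans (h.trans (map_one _))

variable {k D}
variable {R : Type z} [Ring R] [Algebra k R]

/-- The map out of `A[D⁻¹]` induced by an algebra map `f` and a two-sided inverse `e` of `f D`. -/
def lift (f : A →ₐ[k] R) (e : R) (h1 : e * f D = 1) (h2 : f D * e = 1) : Loc k D →ₐ[k] R :=
  RingQuot.liftAlgHom k ⟨FreeAlgebra.lift k (fun o : Option A => o.elim e f), by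
    rintro _ _ (_ | _ | _ | _ | _) <;> simp [h1, h2]⟩

@[simp] theorem lift_of (f : A →ₐ[k] R) (e : R) (h1 h2) (a : A) :
    lift (D := D) f e h1 h2 (of k D a) = f a := by
  refine (RingQuot.liftAlgHom_mkAlgHom_apply k _ _ _).trans ?_
  simp

@[simp] theorem lift_invD (f : A →ₐ[k] R) (e : R) (h1 h2) :
    lift (D := D) f e h1 h2 (invD k D) = e := by
  refine (RingQuot.liftAlgHom_mkAlgHom_apply k _ _ _).trans ?_
  simp

theorem algHom_ext {f g : Loc k D →ₐ[k] R} (h : ∀ a, f (of k D a) = g (of k D a)) : f = g := by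
  have hinv : f (invD k D) = g (invD k D) := by
    refine left_inv_eq_right_inv (a := f (of k D D)) ?_ ?_
    · rw [← map_mul, invD_mul, map_one]
    · rw [h, ← map_mul, mul_invD, map_one]
  refine RingQuot.ringQuot_ext' k f g ?_
  ext o
  cases o with
  | none => exact hinv
  | some a => exact h a

/-- The universal property of the localization. -/
theorem existsUnique_lift (f : A →ₐ[k] R) (hf : IsUnit (f D)) :
    ∃! g : Loc k D →ₐ[k] R, g.comp (of k D) = f := by
  obtain ⟨e, he⟩ := hf
  refine ⟨lift f (↑e⁻¹ : R) (by simp [← he]) (by simp [← he]), ?_, ?_⟩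
  · ext a
    simp
  · intro g hg
    refine algHom_ext fun a => ?_
    rw [lift_of, ← hg]
    rfl

end Loc

end Localization

/-! ### The bialgebra structure on the localization at a group-like element -/

section LocBialgebra

variable (k : Type u) [Field k] {A : Type w} [Ring A] [Bialgebra k A] (D : GroupLike k A)

namespace Loc

/-- The comultiplication of `A[D⁻¹]`: it extends that of `A`, and `Δ(D⁻¹) = D⁻¹ ⊗ D⁻¹`. -/
def comulHom : Loc k D.val →ₐ[k] Loc k D.val ⊗[k] Loc k D.val :=
  lift ((Algebra.TensorProduct.map (of k D.val) (of k D.val)).comp (Bialgebra.comulAlgHom k A))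
    (invD k D.val ⊗ₜ[k] invD k D.val)
    (by simp [D.isGroupLikeElem_val.comul_eq_tmul_self, invD_mul, Algebra.TensorProduct.one_def])
    (by simp [D.isGroupLikeElem_val.comul_eq_tmul_self, mul_invD, Algebra.TensorProduct.one_def])

/-- The counit of `A[D⁻¹]`: it extends that of `A`, and `ε(D⁻¹) = 1`. -/
def counitHom : Loc k D.val →ₐ[k] k :=
  lift (Bialgebra.counitAlgHom k A) 1 (by simp) (by simp)

theorem comulHom_comp_of : (comulHom k D).comp (of k D.val) =
    (Algebra.TensorProduct.map (of k D.val) (of k D.val)).comp (Bialgebra.comulAlgHom k A) := by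
  ext a
  simp [comulHom]

theorem comulHom_of (a : A) : comulHom k D (of k D.val a) =
    Algebra.TensorProduct.map (of k D.val) (of k D.val) (Coalgebra.comul (R := k) a) := by
  simp [comulHom]

theorem counitHom_of (a : A) : counitHom k D (of k D.val a) = Coalgebra.counit (R := k) a := by
  simp [counitHom]

instance instBialgebraLoc : Bialgebra k (Loc k D.val) :=
  Bialgebra.ofAlgHom (comulHom k D) (counitHom k D)
    (algHom_ext fun a => by
      have h1 : ∀ X : A ⊗[k] A, (Algebra.TensorProduct.map (comulHom k D) (.id k _))
          (Algebra.TensorProduct.map (of k D.val) (of k D.val) X) =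
          Algebra.TensorProduct.map (Algebra.TensorProduct.map (of k D.val) (of k D.val))
            (of k D.val) ((Coalgebra.comul (R := k)).rTensor A X) := by
        intro X
        induction X with
        | zero => simp
        | tmul a b => simp [comulHom_of]
        | add X Y hX hY => simp only [map_add, hX, hY]
      have h2 : ∀ X : A ⊗[k] A, (Algebra.TensorProduct.map (.id k _) (comulHom k D))
          (Algebra.TensorProduct.map (of k D.val) (of k D.val) X) =
          Algebra.TensorProduct.map (of k D.val)
            (Algebra.TensorProduct.map (of k D.val) (of k D.val))
            ((Coalgebra.comul (R := k)).lTensor A X) := by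
        intro X
        induction X with
        | zero => simp
        | tmul a b => simp [comulHom_of]
        | add X Y hX hY => simp only [map_add, hX, hY]
      have h3 : ∀ X : (A ⊗[k] A) ⊗[k] A, Algebra.TensorProduct.assoc k k k _ _ _
          (Algebra.TensorProduct.map (Algebra.TensorProduct.map (of k D.val) (of k D.val))
            (of k D.val) X) =
          Algebra.TensorProduct.map (of k D.val)
            (Algebra.TensorProduct.map (of k D.val) (of k D.val))
            (TensorProduct.assoc k A A A X) := by
        intro X
        induction X with
        | zero => simp
        | add X Y hX hY => simp only [map_add, hX, hY]
        | tmul X c =>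
          induction X with
          | zero => simp
          | tmul a b => simp
          | add X Y hX hY => simp only [TensorProduct.add_tmul, map_add, hX, hY]
      simp only [AlgHom.comp_apply, comulHom_of, h1, h2]
      rw [← Coalgebra.coassoc_apply (R := k) a, ← h3]
      rfl)
    (algHom_ext fun a => by
      have h1 : ∀ X : A ⊗[k] A, (Algebra.TensorProduct.map (counitHom k D) (.id k _))
          (Algebra.TensorProduct.map (of k D.val) (of k D.val) X) =
          Algebra.TensorProduct.map (.id k k) (of k D.val)
            ((Coalgebra.counit (R := k)).rTensor A X) := by
        intro X
        induction X with
        | zero => simp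
        | tmul a b => simp [counitHom_of]
        | add X Y hX hY => simp only [map_add, hX, hY]
      simp only [AlgHom.comp_apply, comulHom_of, h1, Coalgebra.rTensor_counit_comul]
      simp)
    (algHom_ext fun a => by
      have h1 : ∀ X : A ⊗[k] A, (Algebra.TensorProduct.map (.id k _) (counitHom k D))
          (Algebra.TensorProduct.map (of k D.val) (of k D.val) X) =
          Algebra.TensorProduct.map (of k D.val) (.id k k)
            ((Coalgebra.counit (R := k)).lTensor A X) := by
        intro X
        induction X with
        | zero => simp
        | tmul a b => simp [counitHom_of]
        | add X Y hX hY => simp only [map_add, hX, hY]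
      simp only [AlgHom.comp_apply, comulHom_of, h1, Coalgebra.lTensor_counit_comul]
      simp)

theorem isGroupLikeElem_invD : IsGroupLikeElem k (invD k D.val) where
  counit_eq_one := lift_invD _ _ _ _
  comul_eq_tmul_self := lift_invD _ _ _ _

/-- The element `D⁻¹` as a group-like element of `A[D⁻¹]`. -/
def invGroupLike : GroupLike k (Loc k D.val) := ⟨invD k D.val, isGroupLikeElem_invD k D⟩

/-- The canonical map `A → A[D⁻¹]` as a coalgebra map. -/
def ofCoalgHom : A →ₗc[k] Loc k D.val :=
  { (of k D.val).toLinearMap with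
    counit_comp := by
      ext a
      exact counitHom_of k D a
    map_comp_comul := by
      ext a
      exact (comulHom_of k D a).symm }

end Loc

end LocBialgebra

/-! ### Left comodules -/

section Comodule

/-- A left coaction of the coalgebra `A` on `M`: a coassociative counital map `M → A ⊗ M`. -/
structure Coaction (k : Type u) [Field k] (A : Type w) [Ring A] [Bialgebra k A]
    (M : Type v) [AddCommGroup M] [Module k M] where
  coact : M →ₗ[k] A ⊗[k] M
  coassoc : (TensorProduct.assoc k A A M).toLinearMap ∘ₗ
      (Coalgebra.comul (R := k) (A := A)).rTensor M ∘ₗ coact = coact.lTensor A ∘ₗ coact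
  counit : (Coalgebra.counit (R := k) (A := A)).rTensor M ∘ₗ coact = TensorProduct.mk k k M 1

variable {k : Type u} [Field k] {A : Type w} [Ring A] [Bialgebra k A]
variable {M : Type v} [AddCommGroup M] [Module k M]
variable {N : Type z} [AddCommGroup N] [Module k N]

/-- Colinear maps. -/
def IsColinear (ρ : Coaction k A M) (σ : Coaction k A N) (f : M →ₗ[k] N) : Prop :=
  σ.coact ∘ₗ f = f.lTensor A ∘ₗ ρ.coact

namespace Coaction

/-- Push a coaction forward along a coalgebra map. -/
def push {B : Type z} [Ring B] [Bialgebra k B] (f : A →ₗc[k] B) (ρ : Coaction k A M) :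
    Coaction k B M where
  coact := f.toLinearMap.rTensor M ∘ₗ ρ.coact
  coassoc := by
    ext m
    have h1 : ∀ X : A ⊗[k] M, TensorProduct.assoc k B B M
        ((Coalgebra.comul (R := k) (A := B)).rTensor M (f.toLinearMap.rTensor M X)) =
        TensorProduct.map f.toLinearMap (f.toLinearMap.rTensor M) (TensorProduct.assoc k A A M
          ((Coalgebra.comul (R := k) (A := A)).rTensor M X)) := by
      have h0 : ∀ (Y : A ⊗[k] A) (m : M), TensorProduct.assoc k B B M
          (TensorProduct.map f.toLinearMap f.toLinearMap Y ⊗ₜ[k] m) =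
          TensorProduct.map f.toLinearMap (f.toLinearMap.rTensor M)
            (TensorProduct.assoc k A A M (Y ⊗ₜ[k] m)) := by
        intro Y m
        induction Y with
        | zero => simp
        | tmul a b => simp
        | add X Y hX hY => simp only [map_add, TensorProduct.add_tmul, hX, hY]
      intro X
      induction X with
      | zero => simp
      | tmul a m =>
        have hf := LinearMap.congr_fun f.map_comp_comul a
        simp only [LinearMap.comp_apply] at hf
        simp only [LinearMap.rTensor_tmul]
        rw [← h0, hf]
      | add X Y hX hY => simp only [map_add, hX, hY]
    have h2 : ∀ X : A ⊗[k] M, (f.toLinearMap.rTensor M ∘ₗ ρ.coact).lTensor B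
        (f.toLinearMap.rTensor M X) =
        TensorProduct.map f.toLinearMap (f.toLinearMap.rTensor M) (ρ.coact.lTensor A X) := by
      intro X
      induction X with
      | zero => simp
      | tmul a m => simp
      | add X Y hX hY => simp only [map_add, hX, hY]
    have h3 := LinearMap.congr_fun ρ.coassoc m
    simp only [LinearMap.comp_apply, LinearEquiv.coe_coe] at h3 ⊢
    rw [h1, h3, h2]
  counit := by
    rw [← ρ.counit, ← LinearMap.comp_assoc, ← LinearMap.rTensor_comp]
    congr 2
    exact f.counit_comp

/-- The one-dimensional comodule `k g`, with coaction `1 ↦ g ⊗ 1`, for a group-like `g`. -/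
def ofGroupLike (g : GroupLike k A) : Coaction k A k where
  coact := TensorProduct.mk k A k g.val
  coassoc := by
    ext
    simp [g.isGroupLikeElem_val.comul_eq_tmul_self]
  counit := by
    ext
    simp

/-- The trivial comodule `k`. -/
def unit (k : Type u) [Field k] (A : Type w) [Ring A] [Bialgebra k A] : Coaction k A k :=
  ofGroupLike 1

/-- The map `(a ⊗ m) ⊗ (b ⊗ n) ↦ (a * b) ⊗ (m ⊗ n)`. -/
def mulMap (k : Type u) [Field k] (A : Type w) [Ring A] [Algebra k A]
    (M : Type v) [AddCommGroup M] [Module k M] (N : Type z) [AddCommGroup N] [Module k N] :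
    (A ⊗[k] M) ⊗[k] (A ⊗[k] N) →ₗ[k] A ⊗[k] (M ⊗[k] N) :=
  (LinearMap.mul' k A).rTensor (M ⊗[k] N) ∘ₗ
    (TensorProduct.tensorTensorTensorComm k A M A N).toLinearMap

@[simp] theorem mulMap_tmul {A : Type w} [Ring A] [Algebra k A] (a b : A) (m : M) (n : N) :
    mulMap k A M N ((a ⊗ₜ[k] m) ⊗ₜ[k] (b ⊗ₜ[k] n)) = (a * b) ⊗ₜ[k] (m ⊗ₜ[k] n) := by
  simp [mulMap]

/-- The tensor product of comodules, with the diagonal coaction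
`m ⊗ n ↦ m₍₋₁₎ n₍₋₁₎ ⊗ (m₍₀₎ ⊗ n₍₀₎)`. -/
def tensor (ρ : Coaction k A M) (σ : Coaction k A N) : Coaction k A (M ⊗[k] N) where
  coact := mulMap k A M N ∘ₗ TensorProduct.map ρ.coact σ.coact
  coassoc := by
    ext m n
    have h0 : ∀ (Y Z : A ⊗[k] A) (m : M) (n : N),
        TensorProduct.assoc k A A (M ⊗[k] N) ((Y * Z) ⊗ₜ[k] (m ⊗ₜ[k] n)) =
        (mulMap k A M N).lTensor A (mulMap k A (A ⊗[k] M) (A ⊗[k] N)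
          (TensorProduct.assoc k A A M (Y ⊗ₜ[k] m) ⊗ₜ[k]
            TensorProduct.assoc k A A N (Z ⊗ₜ[k] n))) := by
      intro Y Z m n
      induction Y with
      | zero => simp
      | add X Y hX hY => simp only [add_mul, map_add, TensorProduct.add_tmul, hX, hY]
      | tmul a b =>
        induction Z with
        | zero => simp
        | add X Y hX hY =>
          simp only [mul_add, map_add, TensorProduct.add_tmul, TensorProduct.tmul_add, hX, hY]
        | tmul c d => simp
    have h1 : ∀ (X : A ⊗[k] M) (Y : A ⊗[k] N),
        TensorProduct.assoc k A A (M ⊗[k] N) ((Coalgebra.comul (R := k) (A := A)).rTensor _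
          (mulMap k A M N (X ⊗ₜ[k] Y))) =
        (mulMap k A M N).lTensor A (mulMap k A (A ⊗[k] M) (A ⊗[k] N)
          (TensorProduct.assoc k A A M ((Coalgebra.comul (R := k) (A := A)).rTensor M X) ⊗ₜ[k]
            TensorProduct.assoc k A A N
              ((Coalgebra.comul (R := k) (A := A)).rTensor N Y))) := by
      intro X Y
      induction X with
      | zero => simp
      | add X Y hX hY => simp only [map_add, TensorProduct.add_tmul, hX, hY]
      | tmul a b =>
        induction Y with
        | zero => simp
        | add X Y hX hY => simp only [map_add, TensorProduct.tmul_add, hX, hY]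
        | tmul c d => simp [h0]
    have h2 : ∀ (X : A ⊗[k] M) (Y : A ⊗[k] N),
        (mulMap k A M N ∘ₗ TensorProduct.map ρ.coact σ.coact).lTensor A
          (mulMap k A M N (X ⊗ₜ[k] Y)) =
        (mulMap k A M N).lTensor A (mulMap k A (A ⊗[k] M) (A ⊗[k] N)
          (ρ.coact.lTensor A X ⊗ₜ[k] σ.coact.lTensor A Y)) := by
      intro X Y
      induction X with
      | zero => simp
      | add X Y hX hY => simp only [map_add, TensorProduct.add_tmul, hX, hY]
      | tmul a b =>
        induction Y with
        | zero => simp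
        | add X Y hX hY => simp only [map_add, TensorProduct.tmul_add, hX, hY]
        | tmul c d => simp
    have h3 := LinearMap.congr_fun ρ.coassoc m
    have h4 := LinearMap.congr_fun σ.coassoc n
    simp only [LinearMap.comp_apply, LinearEquiv.coe_coe] at h3 h4
    simp only [TensorProduct.AlgebraTensorModule.curry_apply, TensorProduct.curry_apply,
      LinearMap.coe_restrictScalars, LinearMap.comp_apply, LinearEquiv.coe_coe,
      TensorProduct.map_tmul]
    rw [h1, h2, h3, h4]
  counit := by
    ext m n
    have h1 : ∀ (X : A ⊗[k] M) (Y : A ⊗[k] N),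
        (Coalgebra.counit (R := k) (A := A)).rTensor _ (mulMap k A M N (X ⊗ₜ[k] Y)) =
        mulMap k k M N ((Coalgebra.counit (R := k) (A := A)).rTensor M X ⊗ₜ[k]
          (Coalgebra.counit (R := k) (A := A)).rTensor N Y) := by
      intro X Y
      induction X with
      | zero => simp
      | add X Y hX hY => simp only [map_add, TensorProduct.add_tmul, hX, hY]
      | tmul a b =>
        induction Y with
        | zero => simp
        | add X Y hX hY => simp only [map_add, TensorProduct.tmul_add, hX, hY]
        | tmul c d => simp
    have h3 := LinearMap.congr_fun ρ.counit m
    have h4 := LinearMap.congr_fun σ.counit n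
    simp only [LinearMap.comp_apply] at h3 h4
    simp only [TensorProduct.AlgebraTensorModule.curry_apply, TensorProduct.curry_apply,
      LinearMap.coe_restrictScalars, LinearMap.comp_apply, TensorProduct.map_tmul]
    rw [h1, h3, h4]
    simp

theorem coassoc_comp {L : Type*} [AddCommGroup L] [Module k L] (τ : Coaction k A L)
    (i : L →ₗ[k] M) (F : M →ₗ[k] A ⊗[k] M) (hF : F ∘ₗ i = i.lTensor A ∘ₗ τ.coact) :
    ((TensorProduct.assoc k A A M).toLinearMap ∘ₗ
      (Coalgebra.comul (R := k) (A := A)).rTensor M ∘ₗ F) ∘ₗ i = (F.lTensor A ∘ₗ F) ∘ₗ i := by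
  ext l
  have h1 : ∀ X : A ⊗[k] L, TensorProduct.assoc k A A M
      ((Coalgebra.comul (R := k) (A := A)).rTensor M (i.lTensor A X)) =
      (i.lTensor A).lTensor A (TensorProduct.assoc k A A L
        ((Coalgebra.comul (R := k) (A := A)).rTensor L X)) := by
    have h0 : ∀ (Y : A ⊗[k] A) (l : L), TensorProduct.assoc k A A M (Y ⊗ₜ[k] i l) =
        (i.lTensor A).lTensor A (TensorProduct.assoc k A A L (Y ⊗ₜ[k] l)) := by
      intro Y l
      induction Y with
      | zero => simp
      | tmul a b => simp
      | add X Y hX hY => simp only [map_add, TensorProduct.add_tmul, hX, hY]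
    intro X
    induction X with
    | zero => simp
    | tmul a l => simp [h0]
    | add X Y hX hY => simp only [map_add, hX, hY]
  have h3 := LinearMap.congr_fun τ.coassoc l
  have h4 := LinearMap.congr_fun hF l
  simp only [LinearMap.comp_apply, LinearEquiv.coe_coe] at h3 h4 ⊢
  rw [h4, h1, h3, ← LinearMap.comp_apply, ← LinearMap.comp_apply (f := F.lTensor A),
    ← LinearMap.lTensor_comp, ← LinearMap.lTensor_comp, hF]

theorem counit_comp {L : Type*} [AddCommGroup L] [Module k L] (τ : Coaction k A L)
    (i : L →ₗ[k] M) (F : M →ₗ[k] A ⊗[k] M) (hF : F ∘ₗ i = i.lTensor A ∘ₗ τ.coact) :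
    ((Coalgebra.counit (R := k) (A := A)).rTensor M ∘ₗ F) ∘ₗ i =
      TensorProduct.mk k k M 1 ∘ₗ i := by
  rw [LinearMap.comp_assoc, hF, ← LinearMap.comp_assoc, LinearMap.rTensor_comp_lTensor,
    ← LinearMap.lTensor_comp_rTensor, LinearMap.comp_assoc, τ.counit]
  ext l
  simp

/-- The direct sum of two comodules. -/
def prod (ρ : Coaction k A M) (σ : Coaction k A N) : Coaction k A (M × N) where
  coact := ((LinearMap.inl k M N).lTensor A ∘ₗ ρ.coact).coprod
    ((LinearMap.inr k M N).lTensor A ∘ₗ σ.coact)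
  coassoc := LinearMap.prod_ext
    (coassoc_comp ρ _ _ (LinearMap.coprod_inl _ _)) (coassoc_comp σ _ _ (LinearMap.coprod_inr _ _))
  counit := LinearMap.prod_ext
    (counit_comp ρ _ _ (LinearMap.coprod_inl _ _)) (counit_comp σ _ _ (LinearMap.coprod_inr _ _))

end Coaction

end Comodule

/-! ### Finite-dimensional comodules: rigidity and tensor generation -/

section FinComod

/-- A finite-dimensional left comodule over the bialgebra `A`. -/
structure FinComod (k : Type u) [Field k] (A : Type w) [Ring A] [Bialgebra k A] where
  carrier : Type u
  [addCommGroup : AddCommGroup carrier]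
  [module : Module k carrier]
  [finite : FiniteDimensional k carrier]
  coaction : Coaction k A carrier

attribute [instance] FinComod.addCommGroup FinComod.module FinComod.finite

variable {k : Type u} [Field k] {A : Type w} [Ring A] [Bialgebra k A]

/-- `IsDualPair X Y` means that there are colinear maps `ev : X ⊗ Y → k` and `coev : k → Y ⊗ X`
satisfying the two snake identities, so that `X` is a left dual of `Y` and `Y` is a right dual
of `X`. -/
def IsDualPair (X Y : FinComod k A) : Prop :=
  ∃ (ev : X.carrier ⊗[k] Y.carrier →ₗ[k] k) (coev : k →ₗ[k] Y.carrier ⊗[k] X.carrier),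
    IsColinear (X.coaction.tensor Y.coaction) (Coaction.unit k A) ev ∧
    IsColinear (Coaction.unit k A) (Y.coaction.tensor X.coaction) coev ∧
    (∀ y : Y.carrier, TensorProduct.rid k Y.carrier (ev.lTensor Y.carrier
      (TensorProduct.assoc k Y.carrier X.carrier Y.carrier (coev 1 ⊗ₜ[k] y))) = y) ∧
    (∀ x : X.carrier, TensorProduct.lid k X.carrier (ev.rTensor X.carrier
      ((TensorProduct.assoc k X.carrier Y.carrier X.carrier).symm (x ⊗ₜ[k] coev 1))) = x)

variable (k A) in
/-- The category of finite-dimensional left `A`-comodules is rigid: every object has a left dual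
and a right dual. -/
def IsRigidComod : Prop :=
  ∀ M : FinComod k A, (∃ X, IsDualPair X M) ∧ (∃ Y, IsDualPair M Y)

/-- The tensor products of finitely many members of `S` (the empty product being the unit). -/
inductive IsTensorWord (S : Set (FinComod k A)) : FinComod k A → Prop
  | unit : IsTensorWord S ⟨k, Coaction.unit k A⟩
  | of (X : FinComod k A) (hX : X ∈ S) : IsTensorWord S X
  | tensor (X Y : FinComod k A) (hX : IsTensorWord S X) (hY : IsTensorWord S Y) :
      IsTensorWord S ⟨X.carrier ⊗[k] Y.carrier, X.coaction.tensor Y.coaction⟩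

/-- The (nonempty) finite direct sums of tensor products of members of `S`. -/
inductive IsSumOfTensorWords (S : Set (FinComod k A)) : FinComod k A → Prop
  | of (X : FinComod k A) (hX : IsTensorWord S X) : IsSumOfTensorWords S X
  | prod (X Y : FinComod k A) (hX : IsSumOfTensorWords S X) (hY : IsSumOfTensorWords S Y) :
      IsSumOfTensorWords S ⟨X.carrier × Y.carrier, X.coaction.prod Y.coaction⟩

/-- The category of finite-dimensional left `A`-comodules is tensorially generated by `S`: every
object is a subquotient of a finite direct sum of tensor products of members of `S`. -/
def IsTensorGeneratedBy (S : Set (FinComod k A)) : Prop :=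
  ∀ M : FinComod k A, ∃ (X P : FinComod k A) (f : P.carrier →ₗ[k] X.carrier)
    (g : P.carrier →ₗ[k] M.carrier), IsSumOfTensorWords S X ∧
      IsColinear P.coaction X.coaction f ∧ Function.Injective f ∧
      IsColinear P.coaction M.coaction g ∧ Function.Surjective g

end FinComod

/-! ### Coquasitriangular structures -/

section Coquasitriangular

variable {k : Type u} [Field k] {A : Type w} [Ring A] [Bialgebra k A]

/-- The convolution product of two bilinear forms on `A`:
`(r * r') (a, b) = r (a₍₁₎, b₍₁₎) r' (a₍₂₎, b₍₂₎)`. -/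
def conv (r r' : A →ₗ[k] A →ₗ[k] k) : A →ₗ[k] A →ₗ[k] k :=
  TensorProduct.curry (LinearMap.mul' k k ∘ₗ
    TensorProduct.map (TensorProduct.lift r) (TensorProduct.lift r') ∘ₗ
      Coalgebra.comul (R := k) (A := A ⊗[k] A))

/-- The unit `(a, b) ↦ ε(a) ε(b)` of the convolution product. -/
def convOne (k : Type u) [Field k] (A : Type w) [Ring A] [Bialgebra k A] : A →ₗ[k] A →ₗ[k] k :=
  LinearMap.mk₂ k (fun a b => Coalgebra.counit (R := k) a * Coalgebra.counit (R := k) b)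
    (by simp [add_mul]) (by simp [mul_assoc]) (by simp [mul_add]) (by simp [mul_left_comm])

/-- `r` is a coquasitriangular structure on the bialgebra `A`. -/
structure IsCoquasitriangular (r : A →ₗ[k] A →ₗ[k] k) : Prop where
  /-- `r` is invertible for the convolution product. -/
  invertible : ∃ r' : A →ₗ[k] A →ₗ[k] k, conv r r' = convOne k A ∧ conv r' r = convOne k A
  /-- `r (a b, c) = r (a, c₍₁₎) r (b, c₍₂₎)` -/
  mul_left : ∀ a b c : A, r (a * b) c =
    LinearMap.mul' k k (TensorProduct.map (r a) (r b) (Coalgebra.comul (R := k) c))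
  /-- `r (a, b c) = r (a₍₂₎, b) r (a₍₁₎, c)` -/
  mul_right : ∀ a b c : A, r a (b * c) =
    LinearMap.mul' k k (TensorProduct.map (r.flip c) (r.flip b) (Coalgebra.comul (R := k) a))
  /-- `r (a₍₁₎, b₍₁₎) a₍₂₎ b₍₂₎ = b₍₁₎ a₍₁₎ r (a₍₂₎, b₍₂₎)` -/
  comm : ∀ a b : A,
    TensorProduct.lid k A (TensorProduct.map (TensorProduct.lift r) (LinearMap.mul' k A)
      (Coalgebra.comul (R := k) (a ⊗ₜ[k] b))) =
    TensorProduct.rid k A (TensorProduct.map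
      (LinearMap.mul' k A ∘ₗ (TensorProduct.comm k A A).toLinearMap) (TensorProduct.lift r)
      (Coalgebra.comul (R := k) (a ⊗ₜ[k] b)))

end Coquasitriangular

/-! ### Weakly graded-Frobenius algebras and the quantum determinant -/

section WGF

variable {k : Type u} [Field k] {A : Type w} [Ring A] [Bialgebra k A]
variable {V : Type v} [AddCommGroup V] [Module k V]
variable {B : Type z} [Ring B] [Algebra k B]

/-- The structure of a weakly graded-Frobenius algebra for the bialgebra `A` and the `A`-comodule
`(V, ρ)` on the graded algebra `B = ⨁ 𝓑 n`. -/
structure WGFAlgebra (ρ : Coaction k A V) (𝓑 : ℕ → Submodule k B) [GradedAlgebra 𝓑] where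
  /-- The coaction of `A` on `B`. -/
  coaction : Coaction k A B
  /-- The coaction is an algebra map. -/
  coact_one : coaction.coact 1 = 1
  coact_mul : ∀ a b : B, coaction.coact (a * b) = coaction.coact a * coaction.coact b
  /-- The homogeneous components are subcomodules. -/
  coact_mem : ∀ n, ∀ a ∈ 𝓑 n, coaction.coact a ∈ LinearMap.range ((𝓑 n).subtype.lTensor A)
  /-- `B` is connected: `𝓑 0 = k 1`. -/
  connected : 𝓑 0 = 1
  /-- The identification of `V` with `𝓑 1`, as comodules. -/
  incl : V →ₗ[k] B
  incl_injective : Function.Injective incl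
  incl_range : LinearMap.range incl = 𝓑 1
  incl_colinear : IsColinear ρ coaction incl
  finite : FiniteDimensional k B
  /-- The top degree, in which `B` is one-dimensional. -/
  top : ℕ
  finrank_top : Module.finrank k (𝓑 top) = 1
  eq_bot : ∀ n, top < n → 𝓑 n = ⊥
  /-- Nondegeneracy of `𝓑 1 × 𝓑 (top - 1) → 𝓑 top`.  (If `top = 0` then `𝓑 1 = 0` and
  `𝓑 (-1) = 0`, and there is no condition.) -/
  left_left : ∀ q, q + 1 = top → ∀ a ∈ 𝓑 1, (∀ b ∈ 𝓑 q, a * b = 0) → a = 0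
  left_right : ∀ q, q + 1 = top → ∀ b ∈ 𝓑 q, (∀ a ∈ 𝓑 1, a * b = 0) → b = 0
  /-- Nondegeneracy of `𝓑 (top - 1) × 𝓑 1 → 𝓑 top`. -/
  right_left : ∀ q, q + 1 = top → ∀ b ∈ 𝓑 q, (∀ a ∈ 𝓑 1, b * a = 0) → b = 0
  right_right : ∀ q, q + 1 = top → ∀ a ∈ 𝓑 1, (∀ b ∈ 𝓑 q, b * a = 0) → a = 0

namespace WGFAlgebra

variable {ρ : Coaction k A V} {𝓑 : ℕ → Submodule k B} [GradedAlgebra 𝓑] (W : WGFAlgebra ρ 𝓑)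

/-- A volume element: a nonzero element of the one-dimensional top component. -/
structure VolumeElement where
  val : B
  mem : val ∈ 𝓑 W.top
  ne_zero : val ≠ 0

variable {W}

theorem exists_det (b : W.VolumeElement) :
    ∃ D : A, W.coaction.coact b.val = D ⊗ₜ[k] b.val := by
  obtain ⟨X, hX⟩ := W.coact_mem _ _ b.mem
  have hb : (⟨b.val, b.mem⟩ : 𝓑 W.top) ≠ 0 := fun h => b.ne_zero (congrArg Subtype.val h)
  have key : ∀ X : A ⊗[k] 𝓑 W.top, ∃ D : A, (𝓑 W.top).subtype.lTensor A X = D ⊗ₜ[k] b.val := by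
    intro X
    induction X with
    | zero => exact ⟨0, by simp⟩
    | tmul a y =>
      obtain ⟨s, hs⟩ := (finrank_eq_one_iff_of_nonzero' _ hb).1 W.finrank_top y
      refine ⟨s • a, ?_⟩
      rw [← hs]
      simp [TensorProduct.smul_tmul]
    | add X Y hX hY =>
      obtain ⟨D, hD⟩ := hX
      obtain ⟨E, hE⟩ := hY
      exact ⟨D + E, by rw [map_add, hD, hE, TensorProduct.add_tmul]⟩
  obtain ⟨D, hD⟩ := key X
  exact ⟨D, hX.symm.trans hD⟩

theorem tmul_right_injective {M : Type*} [AddCommGroup M] [Module k M] {b : B} (hb : b ≠ 0)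
    {m m' : M} (h : m ⊗ₜ[k] b = m' ⊗ₜ[k] b) : m = m' := by
  obtain ⟨φ, hφ⟩ := Module.Projective.exists_dual_ne_zero k hb
  have := congrArg (fun X => TensorProduct.rid k M (φ.lTensor M X)) h
  simpa [hφ, smul_right_injective M hφ |>.eq_iff] using this

theorem isGroupLikeElem_of_coact {D : A} {b : B} (hb : b ≠ 0)
    (h : W.coaction.coact b = D ⊗ₜ[k] b) : IsGroupLikeElem k D where
  counit_eq_one := by
    have h1 := LinearMap.congr_fun W.coaction.counit b
    simp only [LinearMap.comp_apply, h, LinearMap.rTensor_tmul, TensorProduct.mk_apply] at h1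
    exact tmul_right_injective hb h1
  comul_eq_tmul_self := by
    have h1 := LinearMap.congr_fun W.coaction.coassoc b
    simp only [LinearMap.comp_apply, h, LinearMap.rTensor_tmul, LinearMap.lTensor_tmul,
      LinearEquiv.coe_coe] at h1
    refine tmul_right_injective hb ((TensorProduct.assoc k A A B).injective ?_)
    rw [h1, TensorProduct.assoc_tmul]

/-- The quantum determinant: the group-like element `D` with `λ(b) = D ⊗ b`. -/
def det (b : W.VolumeElement) : GroupLike k A :=
  ⟨(exists_det b).choose, isGroupLikeElem_of_coact b.ne_zero (exists_det b).choose_spec⟩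

theorem coact_volume (b : W.VolumeElement) :
    W.coaction.coact b.val = (det b).val ⊗ₜ[k] b.val := (exists_det b).choose_spec

variable {ι : Type*} [Fintype ι] [DecidableEq ι]

/-- `ω` is the family in `𝓑 (top - 1)` dual to the basis `x` of `V`: `x i * ω j = δ_ij b`.
(By nondegeneracy it exists, it is unique, and it is a basis of `𝓑 (top - 1)`; if `top = 0`, then
`V = 0` and the family is empty.) -/
def IsDualFamily (b : W.VolumeElement) (x : Module.Basis ι k V) (ω : ι → B) : Prop :=
  (∀ j, ω j ∈ 𝓑 (W.top - 1)) ∧ ∀ i j, W.incl (x i) * ω j = if i = j then b.val else 0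

/-- `T i j = T_i^j` are the matrix coefficients of the family `ω`: `λ(ω j) = ∑ i, T i j ⊗ ω i`. -/
def IsCoefficientMatrix (W : WGFAlgebra ρ 𝓑) (ω : ι → B) (T : ι → ι → A) : Prop :=
  ∀ j, W.coaction.coact (ω j) = ∑ i, T i j ⊗ₜ[k] ω i

end WGFAlgebra

end WGF

/-! ### The data attached to a braided vector space -/

section Main

variable {k : Type u} [Field k] {V : Type v} [AddCommGroup V] [Module k V]
variable {ι : Type w} [Fintype ι] [DecidableEq ι]

/-- The FRT bialgebra `A(c)`. -/
abbrev FRTOf (x : Module.Basis ι k V) (c : V ⊗[k] V ≃ₗ[k] V ⊗[k] V) : Type (max u w) :=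
  FRTAlg (coeffs x c)

/-- The coaction `x i ↦ ∑ j, t i j ⊗ x j` of `A(c)` on `V`. -/
def frtCoaction (x : Module.Basis ι k V) (c : V ⊗[k] V ≃ₗ[k] V ⊗[k] V) :
    Coaction k (FRTOf x c) V where
  coact := x.constr k fun i => ∑ j, FRTAlg.t (coeffs x c) i j ⊗ₜ[k] x j
  coassoc := x.ext fun i => by
    simp only [LinearMap.comp_apply, Module.Basis.constr_basis, map_sum, LinearMap.rTensor_tmul,
      LinearMap.lTensor_tmul, FRTAlg.comul_t, TensorProduct.sum_tmul, TensorProduct.tmul_sum,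
      LinearEquiv.coe_coe, TensorProduct.assoc_tmul]
    exact Finset.sum_comm
  counit := x.ext fun i => by
    simp [FRTAlg.counit_t, TensorProduct.ite_tmul]

variable {x : Module.Basis ι k V} {c : V ⊗[k] V ≃ₗ[k] V ⊗[k] V}
variable {B : Type z} [Ring B] [Algebra k B] {𝓑 : ℕ → Submodule k B} [GradedAlgebra 𝓑]
variable {W : WGFAlgebra (frtCoaction x c) 𝓑}

/-- The localization `H(c) = A(c)[D⁻¹]` at the quantum determinant. -/
abbrev HOf (b : W.VolumeElement) : Type (max u w) := Loc k (WGFAlgebra.det b).val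

/-- The bialgebra structure of `H(c)`. -/
abbrev bialgebraH (b : W.VolumeElement) : Bialgebra k (HOf b) :=
  Loc.instBialgebraLoc k (WGFAlgebra.det b)

/-- The canonical map `A(c) → H(c)`. -/
abbrev toH (b : W.VolumeElement) : FRTOf x c →ₐ[k] HOf b := Loc.of k (WGFAlgebra.det b).val

/-- The element `D⁻¹` of `H(c)`. -/
abbrev detInv (b : W.VolumeElement) : HOf b := Loc.invD k (WGFAlgebra.det b).val

/-- The one-dimensional `H(c)`-comodule `k D⁻¹`. -/
def comodDetInv (b : W.VolumeElement) : FinComod k (HOf b) :=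
  ⟨k, Coaction.ofGroupLike (Loc.invGroupLike k (WGFAlgebra.det b))⟩

/-- The `H(c)`-comodule `V`. -/
def comodV {V : Type u} [AddCommGroup V] [Module k V] [FiniteDimensional k V]
    {x : Module.Basis ι k V} {c : V ⊗[k] V ≃ₗ[k] V ⊗[k] V} {W : WGFAlgebra (frtCoaction x c) 𝓑}
    (b : W.VolumeElement) : FinComod k (HOf b) :=
  ⟨V, (frtCoaction x c).push (Loc.ofCoalgHom k (WGFAlgebra.det b))⟩

end Main

end QDet

end

noncomputable section

namespace QDet

/-! ### Generators of the FRT algebra and of its localization -/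

section Induction

variable {k : Type u} [Field k] {ι : Type w} [Fintype ι] {C : ι → ι → ι → ι → k}

/-! Write H for A(c)[D⁻¹] and t for the matrix of generators. Non-degeneracy on the two sides gives
two families in degree top − 1, with x_i ω^j = δ_ij 𝔟 and ω'^j x_i = δ_ij 𝔟. Applying the
multiplicative coaction to these equations gives ∑ t_i^l T_l^j = δ_ij D and ∑ T'_l^j t_i^l = δ_ij D.
So in H the matrix p = T D⁻¹ is a right inverse of t, and q = D⁻¹ T' is a right inverse of t over
the opposite algebra. They are the candidates for 𝒮(t) and 𝒮⁻¹(t). What is missing is that they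
satisfy the FRT relations in the opposite algebra, so that t ↦ p and t ↦ q extend to
antihomomorphisms. This is extracted from the coquasitriangular form, which is therefore built
before the antipode.

The form is extended from A(c) one variable at a time. The braid equation makes t_i^p ↦
(c_{ji}^{pq})_{jq} a representation of A(c); it extends to H because c⁻¹ supplies a convolution
inverse, which makes the image of the group-like D invertible (`IsYangBaxter.rep_mul_antirep`). The
entries of this representation, as functionals on H, satisfy the FRT relations for the opposite
convolution product (`IsYangBaxter.isFRTFamily_entry`), which extends the second variable to A(c).
There D acts as a character of H, and characters of H are convolution invertible because t has a
right inverse (`Loc.exists_char_inverse`); hence the form is defined on H × H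
(`IsYangBaxter.exists_pairing`).

The commutation rule says that a matrix coalgebra intertwines two algebra maps, so it spreads from
generators to H (`Loc.commAt`). Both r(p,p) and r(t,t) are inverse to r(t,p), so r(p,p) = c, and
likewise for q (`IsCanonicalPairing.pairing_rightInverse`,
`IsCanonicalPairing.pairing_leftInverse`). The commutation rule for the entries of p or q is then
exactly the opposite FRT relation (`IsCanonicalPairing.isFRTFamily_op`). Thus 𝒮 and a left inverse
𝒮' of it exist (`Loc.exists_antipode`), and (a, b) ↦ r(𝒮 a, b) is the convolution inverse of r.

Duals of comodules come from the transposes of 𝒮 and 𝒮' applied to coefficient matrices. For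
generation, the coefficients of tensor words in V and 𝕜D⁻¹ span H, so inside the cofree comodule H ⊗
M the coaction image of M is covered by a sum of words X; the fibre product of X and M over H ⊗ M
exhibits M as a subquotient (`isTensorGeneratedBy_of_wordSpan`). -/

theorem FRTAlg.induction {p : FRTAlg C → Prop} (algebraMap : ∀ r, p (algebraMap k _ r))
    (add : ∀ a b, p a → p b → p (a + b)) (mul : ∀ a b, p a → p b → p (a * b))
    (t : ∀ i j, p (FRTAlg.t C i j)) (a : FRTAlg C) : p a := by
  obtain ⟨y, rfl⟩ := RingQuot.mkAlgHom_surjective k (FRTRel C) a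
  change p (FRTAlg.mk C y)
  induction y using FreeAlgebra.induction with
  | grade0 r => rw [AlgHom.commutes]; exact algebraMap r
  | grade1 x => exact t x.1 x.2
  | mul a b ha hb => rw [map_mul]; exact mul _ _ ha hb
  | add a b ha hb => rw [map_add]; exact add _ _ ha hb

theorem Loc.induction {A : Type w} [Ring A] [Algebra k A] {D : A} {p : Loc k D → Prop}
    (add : ∀ a b, p a → p b → p (a + b)) (mul : ∀ a b, p a → p b → p (a * b))
    (of : ∀ a, p (Loc.of k D a)) (invD : p (Loc.invD k D)) (a : Loc k D) : p a := by
  obtain ⟨y, rfl⟩ := RingQuot.mkAlgHom_surjective k (LocRel D) a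
  change p (Loc.mk k D y)
  induction y using FreeAlgebra.induction with
  | grade0 r => rw [AlgHom.commutes, ← AlgHom.commutes (Loc.of k D)]; exact of _
  | grade1 x =>
    cases x with
    | none => exact invD
    | some a => exact of a
  | mul a b ha hb => rw [map_mul]; exact mul _ _ ha hb
  | add a b ha hb => rw [map_add]; exact add _ _ ha hb

/-- Induction on the localization of an FRT algebra. -/
theorem Loc.frtInduction {D : FRTAlg C} {p : Loc k D → Prop}
    (algebraMap : ∀ r, p (algebraMap k _ r))
    (add : ∀ a b, p a → p b → p (a + b)) (mul : ∀ a b, p a → p b → p (a * b))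
    (t : ∀ i j, p (Loc.of k D (FRTAlg.t C i j)))
    (invD : p (Loc.of k D D) → p (Loc.invD k D)) (a : Loc k D) : p a := by
  have h : ∀ a, p (Loc.of k D a) := fun a => by
    induction a using FRTAlg.induction with
    | algebraMap r => rw [AlgHom.commutes]; exact algebraMap r
    | add a b ha hb => rw [map_add]; exact add _ _ ha hb
    | mul a b ha hb => rw [map_mul]; exact mul _ _ ha hb
    | t i j => exact t i j
  exact Loc.induction add mul h (invD (h D)) a

/-- An element that intertwines two algebra maps on the generators intertwines them. -/
theorem Loc.intertwine {D : FRTAlg C} {R : Type z} [Ring R] [Algebra k R]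
    (L L' : Loc k D →ₐ[k] R) (Y : R)
    (h : ∀ i j, L (Loc.of k D (FRTAlg.t C i j)) * Y = Y * L' (Loc.of k D (FRTAlg.t C i j)))
    (a : Loc k D) : L a * Y = Y * L' a := by
  induction a using Loc.frtInduction with
  | algebraMap r => rw [AlgHom.commutes, AlgHom.commutes, Algebra.commutes]
  | add a b ha hb => rw [map_add, map_add, add_mul, mul_add, ha, hb]
  | mul a b ha hb => rw [map_mul, map_mul, mul_assoc, hb, ← mul_assoc, ha, mul_assoc]
  | t i j => exact h i j
  | invD hD =>
    -- `L` and `L'` send D⁻¹ to the inverses of the images of D, so the relation at D, known from A,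
    -- can be inverted.
    have h1 : L (Loc.invD k D) * L (Loc.of k D D) = 1 := by
      rw [← map_mul, Loc.invD_mul, map_one]
    have h2 : L' (Loc.of k D D) * L' (Loc.invD k D) = 1 := by
      rw [← map_mul, Loc.mul_invD, map_one]
    calc L (Loc.invD k D) * Y
        = L (Loc.invD k D) * (Y * L' (Loc.of k D D)) * L' (Loc.invD k D) := by
          rw [mul_assoc, mul_assoc, h2, mul_one]
      _ = Y * L' (Loc.invD k D) := by rw [← hD, ← mul_assoc, h1, one_mul]

end Induction

/-! ### Convolution inverses, checked on generators -/

section ConvInverse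

variable {k : Type u} [Field k] {A : Type w} [Ring A] [Bialgebra k A]
  {R : Type z} [Ring R] [Algebra k R]

/-- `F` is a right convolution inverse of `G` at `a`: `F a₍₁₎ * G a₍₂₎ = ε a`. -/
def ConvInvAt (F G : A →ₗ[k] R) (a : A) : Prop :=
  LinearMap.mul' k R (TensorProduct.map F G (Coalgebra.comul (R := k) a)) =
    algebraMap k R (Coalgebra.counit (R := k) a)

theorem ConvInvAt.algebraMap {F G : A →ₗ[k] R} (hF : F 1 = 1) (hG : G 1 = 1) (r : k) :
    ConvInvAt F G (algebraMap k A r) := by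
  have h : ConvInvAt F G 1 := by
    simp [ConvInvAt, Algebra.TensorProduct.one_def, hF, hG]
  simp only [ConvInvAt, Algebra.algebraMap_eq_smul_one, map_smul] at h ⊢
  rw [h]
  simp

theorem ConvInvAt.add {F G : A →ₗ[k] R} {a b : A} (ha : ConvInvAt F G a) (hb : ConvInvAt F G b) :
    ConvInvAt F G (a + b) := by
  simp only [ConvInvAt, map_add] at ha hb ⊢
  rw [ha, hb]

/-- As `G` reverses products, F a₍₁₎ F b₍₁₎ G b₍₂₎ G a₍₂₎ collapses from the inside: the pair in b
is the scalar ε(b), and then the pair in a is ε(a). Hence convolution inverses need checking only on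
algebra generators. -/
theorem ConvInvAt.mul {F G : A →ₗ[k] R} (hF : ∀ a b, F (a * b) = F a * F b)
    (hG : ∀ a b, G (a * b) = G b * G a) {a b : A} (ha : ConvInvAt F G a) (hb : ConvInvAt F G b) :
    ConvInvAt F G (a * b) := by
  simp only [ConvInvAt, Bialgebra.comul_mul, Bialgebra.counit_mul, map_mul] at ha hb ⊢
  rw [← ha]
  generalize Coalgebra.comul (R := k) a = X
  have h : ∀ (x y : A) (Y : A ⊗[k] A), LinearMap.mul' k R (TensorProduct.map F G (x ⊗ₜ y * Y)) =
      F x * LinearMap.mul' k R (TensorProduct.map F G Y) * G y := by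
    intro x y Y
    induction Y with
    | zero => simp
    | tmul c d => simp [hF, hG, mul_assoc]
    | add Y Z hY hZ => simp only [mul_add, map_add, add_mul, hY, hZ]
  induction X with
  | zero => simp
  | tmul x y =>
    rw [h, hb]
    simp only [TensorProduct.map_tmul, LinearMap.mul'_apply]
    rw [← Algebra.commutes, ← Algebra.commutes, mul_assoc]
  | add X Y hX hY => simp only [add_mul, map_add, hX, hY]

theorem ConvInvAt.mul' {F G : A →ₗ[k] R} (hF : ∀ a b, F (a * b) = F b * F a)
    (hG : ∀ a b, G (a * b) = G a * G b) {a b : A} (ha : ConvInvAt F G a) (hb : ConvInvAt F G b) :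
    ConvInvAt F G (a * b) := by
  simp only [ConvInvAt, Bialgebra.comul_mul, Bialgebra.counit_mul, map_mul] at ha hb ⊢
  rw [← hb]
  generalize Coalgebra.comul (R := k) b = Y
  have h : ∀ (x y : A) (X : A ⊗[k] A), LinearMap.mul' k R (TensorProduct.map F G (X * x ⊗ₜ y)) =
      F x * LinearMap.mul' k R (TensorProduct.map F G X) * G y := by
    intro x y Y
    induction Y with
    | zero => simp
    | tmul c d => simp [hF, hG, mul_assoc]
    | add Y Z hY hZ => simp only [mul_add, map_add, add_mul, hY, hZ]
  induction Y with
  | zero => simp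
  | tmul x y =>
    rw [h, ha]
    simp only [TensorProduct.map_tmul, LinearMap.mul'_apply]
    rw [← Algebra.commutes, mul_assoc]
  | add X Y hX hY => simp only [mul_add, map_add, hX, hY]

end ConvInverse

section FRTConvInverse

variable {k : Type u} [Field k] {ι : Type w} [Fintype ι] [DecidableEq ι]
  {C : ι → ι → ι → ι → k} {R : Type z} [Ring R] [Algebra k R]

theorem FRTAlg.convInvAt_t {F G : FRTAlg C →ₗ[k] R} {i j : ι}
    (h : ∑ l, F (FRTAlg.t C i l) * G (FRTAlg.t C l j) = if i = j then 1 else 0) :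
    ConvInvAt F G (FRTAlg.t C i j) := by
  rw [ConvInvAt, FRTAlg.comul_t, FRTAlg.counit_t]
  simp only [map_sum, TensorProduct.map_tmul, LinearMap.mul'_apply, h]
  split_ifs <;> simp

theorem FRTAlg.convInvAt (F : FRTAlg C →ₐ[k] R) (G : FRTAlg C →ₐ[k] Rᵐᵒᵖ)
    (h : ∀ i j, ∑ l, F (FRTAlg.t C i l) * (G (FRTAlg.t C l j)).unop = if i = j then 1 else 0)
    (a : FRTAlg C) :
    ConvInvAt F.toLinearMap
      ((MulOpposite.opLinearEquiv k).symm.toLinearMap ∘ₗ G.toLinearMap) a := by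
  induction a using FRTAlg.induction with
  | algebraMap r => exact ConvInvAt.algebraMap (by simp) (by simp) r
  | add a b ha hb => exact ha.add hb
  | mul a b ha hb => exact ConvInvAt.mul (by simp) (by simp) ha hb
  | t i j => exact FRTAlg.convInvAt_t (h i j)

theorem FRTAlg.convInvAt' (F : FRTAlg C →ₐ[k] Rᵐᵒᵖ) (G : FRTAlg C →ₐ[k] R)
    (h : ∀ i j, ∑ l, (F (FRTAlg.t C i l)).unop * G (FRTAlg.t C l j) = if i = j then 1 else 0)
    (a : FRTAlg C) :
    ConvInvAt ((MulOpposite.opLinearEquiv k).symm.toLinearMap ∘ₗ F.toLinearMap)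
      G.toLinearMap a := by
  induction a using FRTAlg.induction with
  | algebraMap r => exact ConvInvAt.algebraMap (by simp) (by simp) r
  | add a b ha hb => exact ha.add hb
  | mul a b ha hb => exact ConvInvAt.mul' (by simp) (by simp) ha hb
  | t i j => exact FRTAlg.convInvAt_t (h i j)

/-- At a group-like element convolution is ordinary multiplication. This is how the image of D is
shown to be invertible in the various extensions to the localization. -/
theorem ConvInvAt.groupLike {A : Type w} [Ring A] [Bialgebra k A] {F G : A →ₗ[k] R}
    {g : A} (hg : IsGroupLikeElem k g) (h : ConvInvAt F G g) : F g * G g = 1 := by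
  simpa [ConvInvAt, hg.comul_eq_tmul_self, hg.counit_eq_one] using h

end FRTConvInverse

/-! ### Structure constants of the braiding and of its inverse -/

section Coefficients

variable {k : Type u} [Field k] {V : Type v} [AddCommGroup V] [Module k V]
  {ι : Type w} [Fintype ι]

theorem braiding_basis (x : Module.Basis ι k V) (c : V ⊗[k] V ≃ₗ[k] V ⊗[k] V) (i j : ι) :
    c (x i ⊗ₜ x j) = ∑ p, ∑ q, coeffs x c i j p q • (x p ⊗ₜ[k] x q) := by
  rw [← (x.tensorProduct x).sum_repr (c (x i ⊗ₜ x j)), Fintype.sum_prod_type]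
  simp [coeffs]

/-- The braid equation for structure constants. -/
def IsYangBaxter (C : ι → ι → ι → ι → k) : Prop :=
  ∀ i j l p q s, ∑ a, ∑ b, ∑ d, C i j a b * C b l d s * C a d p q =
    ∑ a, ∑ b, ∑ d, C j l a b * C i a p d * C d b q s

theorem IsBraiding.isYangBaxter (x : Module.Basis ι k V) {c : V ⊗[k] V ≃ₗ[k] V ⊗[k] V}
    (hc : IsBraiding c) : IsYangBaxter (coeffs x c) := by
  classical
  intro i j l p q s
  have h := LinearMap.congr_fun hc ((x i ⊗ₜ x j) ⊗ₜ x l)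
  replace h := congrArg
    (fun y => ((x.tensorProduct x).tensorProduct x).repr y ((p, q), s)) h
  simp only [braidLeft, braidRight, LinearMap.comp_apply, LinearMap.rTensor_tmul,
    LinearMap.lTensor_tmul, LinearEquiv.coe_coe, braiding_basis, map_sum, map_smul,
    TensorProduct.sum_tmul, TensorProduct.tmul_sum, TensorProduct.assoc_tmul,
    TensorProduct.assoc_symm_tmul, ← TensorProduct.smul_tmul', TensorProduct.tmul_smul,
    Finsupp.coe_finsetSum, Finset.sum_apply, Finsupp.smul_apply, smul_eq_mul,
    Module.Basis.tensorProduct_repr_tmul_apply, Module.Basis.repr_self, Finsupp.single_apply,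
    mul_ite, mul_one, mul_zero, Finset.sum_ite_eq',
    Finset.mem_univ, if_true, Finset.sum_const_zero, Finset.sum_ite_irrel] at h
  simpa only [Finset.mul_sum, mul_assoc] using h

/-- Structure constants as a matrix. -/
def structureMatrix (C : ι → ι → ι → ι → k) : Matrix (ι × ι) (ι × ι) k :=
  Matrix.of fun a b => C a.1 a.2 b.1 b.2

theorem structureMatrix_mul_symm [DecidableEq ι] (x : Module.Basis ι k V)
    (c : V ⊗[k] V ≃ₗ[k] V ⊗[k] V) :
    structureMatrix (coeffs x c) * structureMatrix (coeffs x c.symm) = 1 := by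
  ext ⟨i, j⟩ ⟨p, q⟩
  have h := congrArg c.symm (braiding_basis x c i j)
  replace h := congrArg (fun y => (x.tensorProduct x).repr y (p, q)) h
  simp only [LinearEquiv.symm_apply_apply, map_sum, map_smul, Finsupp.coe_finsetSum,
    Finset.sum_apply, Finsupp.smul_apply, smul_eq_mul] at h
  rw [Matrix.mul_apply, Fintype.sum_prod_type]
  refine h.symm.trans ?_
  rw [← Module.Basis.tensorProduct_apply, Module.Basis.repr_self, Finsupp.single_apply,
    Matrix.one_apply]

theorem IsBraiding.symm {c : V ⊗[k] V ≃ₗ[k] V ⊗[k] V} (hc : IsBraiding c) :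
    IsBraiding c.symm := by
  have h1 : ∀ X, braidLeft c.symm (braidLeft c X) = X := fun X => by
    rw [braidLeft, braidLeft, ← LinearMap.comp_apply, ← LinearMap.rTensor_comp]
    simp
  have h2 : ∀ X, braidRight c.symm (braidRight c X) = X := fun X => by
    simp only [braidRight, LinearMap.comp_apply, LinearEquiv.coe_coe,
      LinearEquiv.apply_symm_apply]
    rw [← LinearMap.comp_apply (LinearMap.lTensor V _), ← LinearMap.lTensor_comp]
    simp
  have h3 : ∀ X, braidLeft c (braidLeft c.symm X) = X := fun X => by
    rw [braidLeft, braidLeft, ← LinearMap.comp_apply, ← LinearMap.rTensor_comp]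
    simp
  have h4 : ∀ X, braidRight c (braidRight c.symm X) = X := fun X => by
    simp only [braidRight, LinearMap.comp_apply, LinearEquiv.coe_coe,
      LinearEquiv.apply_symm_apply]
    rw [← LinearMap.comp_apply (LinearMap.lTensor V _), ← LinearMap.lTensor_comp]
    simp
  refine LinearMap.ext fun X => ?_
  -- The vector is chosen so that the left word in `c` returns `X`; undoing the right word with c⁻¹
  -- then gives the braid equation for c⁻¹.
  have h := LinearMap.congr_fun hc (braidLeft c.symm (braidRight c.symm (braidLeft c.symm X)))
  simp only [LinearMap.comp_apply] at h ⊢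
  rw [h3, h4, h3] at h
  have h5 := congrArg (fun Y => braidRight c.symm (braidLeft c.symm (braidRight c.symm Y))) h
  simp only [h1, h2] at h5
  exact h5.symm

end Coefficients

/-! ### Families satisfying the FRT relations -/

section FRTFamily

variable {k : Type u} [Field k] {ι : Type w} [Fintype ι] {R : Type z} [Ring R] [Algebra k R]

/-- The FRT relations for a family of elements of an algebra. -/
def IsFRTFamily (C : ι → ι → ι → ι → k) (f : ι → ι → R) : Prop :=
  ∀ i j r s, ∑ p, ∑ q, C i j p q • (f p r * f q s) = ∑ p, ∑ q, C p q r s • (f i p * f j q)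

/-- The algebra map from the FRT algebra given by a family that satisfies the FRT relations. -/
def IsFRTFamily.lift {C : ι → ι → ι → ι → k} {f : ι → ι → R} (hf : IsFRTFamily C f) :
    FRTAlg C →ₐ[k] R :=
  FRTAlg.lift f hf

@[simp] theorem IsFRTFamily.lift_t {C : ι → ι → ι → ι → k} {f : ι → ι → R}
    (hf : IsFRTFamily C f) (i j : ι) : hf.lift (FRTAlg.t C i j) = f i j :=
  FRTAlg.lift_t f hf i j

/-- The matrix `f i p * f j q`. -/
def tensorSquare (f : ι → ι → R) : Matrix (ι × ι) (ι × ι) R :=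
  Matrix.of fun a b => f a.1 b.1 * f a.2 b.2

/-- In this form the relations are visibly stable under inverting the structure matrix, and under
inverting the tensor square of the family. -/
theorem isFRTFamily_iff {C : ι → ι → ι → ι → k} {f : ι → ι → R} :
    IsFRTFamily C f ↔ Commute ((structureMatrix C).map (algebraMap k R)) (tensorSquare f) := by
  rw [Commute, SemiconjBy, ← Matrix.ext_iff]
  simp only [IsFRTFamily, Prod.forall, Matrix.mul_apply, Fintype.sum_prod_type, structureMatrix,
    tensorSquare, Matrix.map_apply, Matrix.of_apply, Algebra.smul_def, Algebra.commutes]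

variable [DecidableEq ι]

theorem IsFRTFamily.of_inverse {C C' : ι → ι → ι → ι → k}
    (h : structureMatrix C * structureMatrix C' = 1) {f : ι → ι → R} (hf : IsFRTFamily C f) :
    IsFRTFamily C' f := by
  rw [isFRTFamily_iff] at hf ⊢
  have h1 := congrArg (fun X => Matrix.map X (algebraMap k R)) h
  have h2 := congrArg (fun X => Matrix.map X (algebraMap k R)) (mul_eq_one_comm.1 h)
  simp only [Matrix.map_mul, Matrix.map_one _ (map_zero _) (map_one _)] at h1 h2
  exact hf.units_inv_left (u := ⟨_, _, h1, h2⟩)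

/-- For scalar families the tensor square is multiplicative, because entries commute; the inverse of
`f` therefore has the inverse tensor square, which commutes with the same matrices. -/
theorem IsFRTFamily.inv {C : ι → ι → ι → ι → k} {f g : ι → ι → k}
    (hf : IsFRTFamily C f) (h : Matrix.of f * Matrix.of g = 1) : IsFRTFamily C g := by
  rw [isFRTFamily_iff] at hf ⊢
  have h0 : ∀ {f g : ι → ι → k}, Matrix.of f * Matrix.of g = 1 →
      tensorSquare f * tensorSquare g = 1 := by
    intro f g h
    ext ⟨i, j⟩ ⟨p, q⟩
    have h1 := congrFun (congrFun h i) p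
    have h2 := congrFun (congrFun h j) q
    simp only [Matrix.mul_apply, Matrix.of_apply] at h1 h2
    have h3 : (1 : Matrix (ι × ι) (ι × ι) k) (i, j) (p, q) =
        (1 : Matrix ι ι k) i p * (1 : Matrix ι ι k) j q := by
      simp only [Matrix.one_apply, Prod.ext_iff, ite_and, mul_ite, mul_one, mul_zero]; split_ifs <;> rfl
    rw [h3, ← h1, ← h2, Finset.sum_mul_sum, Matrix.mul_apply, Fintype.sum_prod_type]
    exact Finset.sum_congr rfl fun _ _ => Finset.sum_congr rfl fun _ _ => by
      simp [tensorSquare]; ring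
  exact hf.units_inv_right (u := ⟨_, _, h0 h, h0 (mul_eq_one_comm.1 h)⟩)

variable {C C' : ι → ι → ι → ι → k}

/-- Entry (a, b) of the relation is the braid equation on x_a ⊗ x_i ⊗ x_j. The matrix attached to
t_i^p is the future r(t_i^p, t_j^q). -/
theorem IsYangBaxter.isFRTFamily (hC : IsYangBaxter C) :
    IsFRTFamily C (fun i p => Matrix.of fun j q => C j i p q) := by
  intro i j r s
  ext a b
  have h := hC a i j r s b
  simp only [Matrix.sum_apply, Matrix.smul_apply, Matrix.mul_apply, Matrix.of_apply, smul_eq_mul,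
    Finset.mul_sum]
  calc _ = ∑ p, ∑ q, ∑ d, C i j p q * C a p r d * C d q s b := by simp only [mul_assoc]
    _ = _ := h.symm
    _ = ∑ p, ∑ d, ∑ q, C a i p d * C d j q b * C p q r s := rfl
    _ = _ := by
      refine Finset.sum_congr rfl fun p _ => ?_
      rw [Finset.sum_comm]
      refine Finset.sum_congr rfl fun q _ => Finset.sum_congr rfl fun d _ => ?_
      ring

/-- Here entry (a, b) is the braid equation on x_i ⊗ x_j ⊗ x_a, and the free strand now forces the
reversed product. Used for c⁻¹, this gives the convolution inverse of the previous family. -/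
theorem IsYangBaxter.isFRTFamily_op (hC : IsYangBaxter C) :
    IsFRTFamily C (fun i p => MulOpposite.op (Matrix.of fun j q => C i j q p)) := by
  intro i j r s
  refine MulOpposite.unop_injective ?_
  ext a b
  have h := hC i j a b r s
  simp only [Finset.unop_sum, MulOpposite.unop_smul, MulOpposite.unop_mul,
    MulOpposite.unop_op,
    Matrix.sum_apply, Matrix.smul_apply, Matrix.mul_apply, Matrix.of_apply, smul_eq_mul,
    Finset.mul_sum]
  calc _ = ∑ p, ∑ q, ∑ d, C i j p q * C q a d s * C p d b r := by simp only [mul_assoc]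
    _ = _ := h
    _ = ∑ d, ∑ q, ∑ p, C j a d q * C i d b p * C p q r s := rfl
    _ = ∑ q, ∑ p, ∑ d, C j a d q * C i d b p * C p q r s := by
      rw [Finset.sum_comm]
      exact Finset.sum_congr rfl fun q _ => Finset.sum_comm
    _ = _ := by
      rw [Finset.sum_comm]
      refine Finset.sum_congr rfl fun q _ => Finset.sum_congr rfl fun p _ =>
        Finset.sum_congr rfl fun d _ => ?_
      ring

end FRTFamily

/-! ### Algebra maps twisted by a matrix representation -/

section Twist

variable {k : Type u} [Field k] {H : Type w} [Ring H] [Bialgebra k H]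
  {m : Type z} [Fintype m] [DecidableEq m]

/-- The matrix entries of a matrix representation. -/
def entry (ρ : H →ₐ[k] Matrix m m k) (i j : m) : H →ₗ[k] k :=
  Matrix.entryLinearMap k k i j ∘ₗ ρ.toLinearMap

@[simp] theorem entry_apply (ρ : H →ₐ[k] Matrix m m k) (i j : m) (a : H) :
    entry ρ i j a = ρ a i j := rfl

theorem commute_scalarAlgHom (ρ : H →ₐ[k] Matrix m m k) (a b : H) :
    Commute (((Algebra.ofId k H).mapMatrix.comp ρ) a) (Matrix.scalarAlgHom m k b) :=
  (Matrix.scalar_commute_iff.2 (by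
    ext i j
    simp [Algebra.ofId_apply, Algebra.commutes])).symm

/-- The algebra map `a ↦ ρ a₍₁₎ a₍₂₎`. -/
def leftTwist (ρ : H →ₐ[k] Matrix m m k) : H →ₐ[k] Matrix m m H :=
  (Algebra.TensorProduct.lift ((Algebra.ofId k H).mapMatrix.comp ρ) (Matrix.scalarAlgHom m k)
    (commute_scalarAlgHom ρ)).comp (Bialgebra.comulAlgHom k H)

/-- The algebra map `a ↦ a₍₁₎ ρ a₍₂₎`. -/
def rightTwist (ρ : H →ₐ[k] Matrix m m k) : H →ₐ[k] Matrix m m H :=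
  (Algebra.TensorProduct.lift (Matrix.scalarAlgHom m k) ((Algebra.ofId k H).mapMatrix.comp ρ)
    (fun a b => (commute_scalarAlgHom ρ b a).symm)).comp (Bialgebra.comulAlgHom k H)

theorem leftTwist_apply (ρ : H →ₐ[k] Matrix m m k) (a : H) (i j : m) :
    leftTwist ρ a i j =
      TensorProduct.lid k H ((entry ρ i j).rTensor H (Coalgebra.comul (R := k) a)) := by
  simp only [leftTwist, AlgHom.comp_apply, Bialgebra.comulAlgHom_apply]
  generalize Coalgebra.comul (R := k) a = X
  induction X with
  | zero => simp
  | tmul a b =>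
    rw [Algebra.TensorProduct.lift_tmul]
    simp [Algebra.smul_def, Algebra.ofId_apply]
  | add X Y hX hY => simp only [map_add, Matrix.add_apply, hX, hY]

theorem rightTwist_apply (ρ : H →ₐ[k] Matrix m m k) (a : H) (i j : m) :
    rightTwist ρ a i j =
      TensorProduct.rid k H ((entry ρ i j).lTensor H (Coalgebra.comul (R := k) a)) := by
  simp only [rightTwist, AlgHom.comp_apply, Bialgebra.comulAlgHom_apply]
  generalize Coalgebra.comul (R := k) a = X
  induction X with
  | zero => simp
  | tmul a b =>
    rw [Algebra.TensorProduct.lift_tmul]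
    simp [Algebra.smul_def, Algebra.ofId_apply, Algebra.commutes]
  | add X Y hX hY => simp only [map_add, Matrix.add_apply, hX, hY]

/-- The convolution products of the matrix entries of a matrix representation are the entries of
its convolution square. -/
def convSquare (ρ : H →ₐ[k] Matrix m m k) : H →ₐ[k] Matrix (m × m) (m × m) k :=
  (Matrix.compAlgEquiv m m k k).toAlgHom.comp (ρ.mapMatrix.comp (leftTwist ρ))

theorem convSquare_apply (ρ : H →ₐ[k] Matrix m m k) (a : H) (j i s r : m) :
    convSquare ρ a (j, i) (s, r) =
      (WithConv.toConv (entry ρ j s) * WithConv.toConv (entry ρ i r)) a := by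
  rw [LinearMap.convMul_apply]
  have h : convSquare ρ a (j, i) (s, r) = entry ρ i r (leftTwist ρ a j s) := rfl
  rw [h, leftTwist_apply]
  generalize Coalgebra.comul (R := k) a = X
  induction X with
  | zero => simp
  | tmul a b => simp
  | add X Y hX hY => simp only [map_add, hX, hY]

end Twist

/-! ### The representation of the localization on V -/

section Rep

variable {k : Type u} [Field k] {ι : Type w} [Fintype ι] [DecidableEq ι]
  {C C' : ι → ι → ι → ι → k}

/-- The representation `t i p ↦ (C j i p q)_{j q}` of the FRT algebra. -/
def IsYangBaxter.rep (hC : IsYangBaxter C) : FRTAlg C →ₐ[k] Matrix ι ι k :=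
  hC.isFRTFamily.lift

@[simp] theorem IsYangBaxter.rep_t (hC : IsYangBaxter C) (i p : ι) :
    hC.rep (FRTAlg.t C i p) = Matrix.of fun j q => C j i p q := IsFRTFamily.lift_t _ _ _

/-- The antirepresentation `t i p ↦ (C' i j q p)_{j q}` of the FRT algebra. -/
def IsYangBaxter.antirep (hC' : IsYangBaxter C')
    (h : structureMatrix C * structureMatrix C' = 1) : FRTAlg C →ₐ[k] (Matrix ι ι k)ᵐᵒᵖ :=
  -- The braid equation for `C'` gives the relations with constants `C'`; those with the inverse
  -- constants `C` are equivalent.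
  (hC'.isFRTFamily_op.of_inverse (mul_eq_one_comm.1 h)).lift

@[simp] theorem IsYangBaxter.antirep_t (hC' : IsYangBaxter C')
    (h : structureMatrix C * structureMatrix C' = 1) (i p : ι) :
    hC'.antirep h (FRTAlg.t C i p) = MulOpposite.op (Matrix.of fun j q => C' i j q p) :=
  IsFRTFamily.lift_t _ _ _

/-- On generators the convolution identity is the matrix equation C C' = 1; at a group-like element
it becomes invertibility. Applied to D, it lets `IsYangBaxter.rep` extend to the localization. -/
theorem IsYangBaxter.rep_mul_antirep (hC : IsYangBaxter C) (hC' : IsYangBaxter C')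
    (h : structureMatrix C * structureMatrix C' = 1) {g : FRTAlg C} (hg : IsGroupLikeElem k g) :
    hC.rep g * (hC'.antirep h g).unop = 1 := by
  refine ConvInvAt.groupLike hg (FRTAlg.convInvAt hC.rep (hC'.antirep h) (fun i j => ?_) g)
  ext a b
  have h1 := congrFun (congrFun h (a, i)) (b, j)
  rw [Matrix.mul_apply, Fintype.sum_prod_type] at h1
  simp only [structureMatrix, Matrix.of_apply, Matrix.one_apply, Prod.mk.injEq] at h1
  simp only [rep_t, antirep_t, MulOpposite.unop_op, Matrix.sum_apply, Matrix.mul_apply,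
    Matrix.of_apply, h1]
  split_ifs <;> simp_all [Matrix.one_apply]

/-- The extension of `IsYangBaxter.rep` to the localization. -/
def IsYangBaxter.locRep (hC : IsYangBaxter C) (hC' : IsYangBaxter C')
    (h : structureMatrix C * structureMatrix C' = 1) (D : GroupLike k (FRTAlg C)) :
    Loc k D.val →ₐ[k] Matrix ι ι k :=
  Loc.lift hC.rep (hC'.antirep h D.val).unop
    (mul_eq_one_comm.1 (hC.rep_mul_antirep hC' h D.isGroupLikeElem_val))
    (hC.rep_mul_antirep hC' h D.isGroupLikeElem_val)

variable (hC : IsYangBaxter C) (hC' : IsYangBaxter C')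
    (h : structureMatrix C * structureMatrix C' = 1) (D : GroupLike k (FRTAlg C))

@[simp] theorem IsYangBaxter.locRep_t (i p : ι) :
    hC.locRep hC' h D (Loc.of k D.val (FRTAlg.t C i p)) = Matrix.of fun j q => C j i p q := by
  rw [locRep, Loc.lift_of, rep_t]

theorem Loc.comul_of_t (i j : ι) :
    Coalgebra.comul (R := k) (Loc.of k D.val (FRTAlg.t C i j)) =
      ∑ p, Loc.of k D.val (FRTAlg.t C i p) ⊗ₜ[k] Loc.of k D.val (FRTAlg.t C p j) := by
  refine (Loc.comulHom_of k D _).trans ?_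
  rw [FRTAlg.comul_t]
  simp

theorem Loc.counit_of_t (i j : ι) :
    Coalgebra.counit (R := k) (Loc.of k D.val (FRTAlg.t C i j)) = if i = j then (1 : k) else 0 := by
  refine (Loc.counitHom_of k D _).trans (FRTAlg.counit_t _ _ _)

theorem IsYangBaxter.convSquare_locRep_t (a b j i s r : ι) :
    convSquare (hC.locRep hC' h D) (Loc.of k D.val (FRTAlg.t C a b)) (j, i) (s, r) =
      ∑ d, C j a d s * C i d b r := by
  rw [convSquare_apply, LinearMap.convMul_apply, Loc.comul_of_t]
  simp

/-- Evaluated at an element a of the localization, the relations say that a constant matrix built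
from `C` commutes with the convolution square of the representation at a. As that square is an
algebra map, only the generators matter, and there the claim is the braid equation. -/
theorem IsYangBaxter.isFRTFamily_entry :
    IsFRTFamily C (fun j q => MulOpposite.op
      (WithConv.toConv (entry (hC.locRep hC' h D) j q))) := by
  set ρ := hC.locRep hC' h D with hρ
  intro i j r s
  refine MulOpposite.unop_injective ?_
  rw [Finset.unop_sum, Finset.unop_sum]
  simp only [Finset.unop_sum, MulOpposite.unop_smul, MulOpposite.unop_mul, MulOpposite.unop_op]
  refine WithConv.ext (LinearMap.ext fun a => ?_)
  have h1 := Loc.intertwine (convSquare ρ) (convSquare ρ)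
    -- The indices are swapped within each pair because the opposite convolution product reverses
    -- the two factors.
    (Matrix.of fun a b => C a.2 a.1 b.2 b.1) (fun a b => by
      ext ⟨j, i⟩ ⟨s, r⟩
      rw [Matrix.mul_apply, Matrix.mul_apply, Fintype.sum_prod_type, Fintype.sum_prod_type]
      simp only [Matrix.of_apply, hρ, convSquare_locRep_t, Finset.mul_sum, Finset.sum_mul]
      calc _ = ∑ x, ∑ d, ∑ y, C j a d x * C i d b y * C y x r s :=
            Finset.sum_congr rfl fun x _ => Finset.sum_comm
        _ = ∑ d, ∑ x, ∑ y, C j a d x * C i d b y * C y x r s := Finset.sum_comm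
        _ = _ := (hC i j a b r s).symm
        _ = ∑ x, ∑ y, ∑ d, C i j y x * C x a d s * C y d b r := Finset.sum_comm
        _ = _ := by simp only [mul_assoc]) a
  have h2 := congrFun (congrFun h1 (j, i)) (s, r)
  rw [Matrix.mul_apply, Matrix.mul_apply, Fintype.sum_prod_type, Fintype.sum_prod_type] at h2
  simp only [Matrix.of_apply, convSquare_apply] at h2
  simp only [WithConv.ofConv_sum, WithConv.ofConv_smul, LinearMap.sum_apply, LinearMap.smul_apply,
    smul_eq_mul]
  rw [Finset.sum_comm, ← h2, Finset.sum_comm]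
  exact Finset.sum_congr rfl fun _ _ => Finset.sum_congr rfl fun _ _ => mul_comm _ _

end Rep

theorem sum_comm_pairs {α β γ δ M : Type*} [AddCommMonoid M] (s : Finset α) (t : Finset β)
    (u : Finset γ) (v : Finset δ) (F : α → β → γ → δ → M) :
    ∑ i ∈ s, ∑ j ∈ t, ∑ m ∈ u, ∑ l ∈ v, F i j m l =
      ∑ l ∈ v, ∑ m ∈ u, ∑ i ∈ s, ∑ j ∈ t, F i j m l := by
  calc _ = ∑ i ∈ s, ∑ l ∈ v, ∑ j ∈ t, ∑ m ∈ u, F i j m l :=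
        Finset.sum_congr rfl fun i _ => by
          rw [Finset.sum_comm (s := v)]
          exact Finset.sum_congr rfl fun j _ => Finset.sum_comm
    _ = ∑ l ∈ v, ∑ i ∈ s, ∑ m ∈ u, ∑ j ∈ t, F i j m l := by
        rw [Finset.sum_comm]
        exact Finset.sum_congr rfl fun l _ => Finset.sum_congr rfl fun i _ => Finset.sum_comm
    _ = _ := Finset.sum_congr rfl fun l _ => Finset.sum_comm

/-! ### Bilinear forms from algebra maps into the opposite dual -/

section Pairing

variable {k : Type u} [Field k] {A : Type w} [Ring A] [Bialgebra k A]
  {H : Type z} [Ring H] [Bialgebra k H]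

/-- The bilinear form of an algebra map to the opposite of the convolution algebra. -/
def pairing (Θ : A →ₐ[k] (WithConv (H →ₗ[k] k))ᵐᵒᵖ) : H →ₗ[k] A →ₗ[k] k :=
  LinearMap.mk₂ k (fun h a => (Θ a).unop h)
    (by simp) (by simp) (by simp) (by simp)

theorem pairing_apply (Θ : A →ₐ[k] (WithConv (H →ₗ[k] k))ᵐᵒᵖ) (h : H) (a : A) :
    pairing Θ h a = (Θ a).unop h := rfl

variable (Θ : A →ₐ[k] (WithConv (H →ₗ[k] k))ᵐᵒᵖ)

theorem pairing_one_right (h : H) : pairing Θ h 1 = Coalgebra.counit (R := k) h := by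
  simp [pairing_apply]

/-- Multiplicativity of Θ into the opposite algebra is what produces the reversed order of the
Sweedler factors required in the second variable. -/
theorem pairing_mul_right (h : H) (a b : A) : pairing Θ h (a * b) =
    LinearMap.mul' k k (TensorProduct.map ((pairing Θ).flip b) ((pairing Θ).flip a)
      (Coalgebra.comul (R := k) h)) := by
  rw [pairing_apply, map_mul, MulOpposite.unop_mul, LinearMap.convMul_apply]
  rfl

/-- Multiplicativity of the pairing in the first variable, at an element of the second. -/
def PairingMulLeft (d : A) : Prop := ∀ a b : H, pairing Θ (a * b) d =
  LinearMap.mul' k k (TensorProduct.map (pairing Θ a) (pairing Θ b) (Coalgebra.comul (R := k) d))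

/-- Unitality of the pairing in the first variable, at an element of the second. -/
def PairingOneLeft (d : A) : Prop := pairing Θ 1 d = Coalgebra.counit (R := k) d

variable {Θ}

theorem PairingOneLeft.algebraMap (r : k) : PairingOneLeft Θ (algebraMap k A r) := by
  simp [PairingOneLeft, Algebra.algebraMap_eq_smul_one, pairing_one_right]

theorem PairingOneLeft.add {a b : A} (ha : PairingOneLeft Θ a) (hb : PairingOneLeft Θ b) :
    PairingOneLeft Θ (a + b) := by
  simp only [PairingOneLeft, map_add] at ha hb ⊢
  rw [ha, hb]

theorem PairingOneLeft.mul {a b : A} (ha : PairingOneLeft Θ a) (hb : PairingOneLeft Θ b) :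
    PairingOneLeft Θ (a * b) := by
  rw [PairingOneLeft] at ha hb ⊢
  rw [pairing_mul_right]
  simp [Algebra.TensorProduct.one_def, ha, hb, mul_comm]

theorem PairingMulLeft.algebraMap (r : k) : PairingMulLeft Θ (algebraMap k A r) := by
  intro a b
  simp [Algebra.algebraMap_eq_smul_one, pairing_one_right, Algebra.TensorProduct.one_def]

theorem PairingMulLeft.add {a b : A} (ha : PairingMulLeft Θ a) (hb : PairingMulLeft Θ b) :
    PairingMulLeft Θ (a + b) := by
  intro x y
  simp only [map_add, ha x y, hb x y]

theorem PairingMulLeft.mul {d e : A} (hd : PairingMulLeft Θ d) (he : PairingMulLeft Θ e) :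
    PairingMulLeft Θ (d * e) := by
  intro a b
  rw [pairing_mul_right, Bialgebra.comul_mul, Bialgebra.comul_mul]
  -- With all four coproducts expanded, multiplicativity at d and e turns both sides into the same
  -- quadruple sum, up to the order of summation and of scalar factors.
  rw [← (Coalgebra.Repr.arbitrary k a).eq, ← (Coalgebra.Repr.arbitrary k b).eq,
    ← (Coalgebra.Repr.arbitrary k d).eq, ← (Coalgebra.Repr.arbitrary k e).eq]
  simp only [Finset.sum_mul_sum, Algebra.TensorProduct.tmul_mul_tmul, map_sum,
    TensorProduct.map_tmul, LinearMap.mul'_apply, LinearMap.flip_apply, hd _ _, he _ _,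
    pairing_mul_right]
  rw [← (Coalgebra.Repr.arbitrary k a).eq, ← (Coalgebra.Repr.arbitrary k b).eq,
    ← (Coalgebra.Repr.arbitrary k d).eq, ← (Coalgebra.Repr.arbitrary k e).eq]
  simp only [Finset.sum_mul_sum, map_sum,
    TensorProduct.map_tmul, LinearMap.mul'_apply, LinearMap.flip_apply]
  rw [sum_comm_pairs]
  exact Finset.sum_congr rfl fun _ _ => Finset.sum_congr rfl fun _ _ =>
    Finset.sum_congr rfl fun _ _ => Finset.sum_congr rfl fun _ _ => by ring

end Pairing

/-! ### Extending the canonical form to the localization -/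

section Theta

variable {k : Type u} [Field k] {ι : Type w} [Fintype ι] [DecidableEq ι]
  {C C' : ι → ι → ι → ι → k}
  (hC : IsYangBaxter C) (hC' : IsYangBaxter C')
    (h : structureMatrix C * structureMatrix C' = 1) (D : GroupLike k (FRTAlg C))

/-- The map from the FRT algebra to the opposite of the dual of its localization. -/
def IsYangBaxter.theta : FRTAlg C →ₐ[k] (WithConv (Loc k D.val →ₗ[k] k))ᵐᵒᵖ :=
  (hC.isFRTFamily_entry hC' h D).lift

theorem IsYangBaxter.pairing_theta_t (a : Loc k D.val) (j q : ι) :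
    pairing (hC.theta hC' h D) a (FRTAlg.t C j q) = hC.locRep hC' h D a j q := by
  rw [pairing_apply, theta, IsFRTFamily.lift_t]
  rfl

theorem IsYangBaxter.pairingOneLeft_theta (d : FRTAlg C) :
    PairingOneLeft (hC.theta hC' h D) d := by
  induction d using FRTAlg.induction with
  | algebraMap r => exact .algebraMap r
  | add a b ha hb => exact ha.add hb
  | mul a b ha hb => exact ha.mul hb
  | t i j => simp [PairingOneLeft, pairing_theta_t, FRTAlg.counit_t, Matrix.one_apply]

theorem IsYangBaxter.pairingMulLeft_theta (d : FRTAlg C) :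
    PairingMulLeft (hC.theta hC' h D) d := by
  induction d using FRTAlg.induction with
  | algebraMap r => exact .algebraMap r
  | add a b ha hb => exact ha.add hb
  | mul a b ha hb => exact ha.mul hb
  | t i j =>
    intro a b
    simp [pairing_theta_t, FRTAlg.comul_t, Matrix.mul_apply]

/-- The character `a ↦ r (a, D)`. -/
def IsYangBaxter.detChar : Loc k D.val →ₐ[k] k :=
  AlgHom.ofLinearMap ((pairing (hC.theta hC' h D)).flip D.val)
    (by simpa [PairingOneLeft] using hC.pairingOneLeft_theta hC' h D D.val)
    (fun a b => by
      have h1 := hC.pairingMulLeft_theta hC' h D D.val a b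
      rw [D.isGroupLikeElem_val.comul_eq_tmul_self] at h1
      simpa using h1)

theorem IsYangBaxter.theta_det : hC.theta hC' h D D.val =
    MulOpposite.op (WithConv.toConv (hC.detChar hC' h D).toLinearMap) := by
  refine MulOpposite.unop_injective (WithConv.ext (LinearMap.ext fun a => ?_))
  rfl

/-- Scalars commute, so a character is also an antihomomorphism and the identity spreads from
generators. At D⁻¹ it is the inverse of the identity at D. -/
theorem Loc.toConv_mul_toConv {χ χ' : Loc k D.val →ₐ[k] k}
    (hχ : ∀ i j, ∑ l, χ (Loc.of k D.val (FRTAlg.t C i l)) * χ' (Loc.of k D.val (FRTAlg.t C l j)) =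
      if i = j then 1 else 0) :
    WithConv.toConv χ.toLinearMap * WithConv.toConv χ'.toLinearMap = 1 := by
  have hg : ∀ g, IsGroupLikeElem k g → χ g * χ' g = 1 →
      ConvInvAt χ.toLinearMap χ'.toLinearMap g := fun g hg h => by
    simpa [ConvInvAt, hg.comul_eq_tmul_self, hg.counit_eq_one] using h
  refine WithConv.ext (LinearMap.ext fun a => ?_)
  change ConvInvAt χ.toLinearMap χ'.toLinearMap a
  induction a using Loc.frtInduction with
  | algebraMap r => exact .algebraMap (by simp) (by simp) r
  | add a b ha hb => exact ha.add hb
  | mul a b ha hb => exact .mul (by simp) (by simp [mul_comm]) ha hb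
  | t i j =>
    rw [ConvInvAt, Loc.comul_of_t, Loc.counit_of_t]
    simp only [map_sum, TensorProduct.map_tmul, LinearMap.mul'_apply, AlgHom.toLinearMap_apply, hχ]
    split_ifs <;> simp
  | invD hD =>
    refine hg _ (Loc.isGroupLikeElem_invD k D) ?_
    have h1 : χ (Loc.of k D.val D.val) * χ' (Loc.of k D.val D.val) = 1 :=
      hD.groupLike (D.isGroupLikeElem_val.map (Loc.ofCoalgHom k D))
    have h2 : ∀ χ : Loc k D.val →ₐ[k] k, χ (Loc.invD k D.val) * χ (Loc.of k D.val D.val) = 1 :=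
      fun χ => by rw [← map_mul, Loc.invD_mul, map_one]
    calc χ (Loc.invD k D.val) * χ' (Loc.invD k D.val)
        = χ (Loc.invD k D.val) * χ' (Loc.invD k D.val) *
          (χ (Loc.of k D.val D.val) * χ' (Loc.of k D.val D.val)) := by rw [h1, mul_one]
      _ = (χ (Loc.invD k D.val) * χ (Loc.of k D.val D.val)) *
          (χ' (Loc.invD k D.val) * χ' (Loc.of k D.val D.val)) := by ring
      _ = 1 := by rw [h2, h2, one_mul]

variable {D}

theorem Loc.isFRTFamily_char (χ : Loc k D.val →ₐ[k] k) :
    IsFRTFamily C fun i j => χ (Loc.of k D.val (FRTAlg.t C i j)) := by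
  intro i j r s
  have h1 := congrArg (fun a => χ (Loc.of k D.val a)) (FRTAlg.t_rel C i j r s)
  simpa using h1

theorem Loc.char_mul {p : ι → ι → Loc k D.val}
    (hp : ∀ i j, ∑ l, Loc.of k D.val (FRTAlg.t C i l) * p l j = if i = j then 1 else 0)
    (χ : Loc k D.val →ₐ[k] k) :
    (Matrix.of fun i j => χ (Loc.of k D.val (FRTAlg.t C i j))) *
      (Matrix.of fun i j => χ (p i j)) = 1 := by
  ext i j
  have h1 := congrArg χ (hp i j)
  rw [map_sum, apply_ite χ, map_one, map_zero] at h1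
  simpa [Matrix.mul_apply, Matrix.one_apply] using h1

/-- If the matrix of generators has a right inverse, then the characters of the localization are
invertible for the convolution. -/
theorem Loc.exists_char_inverse {p : ι → ι → Loc k D.val}
    (hp : ∀ i j, ∑ l, Loc.of k D.val (FRTAlg.t C i l) * p l j = if i = j then 1 else 0)
    (χ : Loc k D.val →ₐ[k] k) : ∃ χ' : Loc k D.val →ₐ[k] k,
      WithConv.toConv χ.toLinearMap * WithConv.toConv χ'.toLinearMap = 1 ∧
      WithConv.toConv χ'.toLinearMap * WithConv.toConv χ.toLinearMap = 1 := by
  have h0 := Loc.char_mul hp χ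
  have h0' := mul_eq_one_comm.1 h0
  -- The inverse of the scalar matrix χ(t) again satisfies the FRT relations, so it defines a
  -- character of A(c).
  let ψ : FRTAlg C →ₐ[k] k := ((Loc.isFRTFamily_char χ).inv h0).lift
  have hψ : ∀ i j, ψ (FRTAlg.t C i j) = χ (p i j) := fun i j => IsFRTFamily.lift_t _ _ _
  have h1 : ∀ a, ConvInvAt (χ.comp (Loc.of k D.val)).toLinearMap ψ.toLinearMap a := by
    intro a
    induction a using FRTAlg.induction with
    | algebraMap r => exact .algebraMap (by simp) (by simp) r
    | add a b ha hb => exact ha.add hb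
    | mul a b ha hb => exact .mul (by simp) (by simp [mul_comm]) ha hb
    | t i j =>
      refine FRTAlg.convInvAt_t ?_
      simpa [hψ, Matrix.mul_apply, Matrix.one_apply] using congrFun (congrFun h0 i) j
  have h2 : χ (Loc.of k D.val D.val) * ψ D.val = 1 := by
    have h3 := (h1 D.val).groupLike D.isGroupLikeElem_val
    rwa [AlgHom.toLinearMap_apply, AlgHom.toLinearMap_apply, AlgHom.comp_apply] at h3
  -- The value at D⁻¹ is forced: χ(D) ψ(D) = 1 makes χ(D) the inverse of ψ(D).
  refine ⟨Loc.lift ψ (χ (Loc.of k D.val D.val)) h2 ((mul_comm _ _).trans h2),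
    Loc.toConv_mul_toConv D fun i j => ?_, Loc.toConv_mul_toConv D fun i j => ?_⟩
  · simpa [hψ, Matrix.mul_apply, Matrix.one_apply] using congrFun (congrFun h0 i) j
  · simpa [hψ, Matrix.mul_apply, Matrix.one_apply] using congrFun (congrFun h0' i) j

/-- The canonical form on the localization of the FRT algebra exists as soon as the matrix of
generators has a right inverse. -/
theorem IsYangBaxter.exists_pairing (hC : IsYangBaxter C) (hC' : IsYangBaxter C')
    (h : structureMatrix C * structureMatrix C' = 1) {p : ι → ι → Loc k D.val}
    (hp : ∀ i j, ∑ l, Loc.of k D.val (FRTAlg.t C i l) * p l j = if i = j then 1 else 0) :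
    ∃ Θ : Loc k D.val →ₐ[k] (WithConv (Loc k D.val →ₗ[k] k))ᵐᵒᵖ,
      (∀ d, PairingOneLeft Θ d) ∧ (∀ d, PairingMulLeft Θ d) ∧
      ∀ i j q s, pairing Θ (Loc.of k D.val (FRTAlg.t C i q)) (Loc.of k D.val (FRTAlg.t C j s)) =
        C j i q s := by
  obtain ⟨χ', h1, h2⟩ := Loc.exists_char_inverse hp (hC.detChar hC' h D)
  -- D acts in the second variable as the character `IsYangBaxter.detChar`, so D⁻¹ must act as its
  -- convolution inverse χ'.
  let Θ : Loc k D.val →ₐ[k] (WithConv (Loc k D.val →ₗ[k] k))ᵐᵒᵖ :=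
    Loc.lift (hC.theta hC' h D) (MulOpposite.op (WithConv.toConv χ'.toLinearMap))
      (by rw [hC.theta_det, ← MulOpposite.op_mul, h1, MulOpposite.op_one])
      (by rw [hC.theta_det, ← MulOpposite.op_mul, h2, MulOpposite.op_one])
  have hof : ∀ a d, pairing Θ a (Loc.of k D.val d) = pairing (hC.theta hC' h D) a d := fun a d => by
    rw [pairing_apply, Loc.lift_of, pairing_apply]
  have hinv : ∀ a, pairing Θ a (Loc.invD k D.val) = χ' a := fun a => by
    rw [pairing_apply, Loc.lift_invD]
    rfl
  refine ⟨Θ, fun d => ?_, fun d => ?_, fun i j q s => ?_⟩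
  · induction d using Loc.induction with
    | add a b ha hb => exact ha.add hb
    | mul a b ha hb => exact ha.mul hb
    | of a =>
      rw [PairingOneLeft, hof, (hC.pairingOneLeft_theta hC' h D a)]
      exact (Loc.counitHom_of k D a).symm
    | invD =>
      rw [PairingOneLeft, hinv, map_one, (Loc.isGroupLikeElem_invD k D).counit_eq_one]
  · induction d using Loc.induction with
    | add a b ha hb => exact ha.add hb
    | mul a b ha hb => exact ha.mul hb
    | of d =>
      intro a b
      rw [hof, (hC.pairingMulLeft_theta hC' h D d a b)]
      have h3 : Coalgebra.comul (R := k) (Loc.of k D.val d) = _ := Loc.comulHom_of k D d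
      rw [h3]
      generalize Coalgebra.comul (R := k) d = X
      induction X with
      | zero => simp
      | tmul u v => simp [hof]
      | add X Y hX hY => simp only [map_add, hX, hY]
    | invD =>
      intro a b
      rw [hinv, map_mul, (Loc.isGroupLikeElem_invD k D).comul_eq_tmul_self]
      simp [hinv]
  · rw [hof, hC.pairing_theta_t, hC.locRep_t]
    rfl

end Theta

/-! ### The commutation rule as an intertwining relation -/

section Corep

variable {k : Type u} [Field k] {H : Type w} [Ring H] [Bialgebra k H]

/-- Matrix coalgebra elements: `Δ (X i j) = ∑ l, X i l ⊗ X l j`, `ε (X i j) = δ_ij`. -/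
structure IsCorep (k : Type u) [Field k] {H : Type w} [Ring H] [Bialgebra k H]
    {m : Type z} [Fintype m] [DecidableEq m] (X : Matrix m m H) : Prop where
  comul : ∀ i j, Coalgebra.comul (R := k) (X i j) = ∑ l, X i l ⊗ₜ[k] X l j
  counit : ∀ i j, Coalgebra.counit (R := k) (X i j) = if i = j then (1 : k) else 0

/-- The commutation relation of a coquasitriangular structure at two elements. -/
def CommAt (r : H →ₗ[k] H →ₗ[k] k) (a b : H) : Prop :=
  TensorProduct.lid k H (TensorProduct.map (TensorProduct.lift r) (LinearMap.mul' k H)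
      (Coalgebra.comul (R := k) (a ⊗ₜ[k] b))) =
    TensorProduct.rid k H (TensorProduct.map
      (LinearMap.mul' k H ∘ₗ (TensorProduct.comm k H H).toLinearMap) (TensorProduct.lift r)
      (Coalgebra.comul (R := k) (a ⊗ₜ[k] b)))

variable {m : Type z} [Fintype m] [DecidableEq m]
  (Θ : H →ₐ[k] (WithConv (H →ₗ[k] k))ᵐᵒᵖ) {X : Matrix m m H}

/-- The representation `a ↦ r (a, X i j)` for a matrix coalgebra `X`. -/
def IsCorep.repRight (hX : IsCorep k X) (h1 : ∀ d, PairingOneLeft Θ d)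
    (hm : ∀ d, PairingMulLeft Θ d) : H →ₐ[k] Matrix m m k :=
  AlgHom.ofLinearMap
    { toFun := fun a => Matrix.of fun i j => pairing Θ a (X i j)
      map_add' := fun a b => by ext; simp
      map_smul' := fun r a => by ext; simp }
    (by
      ext i j
      simpa [PairingOneLeft, hX.counit, Matrix.one_apply] using h1 (X i j))
    (fun a b => by
      ext i j
      simpa [PairingMulLeft, hX.comul, Matrix.mul_apply] using hm (X i j) a b)

/-- The representation `b ↦ r (X j i, b)` for a matrix coalgebra `X`. -/
def IsCorep.repLeft (hX : IsCorep k X) : H →ₐ[k] Matrix m m k :=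
  AlgHom.ofLinearMap
    { toFun := fun b => Matrix.of fun i j => pairing Θ (X j i) b
      map_add' := fun a b => by ext; simp
      map_smul' := fun r a => by ext; simp }
    (by
      ext i j
      simp [pairing_one_right, hX.counit, Matrix.one_apply, eq_comm])
    (fun a b => by
      ext i j
      simp [pairing_mul_right, hX.comul, Matrix.mul_apply, mul_comm])

variable {Θ}

/-- With the second argument running over a matrix coalgebra, the rule is one matrix identity in
which the first argument enters only through two algebra maps. `Loc.intertwine` then reduces it to
generators. -/
theorem IsCorep.commAt_right_iff (hX : IsCorep k X) (h1 : ∀ d, PairingOneLeft Θ d)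
    (hm : ∀ d, PairingMulLeft Θ d) (a : H) :
    (∀ i j, CommAt (pairing Θ) a (X i j)) ↔
      leftTwist (hX.repRight Θ h1 hm) a * X = X * rightTwist (hX.repRight Θ h1 hm) a := by
  rw [← Matrix.ext_iff]
  refine forall_congr' fun i => forall_congr' fun j => ?_
  simp only [CommAt, TensorProduct.comul_tmul, hX.comul, Matrix.mul_apply, leftTwist_apply,
    rightTwist_apply]
  generalize Coalgebra.comul (R := k) a = U
  have e1 : ∀ U : H ⊗[k] H, TensorProduct.lid k H (TensorProduct.map (TensorProduct.lift (pairing Θ))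
      (LinearMap.mul' k H) (TensorProduct.AlgebraTensorModule.tensorTensorTensorComm k k k k H H H H
        (U ⊗ₜ[k] ∑ l, X i l ⊗ₜ[k] X l j))) =
      ∑ l, TensorProduct.lid k H ((entry (hX.repRight Θ h1 hm) i l).rTensor H U) * X l j := by
    intro U
    induction U with
    | zero => simp
    | tmul u v => simp [TensorProduct.tmul_sum]; rfl
    | add U U' h h' =>
      simp only [TensorProduct.add_tmul, map_add, h, h', add_mul, Finset.sum_add_distrib]
  have e2 : ∀ U : H ⊗[k] H, TensorProduct.rid k H (TensorProduct.map
      (LinearMap.mul' k H ∘ₗ (TensorProduct.comm k H H).toLinearMap)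
      (TensorProduct.lift (pairing Θ))
      (TensorProduct.AlgebraTensorModule.tensorTensorTensorComm k k k k H H H H
        (U ⊗ₜ[k] ∑ l, X i l ⊗ₜ[k] X l j))) =
      ∑ l, X i l * TensorProduct.rid k H ((entry (hX.repRight Θ h1 hm) l j).lTensor H U) := by
    intro U
    induction U with
    | zero => simp
    | tmul u v => simp [TensorProduct.tmul_sum]; rfl
    | add U U' h h' =>
      simp only [TensorProduct.add_tmul, map_add, h, h', mul_add, Finset.sum_add_distrib]
  rw [e1, e2]

/-- The same device for the first variable. The transpose appears because multiplication in the
second variable reverses the Sweedler factors of the first. -/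
theorem IsCorep.commAt_left_iff (hX : IsCorep k X) (b : H) :
    (∀ i j, CommAt (pairing Θ) (X i j) b) ↔
      rightTwist (hX.repLeft Θ) b * X.transpose = X.transpose * leftTwist (hX.repLeft Θ) b := by
  rw [← Matrix.ext_iff, forall_comm]
  refine forall_congr' fun j => forall_congr' fun i => ?_
  simp only [CommAt, TensorProduct.comul_tmul, hX.comul, Matrix.mul_apply, leftTwist_apply,
    rightTwist_apply, Matrix.transpose_apply]
  generalize Coalgebra.comul (R := k) b = U
  have e1 : ∀ U : H ⊗[k] H, TensorProduct.lid k H (TensorProduct.map (TensorProduct.lift (pairing Θ))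
      (LinearMap.mul' k H) (TensorProduct.AlgebraTensorModule.tensorTensorTensorComm k k k k H H H H
        ((∑ l, X i l ⊗ₜ[k] X l j) ⊗ₜ[k] U))) =
      ∑ l, X l j * TensorProduct.lid k H ((entry (hX.repLeft Θ) l i).rTensor H U) := by
    intro U
    induction U with
    | zero => simp
    | tmul u v => simp [TensorProduct.sum_tmul]; rfl
    | add U U' h h' =>
      simp only [TensorProduct.tmul_add, map_add, h, h', mul_add, Finset.sum_add_distrib]
  have e2 : ∀ U : H ⊗[k] H, TensorProduct.rid k H (TensorProduct.map
      (LinearMap.mul' k H ∘ₗ (TensorProduct.comm k H H).toLinearMap)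
      (TensorProduct.lift (pairing Θ))
      (TensorProduct.AlgebraTensorModule.tensorTensorTensorComm k k k k H H H H
        ((∑ l, X i l ⊗ₜ[k] X l j) ⊗ₜ[k] U))) =
      ∑ l, TensorProduct.rid k H ((entry (hX.repLeft Θ) j l).lTensor H U) * X i l := by
    intro U
    induction U with
    | zero => simp
    | tmul u v => simp [TensorProduct.sum_tmul]; rfl
    | add U U' h h' =>
      simp only [TensorProduct.tmul_add, map_add, h, h', add_mul, Finset.sum_add_distrib]
  rw [e1, e2, eq_comm]

theorem CommAt.add_left {r : H →ₗ[k] H →ₗ[k] k} {a a' b : H} (h : CommAt r a b)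
    (h' : CommAt r a' b) : CommAt r (a + a') b := by
  simp only [CommAt, TensorProduct.add_tmul, map_add] at h h' ⊢
  rw [h, h']

theorem CommAt.smul_left {r : H →ₗ[k] H →ₗ[k] k} {a b : H} (c : k) (h : CommAt r a b) :
    CommAt r (c • a) b := by
  simp only [CommAt, ← TensorProduct.smul_tmul', map_smul] at h ⊢
  rw [h]

theorem CommAt.zero_left {r : H →ₗ[k] H →ₗ[k] k} {b : H} : CommAt r 0 b := by
  simp [CommAt]

end Corep

/-! ### Spanning by entries of matrix coalgebras -/

section Span

variable {k : Type u} [Field k] {H : Type w} [Ring H] [Bialgebra k H]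

/-- The span of the entries of the matrix coalgebras. -/
def corepSpan (k : Type u) [Field k] (H : Type w) [Ring H] [Bialgebra k H] : Submodule k H :=
  Submodule.span k {a | ∃ (n : ℕ) (X : Matrix (Fin n) (Fin n) H) (i j : Fin n),
    IsCorep k X ∧ X i j = a}

theorem IsCorep.mem_corepSpan {m : Type z} [Fintype m] [DecidableEq m] {X : Matrix m m H}
    (hX : IsCorep k X) (i j : m) : X i j ∈ corepSpan k H := by
  let e := Fintype.equivFin m
  refine Submodule.subset_span ⟨Fintype.card m, X.submatrix e.symm e.symm, e i, e j,
    ⟨fun i j => ?_, fun i j => ?_⟩, by simp⟩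
  · simp only [Matrix.submatrix_apply, hX.comul]
    exact (e.symm.sum_comp fun l => X (e.symm i) l ⊗ₜ[k] X l (e.symm j)).symm
  · simp [hX.counit]

theorem IsCorep.of_groupLike {g : H} (hg : IsGroupLikeElem k g) :
    IsCorep k (Matrix.of fun _ _ : Unit => g) where
  comul i j := by simp [hg.comul_eq_tmul_self]
  counit i j := by simp [hg.counit_eq_one]

theorem IsCorep.kronecker {m n : Type*} [Fintype m] [DecidableEq m] [Fintype n] [DecidableEq n]
    {X : Matrix m m H} {Y : Matrix n n H} (hX : IsCorep k X) (hY : IsCorep k Y) :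
    IsCorep k (Matrix.of fun a b : m × n => X a.1 b.1 * Y a.2 b.2) where
  comul i j := by
    simp only [Matrix.of_apply, Bialgebra.comul_mul, hX.comul, hY.comul, Finset.sum_mul_sum,
      Algebra.TensorProduct.tmul_mul_tmul, Fintype.sum_prod_type]
  counit i j := by
    simp only [Matrix.of_apply, Bialgebra.counit_mul, hX.counit, hY.counit, Prod.ext_iff, ite_and]
    split_ifs <;> simp

theorem mul_mem_corepSpan {a b : H} (ha : a ∈ corepSpan k H) (hb : b ∈ corepSpan k H) :
    a * b ∈ corepSpan k H := by
  refine Submodule.span_induction₂ (p := fun a b _ _ => a * b ∈ corepSpan k H)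
    ?_ ?_ ?_ ?_ ?_ ?_ ?_ ha hb
  · rintro _ _ ⟨n, X, i, j, hX, rfl⟩ ⟨n', Y, i', j', hY, rfl⟩
    exact (hX.kronecker hY).mem_corepSpan (i, i') (j, j')
  · intros; simp
  · intros; simp
  · intro a b c _ _ _ h1 h2
    rw [add_mul]; exact add_mem h1 h2
  · intro a b c _ _ _ h1 h2
    rw [mul_add]; exact add_mem h1 h2
  · intro r a b _ _ h
    rw [smul_mul_assoc]; exact Submodule.smul_mem _ _ h
  · intro r a b _ _ h
    rw [mul_smul_comm]; exact Submodule.smul_mem _ _ h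

end Span

section LocComm

variable {k : Type u} [Field k] {ι : Type w} [Fintype ι] [DecidableEq ι]
  {C : ι → ι → ι → ι → k} (D : GroupLike k (FRTAlg C))

/-- The matrix of generators of the localization of the FRT algebra. -/
def Loc.tMatrix : Matrix ι ι (Loc k D.val) := Matrix.of fun i j => Loc.of k D.val (FRTAlg.t C i j)

theorem Loc.isCorep_tMatrix : IsCorep k (Loc.tMatrix D) where
  comul := Loc.comul_of_t D
  counit := Loc.counit_of_t D

/-- The generators and D⁻¹ are entries of matrix coalgebras, and Kronecker products make the span
closed under multiplication. This allows the first variable of the commutation rule to be replaced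
by such an entry. -/
theorem Loc.mem_corepSpan (a : Loc k D.val) : a ∈ corepSpan k (Loc k D.val) := by
  induction a using Loc.frtInduction with
  | algebraMap r =>
    rw [Algebra.algebraMap_eq_smul_one]
    exact Submodule.smul_mem _ _ ((IsCorep.of_groupLike IsGroupLikeElem.one).mem_corepSpan () ())
  | add a b ha hb => exact add_mem ha hb
  | mul a b ha hb => exact mul_mem_corepSpan ha hb
  | t i j => exact (Loc.isCorep_tMatrix D).mem_corepSpan i j
  | invD _ => exact (IsCorep.of_groupLike (Loc.isGroupLikeElem_invD k D)).mem_corepSpan () ()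

variable {D} {Θ : Loc k D.val →ₐ[k] (WithConv (Loc k D.val →ₗ[k] k))ᵐᵒᵖ}

/-- Two rounds of intertwining: first the second argument is a generator and the first argument
varies, then the first argument is an entry of a matrix coalgebra and the second varies. -/
theorem Loc.commAt (h1 : ∀ d, PairingOneLeft Θ d) (hm : ∀ d, PairingMulLeft Θ d)
    (ht : ∀ i j q s, pairing Θ (Loc.of k D.val (FRTAlg.t C i q)) (Loc.of k D.val (FRTAlg.t C j s)) =
        C j i q s) (a b : Loc k D.val) : CommAt (pairing Θ) a b := by
  have hA : ∀ a i j, CommAt (pairing Θ) a (Loc.tMatrix D i j) := by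
    intro a
    rw [(Loc.isCorep_tMatrix D).commAt_right_iff h1 hm]
    refine Loc.intertwine _ _ _ (fun i j => ?_) a
    ext s l
    -- At two generators the commutation rule is an FRT relation pushed to the localization.
    have h2 := congrArg (Loc.of k D.val) (FRTAlg.t_rel C s i j l)
    simp only [map_sum, map_smul, map_mul] at h2
    have h3 : ∀ a i j, entry ((Loc.isCorep_tMatrix D).repRight Θ h1 hm) i j a =
      pairing Θ a (Loc.of k D.val (FRTAlg.t C i j)) := fun _ _ _ => rfl
    simp only [Matrix.mul_apply, leftTwist_apply, rightTwist_apply, Loc.comul_of_t, map_sum,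
      LinearMap.rTensor_tmul, LinearMap.lTensor_tmul, TensorProduct.lid_tmul,
      TensorProduct.rid_tmul, h3, ht, Finset.sum_mul, Finset.mul_sum, smul_mul_assoc,
      mul_smul_comm]
    rw [Finset.sum_comm]
    exact h2
  refine Submodule.span_induction (p := fun a _ => CommAt (pairing Θ) a b) ?_ .zero_left
    (fun _ _ _ _ h h' => h.add_left h') (fun c _ _ h => h.smul_left c) (Loc.mem_corepSpan D a)
  rintro _ ⟨n, X, i, j, hX, rfl⟩
  refine (hX.commAt_left_iff b).2 ?_ i j
  refine Loc.intertwine _ _ _ (fun s l => ?_) b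
  exact (hX.commAt_left_iff _).1 fun i j => hA _ s l

end LocComm

/-! ### The inverse matrices p and q satisfy the opposite FRT relations -/

section Contragredient

variable {k : Type u} [Field k] {ι : Type w} [Fintype ι] [DecidableEq ι]
  {C : ι → ι → ι → ι → k} {D : GroupLike k (FRTAlg C)}
  {Θ : Loc k D.val →ₐ[k] (WithConv (Loc k D.val →ₗ[k] k))ᵐᵒᵖ}

/-- A form on the localization of the FRT algebra that is multiplicative in both variables and
extends the canonical one. -/
structure IsCanonicalPairing (Θ : Loc k D.val →ₐ[k] (WithConv (Loc k D.val →ₗ[k] k))ᵐᵒᵖ) :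
    Prop where
  one_left : ∀ d, PairingOneLeft Θ d
  mul_left : ∀ d, PairingMulLeft Θ d
  pairing_t : ∀ i j q s, pairing Θ (Loc.of k D.val (FRTAlg.t C i q))
    (Loc.of k D.val (FRTAlg.t C j s)) = C j i q s

theorem IsCorep.comul_transpose {H : Type z} [Ring H] [Bialgebra k H] {p : Matrix ι ι H}
    (hp : IsCorep k p.transpose) (i j : ι) :
    Coalgebra.comul (R := k) (p i j) = ∑ l, p l j ⊗ₜ[k] p i l := hp.comul j i

theorem IsCorep.counit_transpose {H : Type z} [Ring H] [Bialgebra k H] {p : Matrix ι ι H}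
    (hp : IsCorep k p.transpose) (i j : ι) :
    Coalgebra.counit (R := k) (p i j) = if i = j then (1 : k) else 0 := by
  rw [← Matrix.transpose_apply p, hp.counit]
  simp [eq_comm]

theorem ite_and_eq_one_apply {k : Type u} [Field k] {ι : Type w} [DecidableEq ι] (i j l m : ι) :
    (if i = j then if l = m then (1 : k) else 0 else 0) =
      (1 : Matrix (ι × ι) (ι × ι) k) (i, l) (j, m) := by
  simp only [Matrix.one_apply, Prod.mk.injEq, ite_and]

variable {p : Matrix ι ι (Loc k D.val)}

theorem IsCanonicalPairing.pairing_delta_left (hΘ : IsCanonicalPairing Θ)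
    (hp : IsCorep k p.transpose) (i j l m : ι) :
    pairing Θ (if m = l then 1 else 0) (p i j) =
      (1 : Matrix (ι × ι) (ι × ι) k) (i, l) (j, m) := by
  have h := hΘ.one_left (p i j)
  rw [PairingOneLeft, hp.counit_transpose] at h
  rw [← ite_and_eq_one_apply]
  by_cases hml : m = l
  · simp [hml, h]
  · simp [hml, Ne.symm hml]

theorem pairing_delta_right (Θ : Loc k D.val →ₐ[k] (WithConv (Loc k D.val →ₗ[k] k))ᵐᵒᵖ)
    (i j l m : ι) : pairing Θ (Loc.of k D.val (FRTAlg.t C m l)) (if i = j then 1 else 0) =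
      (1 : Matrix (ι × ι) (ι × ι) k) (i, l) (j, m) := by
  rw [← ite_and_eq_one_apply]
  by_cases hij : i = j
  · simp [hij, pairing_one_right, Loc.counit_of_t, eq_comm]
  · simp [hij]

theorem one_prod_apply_comm {k : Type u} [Field k] {ι : Type w} [DecidableEq ι] (i j l m : ι) :
    (1 : Matrix (ι × ι) (ι × ι) k) (i, l) (j, m) =
    (1 : Matrix (ι × ι) (ι × ι) k) (l, j) (m, i) := by
  simp only [Matrix.one_apply, Prod.mk.injEq, and_comm, eq_comm]

/-- Pairing t p = 1 with p in the second variable shows that r(p,p) inverts r(t,p); pairing t with t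
p = 1 shows that r(t,t) inverts it too. This is the identity r(𝒮 a, 𝒮 b) = r(a, b), obtained before
𝒮 exists. -/
theorem IsCanonicalPairing.pairing_rightInverse (hΘ : IsCanonicalPairing Θ)
    (hp : IsCorep k p.transpose)
    (h0 : ∀ i j, ∑ l, Loc.of k D.val (FRTAlg.t C i l) * p l j = if i = j then 1 else 0)
    (i m l b : ι) : pairing Θ (p m l) (p i b) = C i m l b := by
  -- Rows and columns are paired so that the Sweedler sums become matrix products with `Y`.
  let X : Matrix (ι × ι) (ι × ι) k := Matrix.of fun a b => pairing Θ (p b.1 a.2) (p a.1 b.2)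
  let Y : Matrix (ι × ι) (ι × ι) k :=
    Matrix.of fun a b => pairing Θ (Loc.of k D.val (FRTAlg.t C b.2 a.1)) (p a.2 b.1)
  let Z : Matrix (ι × ι) (ι × ι) k := Matrix.of fun a b => C a.1 b.1 a.2 b.2
  have hXY : X * Y = 1 := by
    ext ⟨i, l⟩ ⟨j, m⟩
    have h1 := congrArg (fun a => pairing Θ a (p i j)) (h0 m l)
    simp only [map_sum, LinearMap.sum_apply, hΘ.mul_left (p i j) _ _, hp.comul_transpose,
      TensorProduct.map_tmul, LinearMap.mul'_apply, hΘ.pairing_delta_left hp] at h1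
    rw [Matrix.mul_apply, Fintype.sum_prod_type, ← h1]
    exact Finset.sum_congr rfl fun _ _ => Finset.sum_congr rfl fun _ _ => mul_comm _ _
  have hZY : Z * Y = 1 := by
    ext ⟨i, l⟩ ⟨j, m⟩
    have h1 := congrArg (pairing Θ (Loc.of k D.val (FRTAlg.t C m l))) (h0 i j)
    simp only [map_sum, pairing_mul_right, Loc.comul_of_t, TensorProduct.map_tmul,
      LinearMap.mul'_apply, LinearMap.flip_apply, hΘ.pairing_t, pairing_delta_right] at h1
    rw [Matrix.mul_apply, Fintype.sum_prod_type, ← h1, Finset.sum_comm]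
    exact Finset.sum_congr rfl fun _ _ => Finset.sum_congr rfl fun _ _ => mul_comm _ _
  have hXZ : X = Z := left_inv_eq_right_inv hXY (mul_eq_one_comm.1 hZY)
  exact congrFun (congrFun hXZ (i, l)) (m, b)

/-- The same uniqueness of inverses, with rows and columns regrouped because the factors of the
inverse relation come in the other order. -/
theorem IsCanonicalPairing.pairing_leftInverse (hΘ : IsCanonicalPairing Θ)
    (hp : IsCorep k p.transpose)
    (h0 : ∀ i j, ∑ l, p l j * Loc.of k D.val (FRTAlg.t C i l) = if i = j then 1 else 0)
    (i m l b : ι) : pairing Θ (p m l) (p i b) = C i m l b := by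
  let X : Matrix (ι × ι) (ι × ι) k := Matrix.of fun a b => pairing Θ (p b.1 a.1) (p b.2 a.2)
  let Y : Matrix (ι × ι) (ι × ι) k :=
    Matrix.of fun a b => pairing Θ (Loc.of k D.val (FRTAlg.t C b.1 a.1)) (p b.2 a.2)
  let Z : Matrix (ι × ι) (ι × ι) k := Matrix.of fun a b => C b.2 b.1 a.1 a.2
  have hXY : X * Y = 1 := by
    ext ⟨l, j⟩ ⟨m, i⟩
    have h1 := congrArg (fun a => pairing Θ a (p i j)) (h0 m l)
    simp only [map_sum, LinearMap.sum_apply, hΘ.mul_left (p i j) _ _, hp.comul_transpose,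
      TensorProduct.map_tmul, LinearMap.mul'_apply, hΘ.pairing_delta_left hp] at h1
    rw [Matrix.mul_apply, Fintype.sum_prod_type, ← one_prod_apply_comm, ← h1]
    exact Finset.sum_congr rfl fun _ _ => Finset.sum_congr rfl fun _ _ => rfl
  have hYZ : Y * Z = 1 := by
    ext ⟨l, j⟩ ⟨m, i⟩
    have h1 := congrArg (pairing Θ (Loc.of k D.val (FRTAlg.t C m l))) (h0 i j)
    simp only [map_sum, pairing_mul_right, Loc.comul_of_t, TensorProduct.map_tmul,
      LinearMap.mul'_apply, LinearMap.flip_apply, hΘ.pairing_t, pairing_delta_right] at h1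
    rw [Matrix.mul_apply, Fintype.sum_prod_type, ← one_prod_apply_comm, ← h1, Finset.sum_comm]
    exact Finset.sum_congr rfl fun _ _ => Finset.sum_congr rfl fun _ _ => mul_comm _ _
  have hXZ : X = Z := left_inv_eq_right_inv hXY hYZ
  exact congrFun (congrFun hXZ (l, b)) (m, i)

/-- Once r(p,p) is known to be `C`, the commutation rule at two entries of p is itself the FRT
relation in the opposite algebra. -/
theorem IsCanonicalPairing.isFRTFamily_op (hΘ : IsCanonicalPairing Θ)
    (hp : IsCorep k p.transpose) (hpp : ∀ i m l b, pairing Θ (p m l) (p i b) = C i m l b) :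
    IsFRTFamily C fun i j => MulOpposite.op (p i j) := by
  intro k' i j l
  have h1 : CommAt (pairing Θ) (p i j) (p k' l) :=
    Loc.commAt hΘ.one_left hΘ.mul_left hΘ.pairing_t _ _
  simp only [CommAt, TensorProduct.comul_tmul, hp.comul_transpose, TensorProduct.sum_tmul,
    TensorProduct.tmul_sum, map_sum, TensorProduct.AlgebraTensorModule.tensorTensorTensorComm_tmul,
    TensorProduct.map_tmul, TensorProduct.lift.tmul, hpp, TensorProduct.lid_tmul,
    TensorProduct.rid_tmul, LinearMap.comp_apply, LinearEquiv.coe_coe, TensorProduct.comm_tmul,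
    LinearMap.mul'_apply] at h1
  refine MulOpposite.unop_injective ?_
  simp only [Finset.unop_sum, MulOpposite.unop_smul, MulOpposite.unop_mul, MulOpposite.unop_op]
  exact Finset.sum_comm.trans h1.symm

end Contragredient

/-! ### The antipode and its left inverse -/

section Antipode

variable {k : Type u} [Field k] {ι : Type w} [Fintype ι] [DecidableEq ι]
  {C : ι → ι → ι → ι → k} {D : GroupLike k (FRTAlg C)}

/-- To extend to D⁻¹ the image of D must be D⁻¹. A one-sided inverse of D suffices, since D is
already invertible; which side is available depends on the side of the inverse matrix. -/
theorem Loc.exists_antiHom {f : ι → ι → Loc k D.val}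
    (hf : IsFRTFamily C fun i j => MulOpposite.op (f i j))
    (hD : of k D.val D.val * (hf.lift D.val).unop = 1 ∨ (hf.lift D.val).unop * of k D.val D.val = 1) :
    ∃ S : Loc k D.val →ₐ[k] (Loc k D.val)ᵐᵒᵖ,
      (∀ i j, S (Loc.of k D.val (FRTAlg.t C i j)) = MulOpposite.op (f i j)) ∧
      S (Loc.invD k D.val) = MulOpposite.op (Loc.of k D.val D.val) := by
  have h0 : hf.lift D.val = MulOpposite.op (Loc.invD k D.val) := by
    refine MulOpposite.unop_injective ?_
    rw [MulOpposite.unop_op]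
    rcases hD with hD | hD
    · exact (left_inv_eq_right_inv (Loc.invD_mul k D.val) hD).symm
    · exact left_inv_eq_right_inv hD (Loc.mul_invD k D.val)
  refine ⟨Loc.lift hf.lift (MulOpposite.op (Loc.of k D.val D.val)) ?_ ?_, fun i j => ?_, ?_⟩
  · rw [h0, ← MulOpposite.op_mul, Loc.invD_mul, MulOpposite.op_one]
  · rw [h0, ← MulOpposite.op_mul, Loc.mul_invD, MulOpposite.op_one]
  · rw [Loc.lift_of, IsFRTFamily.lift_t]
  · rw [Loc.lift_invD]

theorem Loc.exists_antiHom_of_rightInverse {f : ι → ι → Loc k D.val}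
    (hf : IsFRTFamily C fun i j => MulOpposite.op (f i j))
    (h : ∀ i j, ∑ l, Loc.of k D.val (FRTAlg.t C i l) * f l j = if i = j then 1 else 0) :
    ∃ S : Loc k D.val →ₐ[k] (Loc k D.val)ᵐᵒᵖ,
      (∀ i j, S (Loc.of k D.val (FRTAlg.t C i j)) = MulOpposite.op (f i j)) ∧
      S (Loc.invD k D.val) = MulOpposite.op (Loc.of k D.val D.val) := by
  refine Loc.exists_antiHom hf (Or.inl ?_)
  refine (FRTAlg.convInvAt (Loc.of k D.val) hf.lift (fun i j => ?_) D.val).groupLike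
    D.isGroupLikeElem_val
  simp only [IsFRTFamily.lift_t, MulOpposite.unop_op, h]

theorem Loc.exists_antiHom_of_leftInverse {f : ι → ι → Loc k D.val}
    (hf : IsFRTFamily C fun i j => MulOpposite.op (f i j))
    (h : ∀ i j, ∑ l, f l j * Loc.of k D.val (FRTAlg.t C i l) = if i = j then 1 else 0) :
    ∃ S : Loc k D.val →ₐ[k] (Loc k D.val)ᵐᵒᵖ,
      (∀ i j, S (Loc.of k D.val (FRTAlg.t C i j)) = MulOpposite.op (f i j)) ∧
      S (Loc.invD k D.val) = MulOpposite.op (Loc.of k D.val D.val) := by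
  refine Loc.exists_antiHom hf (Or.inr (MulOpposite.op_injective ?_))
  -- Over the opposite algebra the antihomomorphism becomes a homomorphism and the canonical map
  -- becomes the reversing one, hence the double opposite.
  refine (FRTAlg.convInvAt' ((AlgEquiv.opOp k _).toAlgHom.comp (Loc.of k D.val)) hf.lift
    (fun i j => MulOpposite.unop_injective ?_) D.val).groupLike D.isGroupLikeElem_val
  refine Eq.trans ?_ ((h i j).trans ?_)
  · simp [IsFRTFamily.lift_t, Finset.unop_sum]
  · split_ifs <;> rfl

/-- An antihomomorphism `H → H`, viewed as a linear map. -/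
def antiLinear {H : Type z} [Ring H] [Algebra k H] (S : H →ₐ[k] Hᵐᵒᵖ) : H →ₗ[k] H :=
  (MulOpposite.opLinearEquiv k).symm.toLinearMap ∘ₗ S.toLinearMap

theorem antiLinear_apply {H : Type z} [Ring H] [Algebra k H] (S : H →ₐ[k] Hᵐᵒᵖ) (a : H) :
    antiLinear S a = (S a).unop := rfl

@[simp] theorem antiLinear_one {H : Type z} [Ring H] [Algebra k H] (S : H →ₐ[k] Hᵐᵒᵖ) :
    antiLinear S 1 = 1 := by simp [antiLinear_apply]

theorem antiLinear_mul {H : Type z} [Ring H] [Algebra k H] (S : H →ₐ[k] Hᵐᵒᵖ) (a b : H) :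
    antiLinear S (a * b) = antiLinear S b * antiLinear S a := by simp [antiLinear_apply]

theorem antiLinear_delta {ι : Type w} [DecidableEq ι] {H : Type z} [Ring H] [Algebra k H]
    (S : H →ₐ[k] Hᵐᵒᵖ) (i j : ι) :
    antiLinear S (if i = j then 1 else 0) = if i = j then 1 else 0 := by
  split_ifs <;> simp

/-- A map on a bialgebra that is an antipode with a left inverse. -/
structure IsAntipode {H : Type z} [Ring H] [Bialgebra k H] (S S' : H →ₐ[k] Hᵐᵒᵖ) : Prop where
  right : ∀ a, ConvInvAt LinearMap.id (antiLinear S) a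
  left : ∀ a, ConvInvAt (antiLinear S) LinearMap.id a
  leftInverse : ∀ a, antiLinear S' (antiLinear S a) = a

/-- If the contragredient matrices `p` and `q` of the matrix of generators satisfy the FRT
relations, then there is a bijective antipode. -/
theorem Loc.exists_antipode {p q : Matrix ι ι (Loc k D.val)}
    (hp : IsFRTFamily C fun i j => MulOpposite.op (p i j))
    (hq : IsFRTFamily C fun i j => MulOpposite.op (q i j))
    (h : ∀ i j, ∑ l, Loc.of k D.val (FRTAlg.t C i l) * p l j = if i = j then 1 else 0)
    (h' : ∀ i j, ∑ l, q l j * Loc.of k D.val (FRTAlg.t C i l) = if i = j then 1 else 0) :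
    ∃ S S' : Loc k D.val →ₐ[k] (Loc k D.val)ᵐᵒᵖ, IsAntipode S S' ∧
      (∀ i j, antiLinear S (Loc.of k D.val (FRTAlg.t C i j)) = p i j) ∧
      antiLinear S (Loc.invD k D.val) = Loc.of k D.val D.val := by
  obtain ⟨S, hS, hSD⟩ := Loc.exists_antiHom_of_rightInverse hp h
  obtain ⟨S', hS', hSD'⟩ := Loc.exists_antiHom_of_leftInverse hq h'
  have hSt : ∀ i j, antiLinear S (Loc.of k D.val (FRTAlg.t C i j)) = p i j := fun i j => by
    rw [antiLinear_apply, hS, MulOpposite.unop_op]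
  have hSt' : ∀ i j, antiLinear S' (Loc.of k D.val (FRTAlg.t C i j)) = q i j := fun i j => by
    rw [antiLinear_apply, hS', MulOpposite.unop_op]
  have hSi : antiLinear S (Loc.invD k D.val) = Loc.of k D.val D.val := by
    rw [antiLinear_apply, hSD, MulOpposite.unop_op]
  have hSi' : antiLinear S' (Loc.invD k D.val) = Loc.of k D.val D.val := by
    rw [antiLinear_apply, hSD', MulOpposite.unop_op]
  have hinv : ∀ U : Loc k D.val →ₐ[k] (Loc k D.val)ᵐᵒᵖ,
      antiLinear U (Loc.invD k D.val) = Loc.of k D.val D.val →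
      antiLinear U (Loc.of k D.val D.val) = Loc.invD k D.val := fun U hU => by
    have h1 := antiLinear_mul U (Loc.invD k D.val) (Loc.of k D.val D.val)
    rw [hU, Loc.invD_mul, antiLinear_one] at h1
    exact left_inv_eq_right_inv h1.symm (Loc.mul_invD k D.val)
  have e1 : Loc.tMatrix D * p = 1 := by
    ext i j
    simp only [Matrix.mul_apply, Matrix.one_apply, Loc.tMatrix, Matrix.of_apply, h]
  -- Applying `S` to the relation between q and t gives p a right inverse; t is a left inverse of p,
  -- so the two agree and p is a two-sided inverse of t.
  have e2 : p * Matrix.of (fun i j => antiLinear S (q i j)) = 1 := by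
    ext i j
    have h1 := congrArg (antiLinear S) (h' i j)
    simpa only [map_sum, antiLinear_mul, hSt, antiLinear_delta, Matrix.mul_apply, Matrix.one_apply,
      Matrix.of_apply] using h1
  have e3 : p * Loc.tMatrix D = 1 := by
    rw [left_inv_eq_right_inv e1 e2, e2]
  -- Over the opposite algebra t is a left inverse of q, and `S'` applied to t p = 1 gives a right
  -- inverse of q, so `S'` takes p back to t.
  have e4 : ∀ i j, antiLinear S' (p i j) = Loc.of k D.val (FRTAlg.t C i j) := by
    let X : Matrix ι ι (Loc k D.val)ᵐᵒᵖ :=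
      Matrix.of fun i j => MulOpposite.op (Loc.of k D.val (FRTAlg.t C i j))
    let Y : Matrix ι ι (Loc k D.val)ᵐᵒᵖ := Matrix.of fun i j => MulOpposite.op (q i j)
    let Z : Matrix ι ι (Loc k D.val)ᵐᵒᵖ :=
      Matrix.of fun i j => MulOpposite.op (antiLinear S' (p i j))
    have hXY : X * Y = 1 := by
      ext i j
      refine MulOpposite.unop_injective ?_
      rw [Matrix.mul_apply, Finset.unop_sum, Matrix.one_apply]
      refine (h' i j).trans ?_
      split_ifs <;> rfl
    have hYZ : Y * Z = 1 := by
      ext i j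
      have h1 := congrArg (antiLinear S') (h i j)
      simp only [map_sum, antiLinear_mul, hSt', antiLinear_delta] at h1
      refine MulOpposite.unop_injective ?_
      rw [Matrix.mul_apply, Finset.unop_sum, Matrix.one_apply]
      refine h1.trans ?_
      split_ifs <;> rfl
    intro i j
    exact congrArg MulOpposite.unop (congrFun (congrFun (left_inv_eq_right_inv hXY hYZ).symm i) j)
  refine ⟨S, S', ⟨fun a => ?_, fun a => ?_, fun a => ?_⟩, hSt, hSi⟩
  · induction a using Loc.frtInduction with
    | algebraMap r => exact .algebraMap rfl (antiLinear_one S) r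
    | add a b ha hb => exact ha.add hb
    | mul a b ha hb => exact .mul (fun _ _ => rfl) (antiLinear_mul S) ha hb
    | t i j =>
      rw [ConvInvAt, Loc.comul_of_t, Loc.counit_of_t, apply_ite (algebraMap k _), map_one, map_zero]
      simp only [map_sum, TensorProduct.map_tmul, LinearMap.mul'_apply, hSt, LinearMap.id_apply, h]
    | invD _ =>
      rw [ConvInvAt, (Loc.isGroupLikeElem_invD k D).comul_eq_tmul_self,
        (Loc.isGroupLikeElem_invD k D).counit_eq_one, TensorProduct.map_tmul, LinearMap.mul'_apply,
        hSi, LinearMap.id_apply, Loc.invD_mul, map_one]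
  · induction a using Loc.frtInduction with
    | algebraMap r => exact .algebraMap (antiLinear_one S) rfl r
    | add a b ha hb => exact ha.add hb
    | mul a b ha hb => exact .mul' (antiLinear_mul S) (fun _ _ => rfl) ha hb
    | t i j =>
      rw [ConvInvAt, Loc.comul_of_t, Loc.counit_of_t, apply_ite (algebraMap k _), map_one, map_zero]
      simp only [map_sum, TensorProduct.map_tmul, LinearMap.mul'_apply, hSt, LinearMap.id_apply]
      exact (congrFun (congrFun e3 i) j).trans (Matrix.one_apply ..)
    | invD _ =>
      rw [ConvInvAt, (Loc.isGroupLikeElem_invD k D).comul_eq_tmul_self,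
        (Loc.isGroupLikeElem_invD k D).counit_eq_one, TensorProduct.map_tmul, LinearMap.mul'_apply,
        hSi, LinearMap.id_apply, Loc.mul_invD, map_one]
  · induction a using Loc.frtInduction with
    | algebraMap r => simp [antiLinear_apply]
    | add a b ha hb => rw [map_add, map_add, ha, hb]
    | mul a b ha hb => rw [antiLinear_mul, antiLinear_mul, ha, hb]
    | t i j => rw [hSt, e4]
    | invD _ => rw [hSi, hinv S' hSi']

end Antipode

/-! ### Convolution invertibility of the form -/

section Coquasi

variable {k : Type u} [Field k] {ι : Type w} [Fintype ι] [DecidableEq ι]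
  {C : ι → ι → ι → ι → k} {D : GroupLike k (FRTAlg C)}
  {Θ : Loc k D.val →ₐ[k] (WithConv (Loc k D.val →ₗ[k] k))ᵐᵒᵖ}

/-- Multiplicativity in the first variable contracts the convolution product to r(F a₍₁₎ G a₍₂₎, d)
= ε(a) r(1, d). With the identity and the antipode in the two orders, it gives both halves of
invertibility. -/
theorem IsCanonicalPairing.conv_comp (hΘ : IsCanonicalPairing Θ)
    {F G : Loc k D.val →ₗ[k] Loc k D.val} (h : ∀ a, ConvInvAt F G a) :
    conv (pairing Θ ∘ₗ F) (pairing Θ ∘ₗ G) = convOne k (Loc k D.val) := by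
  refine LinearMap.ext fun a => LinearMap.ext fun d => ?_
  have h1 := congrArg (fun u => pairing Θ u d) (h a)
  simp only [Algebra.algebraMap_eq_smul_one, map_smul, LinearMap.smul_apply] at h1
  rw [hΘ.one_left d, smul_eq_mul] at h1
  simp only [conv, convOne, TensorProduct.curry_apply, LinearMap.comp_apply,
    LinearMap.mk₂_apply, TensorProduct.comul_tmul]
  rw [← h1]
  generalize Coalgebra.comul (R := k) a = X
  induction X with
  | zero => simp
  | add X Y hX hY =>
    simp only [TensorProduct.add_tmul, map_add, hX, hY, LinearMap.add_apply]
  | tmul u v =>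
    simp only [TensorProduct.map_tmul, LinearMap.mul'_apply]
    rw [hΘ.mul_left d (F u) (G v)]
    generalize Coalgebra.comul (R := k) d = Y
    induction Y with
    | zero => simp
    | add X Y hX hY => simp only [TensorProduct.tmul_add, map_add, hX, hY]
    | tmul s t =>
      simp only [TensorProduct.AlgebraTensorModule.tensorTensorTensorComm_tmul,
        TensorProduct.map_tmul, TensorProduct.lift.tmul, LinearMap.comp_apply, LinearMap.mul'_apply]

theorem IsCanonicalPairing.exists_conv_inverse (hΘ : IsCanonicalPairing Θ)
    {S S' : Loc k D.val →ₐ[k] (Loc k D.val)ᵐᵒᵖ} (hS : IsAntipode S S') :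
    ∃ r' : Loc k D.val →ₗ[k] Loc k D.val →ₗ[k] k,
      conv (pairing Θ) r' = convOne k (Loc k D.val) ∧
      conv r' (pairing Θ) = convOne k (Loc k D.val) := by
  have h1 := hΘ.conv_comp hS.right
  have h2 := hΘ.conv_comp hS.left
  rw [LinearMap.comp_id] at h1 h2
  exact ⟨pairing Θ ∘ₗ antiLinear S, h1, h2⟩

theorem IsCanonicalPairing.isCoquasitriangular (hΘ : IsCanonicalPairing Θ)
    {S S' : Loc k D.val →ₐ[k] (Loc k D.val)ᵐᵒᵖ} (hS : IsAntipode S S') :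
    IsCoquasitriangular (pairing Θ) :=
  have h : ∀ a b, CommAt (pairing Θ) a b := Loc.commAt hΘ.one_left hΘ.mul_left hΘ.pairing_t
  { invertible := hΘ.exists_conv_inverse hS
    mul_left := fun a b d => hΘ.mul_left d a b
    mul_right := fun a b d => pairing_mul_right Θ a b d
    comm := h }

end Coquasi

/-! ### Comodules and their coefficient matrices -/

section MatrixCoefficients

variable {k : Type u} [Field k] {H : Type w} [Ring H] [Bialgebra k H]
  {M : Type v} [AddCommGroup M] [Module k M]
  {m : Type z} [Fintype m]

/-- The map `a ⊗ x ↦ φ x • a`. -/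
def coefficient (H : Type w) [Ring H] [Algebra k H] (φ : Module.Dual k M) : H ⊗[k] M →ₗ[k] H :=
  (TensorProduct.rid k H).toLinearMap ∘ₗ φ.lTensor H

@[simp] theorem coefficient_tmul {H : Type w} [Ring H] [Algebra k H] (φ : Module.Dual k M) (a : H)
    (x : M) : coefficient H φ (a ⊗ₜ[k] x) = φ x • a := by
  simp [coefficient]

theorem sum_coefficient_tmul {H : Type w} [Ring H] [Algebra k H] (e : Module.Basis m k M)
    (X : H ⊗[k] M) : ∑ j, coefficient H (e.coord j) X ⊗ₜ[k] e j = X := by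
  induction X with
  | zero => simp
  | add X Y hX hY => simp only [map_add, TensorProduct.add_tmul, Finset.sum_add_distrib, hX, hY]
  | tmul a x =>
    simp only [coefficient_tmul, TensorProduct.smul_tmul, ← TensorProduct.tmul_sum,
      Module.Basis.coord_apply, e.sum_repr]

theorem coefficient_sum_tmul [DecidableEq m] {H : Type w} [Ring H] [Algebra k H] (e : Module.Basis m k M)
    (u : m → H) (i : m) : coefficient H (e.coord i) (∑ j, u j ⊗ₜ[k] e j) = u i := by
  simp [Finsupp.single_apply]

/-- The matrix of a coaction with respect to a basis. -/
def Coaction.matrix (ρ : Coaction k H M) (e : Module.Basis m k M) : Matrix m m H :=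
  Matrix.of fun i j => coefficient H (e.coord j) (ρ.coact (e i))

theorem Coaction.coact_basis (ρ : Coaction k H M) (e : Module.Basis m k M) (i : m) :
    ρ.coact (e i) = ∑ j, ρ.matrix e i j ⊗ₜ[k] e j :=
  (sum_coefficient_tmul e _).symm

theorem Coaction.isCorep_matrix [DecidableEq m] (ρ : Coaction k H M) (e : Module.Basis m k M) :
    IsCorep k (ρ.matrix e) where
  comul i j := by
    have h := LinearMap.congr_fun ρ.coassoc (e i)
    simp only [LinearMap.comp_apply, ρ.coact_basis, map_sum, LinearMap.rTensor_tmul,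
      LinearMap.lTensor_tmul, LinearEquiv.coe_coe, TensorProduct.tmul_sum] at h
    rw [Finset.sum_comm] at h
    have h2 := congrArg (TensorProduct.assoc k H H M).symm h
    simp only [map_sum, LinearEquiv.symm_apply_apply, TensorProduct.assoc_symm_tmul,
      ← TensorProduct.sum_tmul] at h2
    have h3 := congrArg (coefficient (H ⊗[k] H) (e.coord j)) h2
    rwa [coefficient_sum_tmul e, coefficient_sum_tmul e] at h3
  counit i j := by
    have h := LinearMap.congr_fun ρ.counit (e i)
    simp only [LinearMap.comp_apply, ρ.coact_basis, map_sum, LinearMap.rTensor_tmul,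
      TensorProduct.mk_apply] at h
    have h3 := congrArg (coefficient k (e.coord j)) h
    rw [coefficient_sum_tmul e] at h3
    rw [h3]
    simp [Finsupp.single_apply]

/-- The comodule with a given matrix of coefficients. -/
def IsCorep.coaction [DecidableEq m] {X : Matrix m m H} (hX : IsCorep k X) (e : Module.Basis m k M) :
    Coaction k H M where
  coact := e.constr k fun i => ∑ j, X i j ⊗ₜ[k] e j
  coassoc := e.ext fun i => by
    simp only [LinearMap.comp_apply, Module.Basis.constr_basis, map_sum, LinearMap.rTensor_tmul,
      LinearMap.lTensor_tmul, hX.comul, TensorProduct.sum_tmul, TensorProduct.tmul_sum,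
      LinearEquiv.coe_coe, TensorProduct.assoc_tmul]
    exact Finset.sum_comm
  counit := e.ext fun i => by
    simp [hX.counit, TensorProduct.ite_tmul]

theorem IsCorep.coaction_basis [DecidableEq m] {X : Matrix m m H} (hX : IsCorep k X) (e : Module.Basis m k M)
    (i : m) : (hX.coaction e).coact (e i) = ∑ j, X i j ⊗ₜ[k] e j := by
  simp only [coaction, Module.Basis.constr_basis]

end MatrixCoefficients

/-! ### Contragredient matrix coalgebras and rigidity -/

section ContragredientCorep

/-- Inverting a product reverses it. For the coproduct and the two inclusions into H ⊗ H, it says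
that the inverse of a matrix coalgebra has the flipped coproduct, so its transpose is again a matrix
coalgebra. -/
theorem map_eq_mul_of_inverse {m R R' : Type*} [Fintype m] [DecidableEq m] [Ring R] [Ring R']
    (f f₁ f₂ : R →+* R') {a s : Matrix m m R} (h : a * s = 1) (h' : s * a = 1)
    (hf : a.map f = a.map f₁ * a.map f₂) : s.map f = s.map f₂ * s.map f₁ := by
  have h1 : ∀ g : R →+* R', a.map g * s.map g = 1 := fun g => by
    rw [← Matrix.map_mul, h, Matrix.map_one g g.map_zero g.map_one]
  have h2 : s.map f * a.map f = 1 := by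
    rw [← Matrix.map_mul, h', Matrix.map_one f f.map_zero f.map_one]
  refine left_inv_eq_right_inv h2 ?_
  rw [hf, mul_assoc, ← mul_assoc (a.map f₂), h1, one_mul, h1]

variable {k : Type u} [Field k] {H : Type w} [Ring H] [Bialgebra k H]
  {m : Type z} [Fintype m] [DecidableEq m] {a b : Matrix m m H}

theorem IsCorep.of_rightDual (ha : IsCorep k a)
    (h : ∀ i j, ∑ l, a i l * b j l = if i = j then 1 else 0)
    (h' : ∀ i j, ∑ l, b l i * a l j = if i = j then 1 else 0) : IsCorep k b where
  comul i j := by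
    have h1 := map_eq_mul_of_inverse (a := a) (s := b.transpose)
      (Bialgebra.comulAlgHom k H).toRingHom
      (Algebra.TensorProduct.includeLeft : H →ₐ[k] H ⊗[k] H).toRingHom
      (Algebra.TensorProduct.includeRight : H →ₐ[k] H ⊗[k] H).toRingHom
      (by ext i j; simpa [Matrix.mul_apply, Matrix.one_apply] using h i j)
      (by ext i j; simpa [Matrix.mul_apply, Matrix.one_apply] using h' i j)
      (by ext i j; simp [Matrix.mul_apply, ha.comul])
    simpa [Matrix.mul_apply] using congrFun (congrFun h1 j) i
  counit i j := by
    have h1 := congrArg (Bialgebra.counitAlgHom k H) (h j i)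
    simpa [ha.counit, apply_ite, eq_comm] using h1

/-- Here the transpose of `b` inverts `a` over the opposite algebra, so the inversion argument is
run there. -/
theorem IsCorep.of_leftDual (ha : IsCorep k a)
    (h : ∀ i j, ∑ l, b i l * a j l = if i = j then 1 else 0)
    (h' : ∀ i j, ∑ l, a l i * b l j = if i = j then 1 else 0) : IsCorep k b where
  comul i j := by
    have h1 := map_eq_mul_of_inverse (a := a.map MulOpposite.op)
      (s := b.transpose.map MulOpposite.op)
      (Bialgebra.comulAlgHom k H).toRingHom.op
      (Algebra.TensorProduct.includeLeft : H →ₐ[k] H ⊗[k] H).toRingHom.op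
      (Algebra.TensorProduct.includeRight : H →ₐ[k] H ⊗[k] H).toRingHom.op
      (by
        ext i j
        refine MulOpposite.unop_injective ?_
        rw [Matrix.mul_apply, Finset.unop_sum, Matrix.one_apply]
        refine (h j i).trans ?_
        rw [apply_ite MulOpposite.unop, MulOpposite.unop_one, MulOpposite.unop_zero]
        simp only [eq_comm])
      (by
        ext i j
        refine MulOpposite.unop_injective ?_
        rw [Matrix.mul_apply, Finset.unop_sum, Matrix.one_apply]
        refine (h' j i).trans ?_
        rw [apply_ite MulOpposite.unop, MulOpposite.unop_one, MulOpposite.unop_zero]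
        simp only [eq_comm])
      (by
        ext i j
        refine MulOpposite.unop_injective ?_
        rw [Matrix.mul_apply, Finset.unop_sum]
        simp [ha.comul])
    have h2 := congrArg MulOpposite.unop (congrFun (congrFun h1 j) i)
    rw [Matrix.mul_apply, Finset.unop_sum] at h2
    simpa using h2
  counit i j := by
    have h1 := congrArg (Bialgebra.counitAlgHom k H) (h i j)
    simpa [ha.counit, apply_ite] using h1

end ContragredientCorep

section Rigid

variable {k : Type u} [Field k] {H : Type w} [Ring H] [Bialgebra k H]
  {m : Type z} [Fintype m] [DecidableEq m] {a b : Matrix m m H}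

/-- The two matrix identities are colinearity of the evaluation and of the coevaluation for the
bases `e` and `f`; the snake identities are those of vector spaces. -/
theorem isDualPair_of_matrix {M N : FinComod k H} (e : Module.Basis m k M.carrier)
    (f : Module.Basis m k N.carrier)
    (he : ∀ i, M.coaction.coact (e i) = ∑ j, a i j ⊗ₜ[k] e j)
    (hf : ∀ i, N.coaction.coact (f i) = ∑ j, b i j ⊗ₜ[k] f j)
    (h : ∀ i j, ∑ l, a i l * b j l = if i = j then 1 else 0)
    (h' : ∀ i j, ∑ l, b l i * a l j = if i = j then 1 else 0) : IsDualPair M N := by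
  let ev : M.carrier ⊗[k] N.carrier →ₗ[k] k :=
    (e.tensorProduct f).constr k fun ij => if ij.1 = ij.2 then 1 else 0
  have hev : ∀ i j, ev (e i ⊗ₜ[k] f j) = if i = j then 1 else 0 := fun i j => by
    rw [← Module.Basis.tensorProduct_apply, Module.Basis.constr_basis]
  let coev : k →ₗ[k] N.carrier ⊗[k] M.carrier :=
    LinearMap.toSpanSingleton k _ (∑ i, f i ⊗ₜ[k] e i)
  have hcoev : coev 1 = ∑ i, f i ⊗ₜ[k] e i := by simp [coev]
  have hunit : (Coaction.unit k H).coact 1 = 1 ⊗ₜ[k] 1 := rfl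
  refine ⟨ev, coev, (e.tensorProduct f).ext fun ij => ?_, LinearMap.ext_ring ?_, fun y => ?_,
    fun x => ?_⟩
  · obtain ⟨i, j⟩ := ij
    have h1 : (Coaction.unit k H).coact (if i = j then 1 else 0) =
        (if i = j then 1 else 0 : H) ⊗ₜ[k] 1 := by
      split_ifs
      · exact hunit
      · simp
    rw [Module.Basis.tensorProduct_apply, LinearMap.comp_apply, LinearMap.comp_apply, hev, h1, ← h]
    simp only [Coaction.tensor, LinearMap.comp_apply, TensorProduct.map_tmul, he, hf,
      TensorProduct.sum_tmul, TensorProduct.tmul_sum, map_sum, Coaction.mulMap_tmul,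
      LinearMap.lTensor_tmul, hev, TensorProduct.tmul_ite]
    simp
  · rw [LinearMap.comp_apply, LinearMap.comp_apply, hunit, LinearMap.lTensor_tmul, hcoev]
    simp only [Coaction.tensor, LinearMap.comp_apply, TensorProduct.map_tmul, he, hf,
      TensorProduct.sum_tmul, TensorProduct.tmul_sum, map_sum, Coaction.mulMap_tmul]
    rw [Finset.sum_comm]
    refine Finset.sum_congr rfl fun j _ => ?_
    rw [Finset.sum_comm]
    simp only [← TensorProduct.sum_tmul, h', TensorProduct.ite_tmul]
    simp
  · rw [hcoev]
    refine LinearMap.congr_fun (f := (TensorProduct.rid k N.carrier).toLinearMap ∘ₗ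
      ev.lTensor N.carrier ∘ₗ (TensorProduct.assoc k _ _ _).toLinearMap ∘ₗ
      TensorProduct.mk k _ _ (∑ i, f i ⊗ₜ[k] e i)) (g := LinearMap.id) (f.ext fun j => ?_) y
    simp [hev]
  · rw [hcoev]
    refine LinearMap.congr_fun (f := (TensorProduct.lid k M.carrier).toLinearMap ∘ₗ
      ev.rTensor M.carrier ∘ₗ (TensorProduct.assoc k _ _ _).symm.toLinearMap ∘ₗ
      (TensorProduct.mk k _ _).flip (∑ i, f i ⊗ₜ[k] e i)) (g := LinearMap.id) (e.ext fun j => ?_) x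
    simp [hev]

variable {S S' : H →ₐ[k] Hᵐᵒᵖ}

theorem IsAntipode.sum_right (hS : IsAntipode S S') (ha : IsCorep k a) (i j : m) :
    ∑ l, a i l * antiLinear S (a l j) = if i = j then 1 else 0 := by
  have h := hS.right (a i j)
  rw [ConvInvAt, ha.comul, ha.counit, apply_ite (algebraMap k H), map_one, map_zero] at h
  simpa only [map_sum, TensorProduct.map_tmul, LinearMap.mul'_apply, LinearMap.id_apply] using h

theorem IsAntipode.sum_left (hS : IsAntipode S S') (ha : IsCorep k a) (i j : m) :
    ∑ l, antiLinear S (a i l) * a l j = if i = j then 1 else 0 := by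
  have h := hS.left (a i j)
  rw [ConvInvAt, ha.comul, ha.counit, apply_ite (algebraMap k H), map_one, map_zero] at h
  simpa only [map_sum, TensorProduct.map_tmul, LinearMap.mul'_apply, LinearMap.id_apply] using h

/-- `S'` reverses the antipode identity of `S`, and S'S = id is all that is needed. -/
theorem IsAntipode.sum_right' (hS : IsAntipode S S') (ha : IsCorep k a) (i j : m) :
    ∑ l, a l j * antiLinear S' (a i l) = if i = j then 1 else 0 := by
  have h := congrArg (antiLinear S') (hS.sum_right ha i j)
  simpa only [map_sum, antiLinear_mul, hS.leftInverse, antiLinear_delta] using h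

theorem IsAntipode.sum_left' (hS : IsAntipode S S') (ha : IsCorep k a) (i j : m) :
    ∑ l, antiLinear S' (a l j) * a i l = if i = j then 1 else 0 := by
  have h := congrArg (antiLinear S') (hS.sum_left ha i j)
  simpa only [map_sum, antiLinear_mul, hS.leftInverse, antiLinear_delta] using h

/-- The right dual of M has coefficient matrix the transpose of `S` of that of M, the left dual the
transpose of `S'` of it. Both live on the coordinate space of M. -/
theorem IsAntipode.isRigidComod (hS : IsAntipode S S') : IsRigidComod k H := by
  intro M
  let e := Module.finBasis k M.carrier
  let f := Pi.basisFun k (Fin (Module.finrank k M.carrier))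
  have ha := M.coaction.isCorep_matrix e
  have hr : IsCorep k (Matrix.of fun i j => antiLinear S (M.coaction.matrix e j i)) :=
    ha.of_rightDual (fun i j => hS.sum_right ha i j) (fun i j => hS.sum_left ha i j)
  have hl : IsCorep k (Matrix.of fun i j => antiLinear S' (M.coaction.matrix e j i)) :=
    ha.of_leftDual (fun i j => (hS.sum_left' ha j i).trans (by simp only [eq_comm]))
      (fun i j => (hS.sum_right' ha j i).trans (by simp only [eq_comm]))
  exact ⟨⟨⟨_, hl.coaction f⟩, isDualPair_of_matrix f e (hl.coaction_basis f)
      (M.coaction.coact_basis e) (fun i j => (hS.sum_left' ha j i).trans (by simp only [eq_comm]))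
      (fun i j => (hS.sum_right' ha j i).trans (by simp only [eq_comm]))⟩,
    ⟨_, hr.coaction f⟩, isDualPair_of_matrix e f (M.coaction.coact_basis e)
      (hr.coaction_basis f) (fun i j => hS.sum_right ha i j) (fun i j => hS.sum_left ha i j)⟩

end Rigid

/-! ### Subcomodules, kernels and cofree comodules -/

section Subcomodule

variable {k : Type u} [Field k] {H : Type w} [Ring H] [Bialgebra k H]
  {M : Type v} [AddCommGroup M] [Module k M] {N : Type z} [AddCommGroup N] [Module k N]

/-- The comultiplication of the cofree comodule `H ⊗ M`. -/
def cofreeComul (k : Type u) [Field k] (H : Type w) [Ring H] [Bialgebra k H]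
    (M : Type v) [AddCommGroup M] [Module k M] : H ⊗[k] M →ₗ[k] H ⊗[k] (H ⊗[k] M) :=
  (TensorProduct.assoc k H H M).toLinearMap ∘ₗ (Coalgebra.comul (R := k) (A := H)).rTensor M

theorem cofreeComul_lTensor (i : M →ₗ[k] N) :
    cofreeComul k H N ∘ₗ i.lTensor H = (i.lTensor H).lTensor H ∘ₗ cofreeComul k H M := by
  refine TensorProduct.ext' fun a x => ?_
  simp only [cofreeComul, LinearMap.comp_apply, LinearMap.lTensor_tmul, LinearMap.rTensor_tmul,
    LinearEquiv.coe_coe]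
  generalize Coalgebra.comul (R := k) a = Y
  induction Y with
  | zero => simp
  | tmul a b => simp
  | add X Y hX hY => simp only [map_add, TensorProduct.add_tmul, hX, hY]

theorem Coaction.cofreeComul_coact (ρ : Coaction k H M) :
    cofreeComul k H M ∘ₗ ρ.coact = ρ.coact.lTensor H ∘ₗ ρ.coact := by
  rw [← ρ.coassoc, cofreeComul, LinearMap.comp_assoc]

/-- A subspace that is stable under the coaction is a comodule. -/
theorem Coaction.exists_restrict (ρ : Coaction k H M) (P : Submodule k M)
    (hP : ∀ x ∈ P, ρ.coact x ∈ LinearMap.range (P.subtype.lTensor H)) :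
    ∃ τ : Coaction k H P, IsColinear τ ρ P.subtype := by
  have hinj : Function.Injective (P.subtype.lTensor H) :=
    Module.Flat.lTensor_preserves_injective_linearMap _ P.subtype_injective
  have hinj2 : Function.Injective ((P.subtype.lTensor H).lTensor H) :=
    Module.Flat.lTensor_preserves_injective_linearMap _ hinj
  let t : P →ₗ[k] H ⊗[k] P := (LinearEquiv.ofInjective _ hinj).symm.toLinearMap ∘ₗ
    (ρ.coact ∘ₗ P.subtype).codRestrict _ fun x => hP x x.2
  have ht : P.subtype.lTensor H ∘ₗ t = ρ.coact ∘ₗ P.subtype := by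
    ext x
    exact congrArg Subtype.val ((LinearEquiv.ofInjective _ hinj).apply_symm_apply
      ((ρ.coact ∘ₗ P.subtype).codRestrict _ (fun x => hP x x.2) x))
  refine ⟨⟨t, ?_, ?_⟩, ht.symm⟩
  · rw [← LinearMap.comp_assoc, ← cofreeComul]
    -- Tensoring over a field preserves injectivity, so coassociativity may be checked after
    -- inclusion into the ambient comodule.
    refine (LinearMap.cancel_left hinj2).1 ?_
    rw [← LinearMap.comp_assoc, ← cofreeComul_lTensor, LinearMap.comp_assoc, ht,
      ← LinearMap.comp_assoc, ρ.cofreeComul_coact, ← LinearMap.comp_assoc (f := t),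
      ← LinearMap.lTensor_comp, ht, LinearMap.lTensor_comp, LinearMap.comp_assoc,
      LinearMap.comp_assoc, ht]
  · refine (LinearMap.cancel_left (f := P.subtype.lTensor k)
      (Module.Flat.lTensor_preserves_injective_linearMap _ P.subtype_injective)).1 ?_
    rw [← LinearMap.comp_assoc, LinearMap.lTensor_comp_rTensor, ← LinearMap.rTensor_comp_lTensor,
      LinearMap.comp_assoc, ht, ← LinearMap.comp_assoc, ρ.counit]
    ext x
    simp

/-- By exactness of H ⊗ −, the kernel of H ⊗ F is H ⊗ ker F, and the coaction sends ker F into it.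
The map `G` need not be a coaction. -/
theorem Coaction.exists_ker (ρ : Coaction k H M) (F : M →ₗ[k] N) (G : N →ₗ[k] H ⊗[k] N)
    (h : G ∘ₗ F = F.lTensor H ∘ₗ ρ.coact) :
    ∃ τ : Coaction k H (LinearMap.ker F), IsColinear τ ρ (LinearMap.ker F).subtype := by
  refine ρ.exists_restrict _ fun x hx => ?_
  have h1 : F.lTensor H (ρ.coact x) = 0 := by
    have h2 := LinearMap.congr_fun h x
    rw [LinearMap.comp_apply, LinearMap.mem_ker.1 hx, map_zero] at h2
    exact h2.symm
  exact (Module.Flat.lTensor_exact H (LinearMap.exact_subtype_ker_map F) _).1 h1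

theorem Coaction.coact_injective (ρ : Coaction k H M) : Function.Injective ρ.coact := by
  have h : Function.Injective (TensorProduct.mk k k M 1) := by
    intro x y hxy
    simpa using congrArg (TensorProduct.lid k M) hxy
  rw [← ρ.counit, LinearMap.coe_comp] at h
  exact h.of_comp

theorem Coaction.isColinear_fst (ρ : Coaction k H M) (σ : Coaction k H N) :
    IsColinear (ρ.prod σ) ρ (LinearMap.fst k M N) := by
  refine LinearMap.prod_ext ?_ ?_
  · rw [LinearMap.comp_assoc, LinearMap.comp_assoc, LinearMap.fst_comp_inl, prod,
      LinearMap.coprod_inl, ← LinearMap.comp_assoc, ← LinearMap.lTensor_comp,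
      LinearMap.fst_comp_inl, LinearMap.lTensor_id, LinearMap.comp_id, LinearMap.id_comp]
  · rw [LinearMap.comp_assoc, LinearMap.comp_assoc, LinearMap.fst_comp_inr, prod,
      LinearMap.coprod_inr, ← LinearMap.comp_assoc, ← LinearMap.lTensor_comp,
      LinearMap.fst_comp_inr, LinearMap.lTensor_zero, LinearMap.comp_zero, LinearMap.zero_comp]

theorem Coaction.isColinear_snd (ρ : Coaction k H M) (σ : Coaction k H N) :
    IsColinear (ρ.prod σ) σ (LinearMap.snd k M N) := by
  refine LinearMap.prod_ext ?_ ?_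
  · rw [LinearMap.comp_assoc, LinearMap.comp_assoc, LinearMap.snd_comp_inl, prod,
      LinearMap.coprod_inl, ← LinearMap.comp_assoc, ← LinearMap.lTensor_comp,
      LinearMap.snd_comp_inl, LinearMap.lTensor_zero, LinearMap.comp_zero, LinearMap.zero_comp]
  · rw [LinearMap.comp_assoc, LinearMap.comp_assoc, LinearMap.snd_comp_inr, prod,
      LinearMap.coprod_inr, ← LinearMap.comp_assoc, ← LinearMap.lTensor_comp,
      LinearMap.snd_comp_inr, LinearMap.lTensor_id, LinearMap.comp_id, LinearMap.id_comp]

theorem IsColinear.comp {L : Type*} [AddCommGroup L] [Module k L] {τ : Coaction k H L}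
    {ρ : Coaction k H M} {σ : Coaction k H N} {g : M →ₗ[k] N} {f : L →ₗ[k] M}
    (hg : IsColinear ρ σ g) (hf : IsColinear τ ρ f) : IsColinear τ σ (g ∘ₗ f) := by
  rw [IsColinear] at *
  rw [← LinearMap.comp_assoc, hg, LinearMap.comp_assoc, hf, LinearMap.lTensor_comp,
    LinearMap.comp_assoc]

end Subcomodule

/-! ### Tensor generation -/

section TensorGeneration

variable {k : Type u} [Field k] {H : Type w} [Ring H] [Bialgebra k H]

/-- The span of the matrix coefficients of the tensor products of members of `S`. -/
def wordSpan (S : Set (FinComod k H)) : Submodule k H :=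
  Submodule.span k {a | ∃ (X : FinComod k H) (φ : Module.Dual k X.carrier) (y : X.carrier),
    IsTensorWord S X ∧ coefficient H φ (X.coaction.coact y) = a}

variable {S : Set (FinComod k H)}

theorem coefficient_mem_wordSpan {X : FinComod k H} (hX : IsTensorWord S X)
    (φ : Module.Dual k X.carrier) (y : X.carrier) :
    coefficient H φ (X.coaction.coact y) ∈ wordSpan S :=
  Submodule.subset_span ⟨X, φ, y, hX, rfl⟩

theorem one_mem_wordSpan : (1 : H) ∈ wordSpan S := by
  have h := coefficient_mem_wordSpan (S := S) .unit LinearMap.id (1 : k)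
  have h1 : (Coaction.unit k H).coact 1 = 1 ⊗ₜ[k] 1 := rfl
  rw [h1] at h
  simpa using h

theorem mul_mem_wordSpan {a b : H} (ha : a ∈ wordSpan S) (hb : b ∈ wordSpan S) :
    a * b ∈ wordSpan S := by
  refine Submodule.span_induction₂ (p := fun a b _ _ => a * b ∈ wordSpan S)
    ?_ ?_ ?_ ?_ ?_ ?_ ?_ ha hb
  · rintro _ _ ⟨X, φ, x, hX, rfl⟩ ⟨Y, ψ, y, hY, rfl⟩
    have h := coefficient_mem_wordSpan (.tensor X Y hX hY)
      (LinearMap.mul' k k ∘ₗ TensorProduct.map φ ψ) (x ⊗ₜ[k] y)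
    have h1 : ∀ (Z : H ⊗[k] X.carrier) (Z' : H ⊗[k] Y.carrier),
        coefficient H (LinearMap.mul' k k ∘ₗ TensorProduct.map φ ψ)
          (Coaction.mulMap k H X.carrier Y.carrier (Z ⊗ₜ[k] Z')) =
        coefficient H φ Z * coefficient H ψ Z' := by
      intro Z Z'
      induction Z with
      | zero => simp
      | add Z₁ Z₂ h1 h2 => simp only [TensorProduct.add_tmul, map_add, add_mul, h1, h2]
      | tmul a x =>
        induction Z' with
        | zero => simp
        | add Z₁ Z₂ h1 h2 => simp only [TensorProduct.tmul_add, map_add, mul_add, h1, h2]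
        | tmul b y => simp [smul_smul, mul_comm]
    rw [← h1]
    exact h
  · intros; simp
  · intros; simp
  · intro a b c _ _ _ h1 h2
    rw [add_mul]; exact add_mem h1 h2
  · intro a b c _ _ _ h1 h2
    rw [mul_add]; exact add_mem h1 h2
  · intro r a b _ _ h
    rw [smul_mul_assoc]; exact Submodule.smul_mem _ _ h
  · intro r a b _ _ h
    rw [mul_smul_comm]; exact Submodule.smul_mem _ _ h

variable {M : Type u} [AddCommGroup M] [Module k M]

/-- The subspaces of `H ⊗ M` that are contained in the image of a sum of tensor words `X` under a
comodule map `X → H ⊗ M` given by a linear map `X → M`. -/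
def IsCovered (S : Set (FinComod k H)) (R : Submodule k (H ⊗[k] M)) : Prop :=
  ∃ (X : FinComod k H) (Ψ : X.carrier →ₗ[k] M), IsSumOfTensorWords S X ∧
    R ≤ LinearMap.range (Ψ.lTensor H ∘ₗ X.coaction.coact)

theorem IsCovered.mono {R R' : Submodule k (H ⊗[k] M)} (h : IsCovered S R') (hR : R ≤ R') :
    IsCovered S R := by
  obtain ⟨X, Ψ, hX, h⟩ := h
  exact ⟨X, Ψ, hX, hR.trans h⟩

theorem IsCovered.sup {R R' : Submodule k (H ⊗[k] M)} (h : IsCovered S R) (h' : IsCovered S R') :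
    IsCovered S (R ⊔ R') := by
  obtain ⟨X, Ψ, hX, h⟩ := h
  obtain ⟨X', Ψ', hX', h'⟩ := h'
  refine ⟨_, Ψ.coprod Ψ', .prod X X' hX hX', sup_le (h.trans ?_) (h'.trans ?_)⟩
  · have h1 : Ψ.lTensor H ∘ₗ X.coaction.coact = ((Ψ.coprod Ψ').lTensor H ∘ₗ
        (X.coaction.prod X'.coaction).coact) ∘ₗ LinearMap.inl k X.carrier X'.carrier := by
      rw [Coaction.prod, LinearMap.comp_assoc, LinearMap.coprod_inl, ← LinearMap.comp_assoc,
        ← LinearMap.lTensor_comp, LinearMap.coprod_inl]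
    rw [h1]
    exact LinearMap.range_comp_le_range _ _
  · have h1 : Ψ'.lTensor H ∘ₗ X'.coaction.coact = ((Ψ.coprod Ψ').lTensor H ∘ₗ
        (X.coaction.prod X'.coaction).coact) ∘ₗ LinearMap.inr k X.carrier X'.carrier := by
      rw [Coaction.prod, LinearMap.comp_assoc, LinearMap.coprod_inr, ← LinearMap.comp_assoc,
        ← LinearMap.lTensor_comp, LinearMap.coprod_inr]
    rw [h1]
    exact LinearMap.range_comp_le_range _ _

theorem isCovered_bot : IsCovered S (⊥ : Submodule k (H ⊗[k] M)) :=
  ⟨_, 0, .of _ .unit, bot_le⟩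

theorem IsCovered.span_add {y y' : H ⊗[k] M} (h : IsCovered S (k ∙ y)) (h' : IsCovered S (k ∙ y')) :
    IsCovered S (k ∙ (y + y')) := by
  refine (h.sup h').mono ?_
  rw [Submodule.span_singleton_le_iff_mem]
  exact add_mem (Submodule.mem_sup_left (Submodule.mem_span_singleton_self y))
    (Submodule.mem_sup_right (Submodule.mem_span_singleton_self y'))

/-- A coefficient a = φ(x₍₀₎) x₍₋₁₎ of a tensor word yields a ⊗ m as the image of x under the
comodule map induced by φ(−) m; sums are handled by direct sums of words. -/
theorem isCovered_span_singleton (hS : wordSpan S = ⊤) (y : H ⊗[k] M) : IsCovered S (k ∙ y) := by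
  induction y with
  | zero => exact isCovered_bot.mono (by simp)
  | add y y' h h' => exact h.span_add h'
  | tmul a m =>
    refine Submodule.span_induction (p := fun a _ => IsCovered S (k ∙ (a ⊗ₜ[k] m))) ?_ ?_ ?_ ?_
      (hS ▸ Submodule.mem_top : a ∈ wordSpan S)
    · rintro _ ⟨X, φ, x, hX, rfl⟩
      refine ⟨X, φ.smulRight m, .of X hX, ?_⟩
      rw [Submodule.span_singleton_le_iff_mem]
      refine ⟨x, ?_⟩
      rw [LinearMap.comp_apply]
      generalize X.coaction.coact x = Z
      induction Z with
      | zero => simp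
      | add Z₁ Z₂ h1 h2 => simp only [map_add, TensorProduct.add_tmul, h1, h2]
      | tmul a x => simp [TensorProduct.smul_tmul]
    · exact isCovered_bot.mono (by simp)
    · intro a b _ _ h h'
      rw [TensorProduct.add_tmul]
      exact h.span_add h'
    · intro r a _ h
      refine h.mono ?_
      rw [← TensorProduct.smul_tmul']
      exact Submodule.span_singleton_smul_le k r _

theorem isCovered_of_fg (hS : wordSpan S = ⊤) {R : Submodule k (H ⊗[k] M)} (hR : R.FG) :
    IsCovered S R := by
  induction R, hR using Submodule.fg_induction with
  | singleton y => exact isCovered_span_singleton hS y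
  | sup R R' _ _ h h' => exact h.sup h'

/-- If the matrix coefficients of the tensor products of members of `S` span `H`, then the
comodules are tensorially generated by `S`. -/
theorem isTensorGeneratedBy_of_wordSpan (hS : wordSpan S = ⊤) : IsTensorGeneratedBy S := by
  intro M
  obtain ⟨X, Ψ, hX, h⟩ : IsCovered S (LinearMap.range M.coaction.coact) :=
    isCovered_of_fg hS (Module.Finite.iff_fg.1 inferInstance)
  -- The kernel of this difference is the fibre product of `X` and `M` over the cofree comodule H ⊗
  -- M.
  let F : X.carrier × M.carrier →ₗ[k] H ⊗[k] M.carrier :=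
    (Ψ.lTensor H ∘ₗ X.coaction.coact).coprod (-M.coaction.coact)
  have hF : cofreeComul k H M.carrier ∘ₗ F =
      F.lTensor H ∘ₗ (X.coaction.prod M.coaction).coact := by
    refine LinearMap.prod_ext ?_ ?_
    · rw [LinearMap.comp_assoc, LinearMap.comp_assoc, LinearMap.coprod_inl, Coaction.prod,
        LinearMap.coprod_inl, ← LinearMap.comp_assoc, cofreeComul_lTensor, LinearMap.comp_assoc,
        X.coaction.cofreeComul_coact, ← LinearMap.comp_assoc, ← LinearMap.comp_assoc,
        ← LinearMap.lTensor_comp, ← LinearMap.lTensor_comp, LinearMap.coprod_inl]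
    · rw [LinearMap.comp_assoc, LinearMap.comp_assoc, LinearMap.coprod_inr, Coaction.prod,
        LinearMap.coprod_inr, ← LinearMap.comp_assoc, ← LinearMap.lTensor_comp,
        LinearMap.coprod_inr, LinearMap.lTensor_neg, LinearMap.comp_neg, LinearMap.neg_comp,
        M.coaction.cofreeComul_coact]
  obtain ⟨τ, hτ⟩ := (X.coaction.prod M.coaction).exists_ker F _ hF
  refine ⟨X, ⟨LinearMap.ker F, τ⟩, LinearMap.fst k _ _ ∘ₗ (LinearMap.ker F).subtype,
    LinearMap.snd k _ _ ∘ₗ (LinearMap.ker F).subtype, hX,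
    (X.coaction.isColinear_fst M.coaction).comp hτ, ?_,
    (X.coaction.isColinear_snd M.coaction).comp hτ, fun m => ?_⟩
  -- The projection to `X` is injective because the coaction of `M` is; the projection to `M` is
  -- onto because `X` covers the image of that coaction.
  · refine (injective_iff_map_eq_zero _).2 ?_
    rintro ⟨⟨x, m⟩, hxm⟩ (rfl : x = 0)
    have h1 : M.coaction.coact m = 0 := by simpa [F] using hxm
    have h2 : m = 0 := M.coaction.coact_injective (h1.trans (map_zero _).symm)
    subst h2
    rfl
  · obtain ⟨x, hx⟩ := h ⟨m, rfl⟩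
    exact ⟨⟨(x, m), by simpa [F, add_neg_eq_zero] using hx⟩, rfl⟩

end TensorGeneration

/-! ### Dual families in degree top − 1 and the quantum determinant -/

section DualFamilies

theorem exists_dualBasis {k : Type u} [Field k] {V N : Type*} [AddCommGroup V] [Module k V]
    [AddCommGroup N] [Module k N] [FiniteDimensional k N] {ι : Type*} [Fintype ι] [DecidableEq ι]
    (p : V →ₗ[k] N →ₗ[k] k) (h : Function.Injective p) (h' : Function.Injective p.flip)
    (x : Module.Basis ι k V) :
    ∃ ω : Module.Basis ι k N, ∀ i j, p (x i) (ω j) = if i = j then 1 else 0 := by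
  have : FiniteDimensional k V := x.finiteDimensional_of_finite
  have : p.IsPerfPair := .of_injective h h'
  refine ⟨x.dualBasis.map p.flip.toPerfPair.symm, fun i j => ?_⟩
  simp [Finsupp.single_apply, eq_comm]

namespace WGFAlgebra

variable {k : Type u} [Field k] {A : Type w} [Ring A] [Bialgebra k A]
variable {V : Type v} [AddCommGroup V] [Module k V]
variable {B : Type z} [Ring B] [Algebra k B]
variable {ρ : Coaction k A V} {𝓑 : ℕ → Submodule k B} [GradedAlgebra 𝓑] {W : WGFAlgebra ρ 𝓑}
variable {ι : Type*} [Fintype ι] [DecidableEq ι]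

/-- A functional nonzero on the volume element identifies the top component with 𝕜, and the
non-degenerate product becomes a perfect pairing. Keeping `μ` abstract covers multiplication by V
from either side. -/
theorem exists_dualBasis (b : W.VolumeElement) (x : Module.Basis ι k V) {q : ℕ}
    (μ : V →ₗ[k] B →ₗ[k] B) (hμ : ∀ v, ∀ w ∈ 𝓑 q, μ v w ∈ 𝓑 W.top)
    (hl : ∀ v, (∀ w ∈ 𝓑 q, μ v w = 0) → v = 0) (hr : ∀ w ∈ 𝓑 q, (∀ v, μ v w = 0) → w = 0) :
    ∃ ω : Module.Basis ι k (𝓑 q), ∀ i j, μ (x i) (ω j) = if i = j then b.val else 0 := by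
  have := W.finite
  obtain ⟨φ, hφ⟩ := Module.Projective.exists_dual_ne_zero k b.ne_zero
  have hb : (⟨b.val, b.mem⟩ : 𝓑 W.top) ≠ 0 := fun h => b.ne_zero (congrArg Subtype.val h)
  have htop : ∀ y ∈ 𝓑 W.top, y = ((φ b.val)⁻¹ * φ y) • b.val := fun y hy => by
    obtain ⟨s, hs⟩ := (finrank_eq_one_iff_of_nonzero' _ hb).1 W.finrank_top ⟨y, hy⟩
    have hs' : s • b.val = y := congrArg Subtype.val hs
    rw [← hs', map_smul, smul_eq_mul, mul_comm s, inv_mul_cancel_left₀ hφ]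
  let p : V →ₗ[k] 𝓑 q →ₗ[k] k := (μ.compr₂ ((φ b.val)⁻¹ • φ)).compl₂ (𝓑 q).subtype
  have hp : ∀ v w, μ v (w : 𝓑 q) = p v w • b.val := fun v w => htop _ (hμ v w w.2)
  obtain ⟨ω, hω⟩ := QDet.exists_dualBasis p
    ((injective_iff_map_eq_zero _).2 fun v hv => hl v fun w hw => by
      rw [hp v ⟨w, hw⟩, hv, LinearMap.zero_apply, zero_smul])
    ((injective_iff_map_eq_zero _).2 fun w hw => Subtype.ext <| hr w w.2 fun v => by
      rw [hp v w, ← LinearMap.flip_apply p, hw, LinearMap.zero_apply, zero_smul]) x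
  exact ⟨ω, fun i j => by rw [hp, hω, ite_smul, one_smul, zero_smul]⟩

theorem incl_mem (W : WGFAlgebra ρ 𝓑) (v : V) : W.incl v ∈ 𝓑 1 :=
  W.incl_range ▸ LinearMap.mem_range_self W.incl v

theorem exists_incl (W : WGFAlgebra ρ 𝓑) {a : B} (ha : a ∈ 𝓑 1) : ∃ v, W.incl v = a := by
  rwa [← W.incl_range] at ha

/-- A basis vector makes degree 1 nonzero, so the truncated top − 1 is a true predecessor. For an
empty basis the families below exist vacuously. -/
theorem top_ne_zero {ι : Type*} (W : WGFAlgebra ρ 𝓑) (x : Module.Basis ι k V) (i : ι) : W.top ≠ 0 := by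
  intro h
  have h1 := W.incl_mem (x i)
  rw [W.eq_bot 1 (by omega), Submodule.mem_bot] at h1
  exact x.ne_zero i (W.incl_injective (h1.trans (map_zero _).symm))

/-- The matrix of the coaction on a homogeneous component. -/
theorem exists_coefficients (W : WGFAlgebra ρ 𝓑) {n : ℕ} (ω : Module.Basis ι k (𝓑 n)) :
    ∃ T : Matrix ι ι A, IsCorep k T.transpose ∧
      W.IsCoefficientMatrix (fun j => (ω j : B)) T := by
  obtain ⟨σ, hσ⟩ := W.coaction.exists_restrict (𝓑 n) (W.coact_mem n)
  refine ⟨(σ.matrix ω).transpose, σ.isCorep_matrix ω, fun j => ?_⟩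
  have h := LinearMap.congr_fun hσ (ω j)
  rw [LinearMap.comp_apply, LinearMap.comp_apply, σ.coact_basis ω, map_sum] at h
  exact h

theorem coact_incl {ι : Type*} [Fintype ι] (W : WGFAlgebra ρ 𝓑) {x : Module.Basis ι k V} {t : ι → ι → A}
    (ht : ∀ i, ρ.coact (x i) = ∑ j, t i j ⊗ₜ[k] x j) (i : ι) :
    W.coaction.coact (W.incl (x i)) = ∑ j, t i j ⊗ₜ[k] W.incl (x j) := by
  have h := LinearMap.congr_fun W.incl_colinear (x i)
  rw [LinearMap.comp_apply, LinearMap.comp_apply, ht, map_sum] at h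
  exact h

/-- Apply the multiplicative coaction to x_i ω^j = δ_ij 𝔟 and compare coefficients of 𝔟, which
coacts by D. -/
theorem sum_mul_coefficient (b : W.VolumeElement) {x : Module.Basis ι k V} {t T : ι → ι → A}
    {ω : ι → B} (ht : ∀ i, ρ.coact (x i) = ∑ j, t i j ⊗ₜ[k] x j)
    (hω : ∀ i j, W.incl (x i) * ω j = if i = j then b.val else 0)
    (hT : W.IsCoefficientMatrix ω T) (i j : ι) :
    ∑ l, t i l * T l j = if i = j then (det b).val else 0 := by
  have h := W.coact_mul (W.incl (x i)) (ω j)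
  rw [W.coact_incl ht, hT j, hω, Finset.sum_mul_sum] at h
  simp only [Algebra.TensorProduct.tmul_mul_tmul, hω, TensorProduct.tmul_ite,
    Finset.sum_ite_eq, Finset.mem_univ, if_true,
    ← TensorProduct.sum_tmul] at h
  refine tmul_right_injective b.ne_zero (h.symm.trans ?_)
  split_ifs
  · exact coact_volume b
  · simp

theorem sum_coefficient_mul (b : W.VolumeElement) {x : Module.Basis ι k V} {t T : ι → ι → A}
    {ω : ι → B} (ht : ∀ i, ρ.coact (x i) = ∑ j, t i j ⊗ₜ[k] x j)
    (hω : ∀ i j, ω j * W.incl (x i) = if i = j then b.val else 0)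
    (hT : W.IsCoefficientMatrix ω T) (i j : ι) :
    ∑ l, T l j * t i l = if i = j then (det b).val else 0 := by
  have h := W.coact_mul (ω j) (W.incl (x i))
  rw [W.coact_incl ht, hT j, hω, Finset.sum_mul_sum, Finset.sum_comm] at h
  simp only [Algebra.TensorProduct.tmul_mul_tmul, hω, TensorProduct.tmul_ite,
    Finset.sum_ite_eq, Finset.mem_univ, if_true,
    ← TensorProduct.sum_tmul] at h
  refine tmul_right_injective b.ne_zero (h.symm.trans ?_)
  split_ifs
  · exact coact_volume b
  · simp

theorem exists_rightDual (b : W.VolumeElement) (x : Module.Basis ι k V) :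
    ∃ (ω : ι → B) (T : Matrix ι ι A), IsCorep k T.transpose ∧ IsDualFamily b x ω ∧
      W.IsCoefficientMatrix ω T := by
  cases isEmpty_or_nonempty ι
  · exact ⟨isEmptyElim, isEmptyElim, ⟨isEmptyElim, isEmptyElim⟩, ⟨isEmptyElim, isEmptyElim⟩,
      isEmptyElim⟩
  · obtain ⟨i⟩ := ‹Nonempty ι›
    have hq : W.top - 1 + 1 = W.top := Nat.succ_pred_eq_of_ne_zero (W.top_ne_zero x i)
    obtain ⟨ω, hω⟩ := exists_dualBasis b x (q := W.top - 1) (LinearMap.mul k B ∘ₗ W.incl)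
      (fun v w hw => by
        have h := SetLike.mul_mem_graded (W.incl_mem v) hw
        rwa [add_comm, hq] at h)
      (fun v hv => W.incl_injective <| (W.left_left _ hq _ (W.incl_mem v) hv).trans
        (map_zero _).symm)
      (fun w hw hv => W.left_right _ hq w hw fun a ha => by
        obtain ⟨v, rfl⟩ := W.exists_incl ha
        exact hv v)
    obtain ⟨T, hT, hT'⟩ := W.exists_coefficients ω
    exact ⟨_, T, hT, ⟨fun j => (ω j).2, hω⟩, hT'⟩

theorem exists_leftDual (b : W.VolumeElement) (x : Module.Basis ι k V) :
    ∃ (ω : ι → B) (T : Matrix ι ι A), IsCorep k T.transpose ∧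
      (∀ i j, ω j * W.incl (x i) = if i = j then b.val else 0) ∧ W.IsCoefficientMatrix ω T := by
  cases isEmpty_or_nonempty ι
  · exact ⟨isEmptyElim, isEmptyElim, ⟨isEmptyElim, isEmptyElim⟩, isEmptyElim, isEmptyElim⟩
  · obtain ⟨i⟩ := ‹Nonempty ι›
    have hq : W.top - 1 + 1 = W.top := Nat.succ_pred_eq_of_ne_zero (W.top_ne_zero x i)
    obtain ⟨ω, hω⟩ := exists_dualBasis b x (q := W.top - 1) ((LinearMap.mul k B).flip ∘ₗ W.incl)
      (fun v w hw => by
        have h := SetLike.mul_mem_graded hw (W.incl_mem v)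
        rwa [hq] at h)
      (fun v hv => W.incl_injective <| (W.right_right _ hq _ (W.incl_mem v) hv).trans
        (map_zero _).symm)
      (fun w hw hv => W.right_left _ hq w hw fun a ha => by
        obtain ⟨v, rfl⟩ := W.exists_incl ha
        exact hv v)
    obtain ⟨T, hT, hT'⟩ := W.exists_coefficients ω
    exact ⟨_, T, hT, hω, hT'⟩

end WGFAlgebra

end DualFamilies

section CorepOperations

variable {k : Type u} [Field k] {H : Type w} [Ring H] [Bialgebra k H]
  {m : Type z} [Fintype m] [DecidableEq m]

theorem IsCorep.map {A : Type*} [Ring A] [Bialgebra k A] (f : A →ₗc[k] H) {X : Matrix m m A}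
    (hX : IsCorep k X) : IsCorep k (X.map f) where
  comul i j := by
    rw [Matrix.map_apply, ← CoalgHomClass.map_comp_comul_apply, hX.comul]
    simp
  counit i j := by
    rw [Matrix.map_apply, CoalgHomClass.counit_comp_apply, hX.counit]

theorem IsCorep.mul_groupLike {X : Matrix m m H} (hX : IsCorep k X) {g : H}
    (hg : IsGroupLikeElem k g) : IsCorep k (Matrix.of fun i j => X i j * g) where
  comul i j := by
    simp [Bialgebra.comul_mul, hX.comul, hg.comul_eq_tmul_self, Finset.sum_mul]
  counit i j := by
    simp [Bialgebra.counit_mul, hX.counit, hg.counit_eq_one]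

theorem IsCorep.groupLike_mul {X : Matrix m m H} (hX : IsCorep k X) {g : H}
    (hg : IsGroupLikeElem k g) : IsCorep k (Matrix.of fun i j => g * X i j) where
  comul i j := by
    simp [Bialgebra.comul_mul, hX.comul, hg.comul_eq_tmul_self, Finset.mul_sum]
  counit i j := by
    simp [Bialgebra.counit_mul, hX.counit, hg.counit_eq_one]

end CorepOperations

/-! ### Assembling form and antipode on the localization -/

section Localized

variable {k : Type u} [Field k] {ι : Type w} [Fintype ι] [DecidableEq ι]
  {C C' : ι → ι → ι → ι → k} {D : GroupLike k (FRTAlg C)}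

/-- If the matrix of generators has a right and a left inverse up to the factor `D`, then the
localization at `D` has a coquasitriangular form and a bijective antipode. -/
theorem Loc.exists_pairing_antipode (hC : IsYangBaxter C) (hC' : IsYangBaxter C')
    (h : structureMatrix C * structureMatrix C' = 1) {T T' : Matrix ι ι (FRTAlg C)}
    (hT : IsCorep k T.transpose) (hT' : IsCorep k T'.transpose)
    (h1 : ∀ i j, ∑ l, FRTAlg.t C i l * T l j = if i = j then D.val else 0)
    (h2 : ∀ i j, ∑ l, T' l j * FRTAlg.t C i l = if i = j then D.val else 0) :
    ∃ (Θ : Loc k D.val →ₐ[k] (WithConv (Loc k D.val →ₗ[k] k))ᵐᵒᵖ)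
      (S S' : Loc k D.val →ₐ[k] (Loc k D.val)ᵐᵒᵖ), IsCanonicalPairing Θ ∧ IsAntipode S S' ∧
      antiLinear S (Loc.invD k D.val) = Loc.of k D.val D.val := by
  let p : Matrix ι ι (Loc k D.val) :=
    Matrix.of fun i j => Loc.of k D.val (T i j) * Loc.invD k D.val
  let q : Matrix ι ι (Loc k D.val) :=
    Matrix.of fun i j => Loc.invD k D.val * Loc.of k D.val (T' i j)
  have hp : IsCorep k p.transpose :=
    (hT.map (Loc.ofCoalgHom k D)).mul_groupLike (Loc.isGroupLikeElem_invD k D)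
  have hq : IsCorep k q.transpose :=
    (hT'.map (Loc.ofCoalgHom k D)).groupLike_mul (Loc.isGroupLikeElem_invD k D)
  have htp : ∀ i j, ∑ l, Loc.of k D.val (FRTAlg.t C i l) * p l j = if i = j then 1 else 0 := by
    intro i j
    have h3 := congrArg (fun a => Loc.of k D.val a * Loc.invD k D.val) (h1 i j)
    simp only [map_sum, map_mul, Finset.sum_mul, mul_assoc] at h3
    refine h3.trans ?_
    split_ifs
    · exact Loc.mul_invD k D.val
    · rw [map_zero, zero_mul]
  have hqt : ∀ i j, ∑ l, q l j * Loc.of k D.val (FRTAlg.t C i l) = if i = j then 1 else 0 := by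
    intro i j
    have h3 := congrArg (fun a => Loc.invD k D.val * Loc.of k D.val a) (h2 i j)
    simp only [map_sum, map_mul, Finset.mul_sum, ← mul_assoc] at h3
    refine h3.trans ?_
    split_ifs
    · exact Loc.invD_mul k D.val
    · rw [map_zero, mul_zero]
  obtain ⟨Θ, hΘ1, hΘ2, hΘ3⟩ := hC.exists_pairing hC' h htp
  have hΘ : IsCanonicalPairing Θ := ⟨hΘ1, hΘ2, hΘ3⟩
  obtain ⟨S, S', hS, -, hSD⟩ := Loc.exists_antipode
    (hΘ.isFRTFamily_op hp (hΘ.pairing_rightInverse hp htp))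
    (hΘ.isFRTFamily_op hq (hΘ.pairing_leftInverse hq hqt)) htp hqt
  exact ⟨Θ, S, S', hΘ, hS, hSD⟩

/-- `S` applied to t is a left inverse of t, hence equals any right inverse. So the formula holds
for every admissible `T`, with no appeal to uniqueness of the dual family. -/
theorem IsAntipode.antiLinear_t {S S' : Loc k D.val →ₐ[k] (Loc k D.val)ᵐᵒᵖ} (hS : IsAntipode S S')
    {T : ι → ι → FRTAlg C} (h : ∀ i j, ∑ l, FRTAlg.t C i l * T l j = if i = j then D.val else 0)
    (i j : ι) : antiLinear S (Loc.of k D.val (FRTAlg.t C i j)) =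
      Loc.of k D.val (T i j) * Loc.invD k D.val := by
  have h1 : (Loc.tMatrix D).map (antiLinear S) * Loc.tMatrix D = 1 := by
    ext i j
    rw [Matrix.mul_apply, Matrix.one_apply]
    exact hS.sum_left (Loc.isCorep_tMatrix D) i j
  have h2 : Loc.tMatrix D *
      Matrix.of (fun i j => Loc.of k D.val (T i j) * Loc.invD k D.val) = 1 := by
    ext i j
    have h3 := congrArg (fun a => Loc.of k D.val a * Loc.invD k D.val) (h i j)
    simp only [map_sum, map_mul, Finset.sum_mul, mul_assoc] at h3
    rw [Matrix.mul_apply, Matrix.one_apply]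
    refine h3.trans ?_
    split_ifs
    · exact Loc.mul_invD k D.val
    · rw [map_zero, zero_mul]
  have h3 := left_inv_eq_right_inv h1 h2
  exact congrFun (congrFun h3 i) j

/-- The Hopf algebra structure given by an antipode. -/
abbrev IsAntipode.hopfAlgebra {S S' : Loc k D.val →ₐ[k] (Loc k D.val)ᵐᵒᵖ} (hS : IsAntipode S S') :
    HopfAlgebra k (Loc k D.val) :=
  { Loc.instBialgebraLoc k D with
    antipode := antiLinear S
    mul_antipode_rTensor_comul := LinearMap.ext hS.left
    mul_antipode_lTensor_comul := LinearMap.ext hS.right }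

end Localized

section Words

variable {k : Type u} [Field k] {ι : Type w} [Fintype ι] [DecidableEq ι]

theorem frtCoaction_basis {V : Type v} [AddCommGroup V] [Module k V] (x : Module.Basis ι k V)
    (c : V ⊗[k] V ≃ₗ[k] V ⊗[k] V) (i : ι) :
    (frtCoaction x c).coact (x i) = ∑ j, FRTAlg.t (coeffs x c) i j ⊗ₜ[k] x j := by
  simp only [frtCoaction, Module.Basis.constr_basis]

variable {V : Type u} [AddCommGroup V] [Module k V] [FiniteDimensional k V]
  {x : Module.Basis ι k V} {c : V ⊗[k] V ≃ₗ[k] V ⊗[k] V} {B : Type z} [Ring B] [Algebra k B]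
  {𝓑 : ℕ → Submodule k B} [GradedAlgebra 𝓑] {W : WGFAlgebra (frtCoaction x c) 𝓑}

/-- The span contains the coefficients t_i^j of V and D⁻¹ of 𝕜D⁻¹, and tensor products of words make
it a subalgebra. -/
theorem wordSpan_eq_top (b : W.VolumeElement) : wordSpan {comodV b, comodDetInv b} = ⊤ := by
  refine eq_top_iff.2 fun a _ => ?_
  induction a using Loc.frtInduction with
  | algebraMap r =>
    rw [Algebra.algebraMap_eq_smul_one]
    exact Submodule.smul_mem _ _ one_mem_wordSpan
  | add a b ha hb => exact add_mem (ha trivial) (hb trivial)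
  | mul a b ha hb => exact mul_mem_wordSpan (ha trivial) (hb trivial)
  | t i j =>
    have h := coefficient_mem_wordSpan (S := {comodV b, comodDetInv b})
      (.of (comodV b) (Or.inl rfl)) (x.coord j) (x i)
    have h1 : (comodV b).coaction.coact (x i) =
        ∑ j, toH b (FRTAlg.t (coeffs x c) i j) ⊗ₜ[k] x j := by
      have h2 : (comodV b).coaction.coact (x i) = (Loc.ofCoalgHom k _).toLinearMap.rTensor V
        ((frtCoaction x c).coact (x i)) := rfl
      rw [h2, frtCoaction_basis, map_sum]
      rfl
    rw [h1] at h
    rwa [← coefficient_sum_tmul x (fun j => toH b (FRTAlg.t (coeffs x c) i j)) j]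
  | invD _ =>
    have h : coefficient (HOf b) (LinearMap.id : k →ₗ[k] k) (detInv b ⊗ₜ[k] (1 : k)) ∈
        wordSpan {comodV b, comodDetInv b} :=
      coefficient_mem_wordSpan (.of (comodDetInv b) (Or.inr rfl)) LinearMap.id (1 : k)
    rwa [coefficient_tmul, LinearMap.id_apply, one_smul] at h

end Words

end QDet

end

theorem mainTheorem1 {k V : Type u} [Field k] [AddCommGroup V] [Module k V]
    [FiniteDimensional k V] {ι : Type w} [Fintype ι] [DecidableEq ι]
    (x : Module.Basis ι k V) (c : V ⊗[k] V ≃ₗ[k] V ⊗[k] V)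
    (hc : QDet.IsBraiding c) (hrigid : QDet.IsRigidBraiding x c)
    {B : Type z} [Ring B] [Algebra k B] (𝓑 : ℕ → Submodule k B) [GradedAlgebra 𝓑]
    (W : QDet.WGFAlgebra (QDet.frtCoaction x c) 𝓑) (b : W.VolumeElement)
    (hinj : Function.Injective (QDet.toH b)) :
    -- the category of finite-dimensional comodules is rigid, tensorially generated by `V`, `k D⁻¹`
    QDet.IsRigidComod k (QDet.HOf b) ∧
    QDet.IsTensorGeneratedBy {QDet.comodV b, QDet.comodDetInv b} ∧
    -- `H(c)` is coquasitriangular, by a form extending the canonical one of `A(c)`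
    (∃ r : QDet.HOf b →ₗ[k] QDet.HOf b →ₗ[k] k, QDet.IsCoquasitriangular r ∧
      ∀ i j p q, r (QDet.toH b (QDet.FRTAlg.t (QDet.coeffs x c) i p))
        (QDet.toH b (QDet.FRTAlg.t (QDet.coeffs x c) j q)) = QDet.coeffs x c j i p q) ∧
    -- the family `ω` dual to `x` and its matrix coefficients `T` exist, and the bialgebra `H(c)`
    -- has an antipode, given by the stated formulas
    (∃ (ω : ι → B) (T : ι → ι → QDet.FRTOf x c),
      QDet.WGFAlgebra.IsDualFamily b x ω ∧ W.IsCoefficientMatrix ω T) ∧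
    ∃ hopf : HopfAlgebra k (QDet.HOf b),
      hopf.toBialgebra = QDet.bialgebraH b ∧
      hopf.antipode (QDet.detInv b) = QDet.toH b (QDet.WGFAlgebra.det b).val ∧
      ∀ (ω : ι → B) (T : ι → ι → QDet.FRTOf x c),
        QDet.WGFAlgebra.IsDualFamily b x ω → W.IsCoefficientMatrix ω T →
        ∀ i j, hopf.antipode (QDet.toH b (QDet.FRTAlg.t (QDet.coeffs x c) i j)) =
          QDet.toH b (T i j) * QDet.detInv b := by
  obtain ⟨ω, T, hT, hω, hωT⟩ := QDet.WGFAlgebra.exists_rightDual b x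
  obtain ⟨ω', T', hT', hω', hωT'⟩ := QDet.WGFAlgebra.exists_leftDual b x
  have ht := QDet.frtCoaction_basis x c
  -- The two sides of non-degeneracy enter separately: `T` gives the right inverse T D⁻¹ of t, and
  -- `T'` gives D⁻¹ T' for the opposite order.
  obtain ⟨Θ, S, S', hΘ, hS, hSD⟩ := QDet.Loc.exists_pairing_antipode (hc.isYangBaxter x)
    (hc.symm.isYangBaxter x) (QDet.structureMatrix_mul_symm x c) hT hT'
    (QDet.WGFAlgebra.sum_mul_coefficient b ht hω.2 hωT)
    (QDet.WGFAlgebra.sum_coefficient_mul b ht hω' hωT')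
  exact ⟨hS.isRigidComod, QDet.isTensorGeneratedBy_of_wordSpan (QDet.wordSpan_eq_top b),
    ⟨QDet.pairing Θ, hΘ.isCoquasitriangular hS, fun i j p q => hΘ.pairing_t i j p q⟩,
    ⟨ω, T, hω, hωT⟩, hS.hopfAlgebra, rfl, hSD, fun _ _ hω hT =>
      hS.antiLinear_t (QDet.WGFAlgebra.sum_mul_coefficient b ht hω.2 hT)⟩
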